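/- Let $K\subset\mathbb C$ be an imaginary quadratic field of discriminant $-D$ with ring of integers $\mathfrak o$, let $\chi=\prod_{p\mid D}\chi_p$ be its quadratic character modulo $D$, let $\mathfrak d=\frac{i}{\sqrt D}\mathfrak o$ be the inverse different and $[\mathfrak d]=\mathfrak d/\mathfrak o$. Write $\mathsf e[x]=e^{2\pi i x}$. Let $k\ge 0$ be an integer divisible by $|\mathfrak o^\times|$ and $N$ a positive integer with $\gcd(D,N)=1$. For $\ell\in\mathbb Z$ put $a_D(\ell)=|\{u\in[\mathfrak d] : D|u|^2\equiv-\ell \bmod D\}|$, and let $\mathfrak M^+_{k-1}(DN,\chi)$ be the space of holomorphic modular forms $g=\sum_{\ell\ge0}a_\ell(g)\mathsf e[\ell\tau]$ of weight $k-1$ on $\Gamma_0(DN)$ with nebentypus $\chi$ such that $a_\ell(g)=0$ whenever $a_D(\ell)=0$. A Hermitian Jacobi form of weight $k$, index $1$ and level $N$ is a holomorphic function $\varphi:\mathfrak H\times\mathbb C^2\to\mathbb C$ such that, for all $\epsilon\in\mathfrak o^\times$, $A=\begin{pmatrix}a&b\\c&d\end{pmatrix}\in\Gamma_0(N)$ and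 $\lambda,\mu\in\mathfrak o$, $$\varphi|[\epsilon A]:=(c\tau+d)^{-k}\,\mathsf e\!\left[-\tfrac{czw}{c\tau+d}\right]\varphi\!\left(\tfrac{a\tau+b}{c\tau+d},\tfrac{\epsilon z}{c\tau+d},\tfrac{\bar\epsilon w}{c\tau+d}\right)=\varphi,$$ $$\mathsf e[|\lambda|^2\tau+\bar\lambda z+\lambda w]\,\varphi(\tau,z+\lambda\tau+\mu,w+\bar\lambda\tau+\bar\mu)=\varphi(\tau,z,w),$$ and such that for every $M\in \mathrm{SL}_2(\mathbb Z)$ there is an integer $\nu=\nu(M)\ge 1$, with $\nu(I_2)=1$, and an expansion $$\varphi|[M]=\sum_{\ell\ge0,\ t\in\mathfrak d,\ \nu|t|^2\le\ell}c^M_\varphi(\ell,t)\,\mathsf e\!\left[\tfrac{\ell}{\nu}\tau+\bar tz+tw\right].$$ It is special if $c_\varphi(\ell,t):=c_\varphi^{I_2}(\ell,t)$ depends only on $\ell-|t|^2$; then write $c_\varphi(\ell,t)=\alpha^*_\varphi(D(\ell-|t|^2))$. Let $\mathfrak J^*_{k,1}(N)$ be the space of special forms. For $u\in[\mathfrak d]$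 put $$\vartheta_u(\tau,z,w)=\sum_{a\in u+\mathfrak o}\mathsf e[|a|^2\tau+\bar az+aw].$$ Each $\varphi\in\mathfrak J^*_{k,1}(N)$ has the theta decomposition $\varphi=\sum_{u}f_u\vartheta_u$ with $$f_u(\tau)=\sum_{\ell\ge0,\ \ell\equiv-D|u|^2\,(D)}\alpha^*_\varphi(\ell)\,\mathsf e[\ell\tau/D].$$ Let $$\iota(\varphi):=f_0|_{k-1}W_D,\qquad W_D=\begin{pmatrix}1&0\\N&1\end{pmatrix}\begin{pmatrix}D&y\\0&1\end{pmatrix},$$ where $y$ is any integer with $Ny\equiv-1\bmod D$ and $(f|_{k-1}\begin{pmatrix}a&b\\c&d\end{pmatrix})(\tau)=(c\tau+d)^{-(k-1)}f(\frac{a\tau+b}{c\tau+d})$. **Theorem.** For $g\in\mathfrak M^+_{k-1}(DN,\chi)$ and $u\in[\mathfrak d]$ define $$g_u(\tau)=\chi(N)\,\frac{-i\sqrt D}{a_D(-D|u|^2)}\sum_{\ell\ge0,\ \ell\equiv-D|u|^2\,(D)}a_\ell(g)\,\mathsf e[\ell\tau/D],\qquad \varphi_g=\sum_{u\in[\mathfrak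 d]}g_u\vartheta_u.$$ Then $\varphi_g\in\mathfrak J^*_{k,1}(N)$ and $\iota(\varphi_g)=g$. In particular, $\iota$ is an isomorphism of complex vector spaces $\mathfrak J^*_{k,1}(N)\cong\mathfrak M^+_{k-1}(DN,\chi)$, with inverse $g\mapsto\varphi_g$. -/

import Mathlib

open UpperHalfPlane CongruenceSubgroup Complex
open scoped MatrixGroups ModularForm Manifold

noncomputable section

namespace HermitianMaass

/-- `𝖾[x] = exp(2πix)`. -/
def ef (x : ℂ) : ℂ := Complex.exp (2 * Real.pi * Complex.I * x)

/-! ### The imaginary quadratic field, its inverse different, and its quadratic character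

`K` is a number field with a fixed embedding `ι : K →+* ℂ`; everything below is seen inside `ℂ`. -/

section Field

variable {K : Type*} [Field K] [NumberField K] (ι : K →+* ℂ)

variable (K) in
/-- `D`, where `-D` is the discriminant of the imaginary quadratic field `K`. -/
def absDisc : ℕ := (NumberField.discr K).natAbs

/-- The ring of integers of `K`, as a lattice in `ℂ`. -/
def intLattice : AddSubgroup ℂ :=
  (ι.comp (algebraMap (NumberField.RingOfIntegers K) K)).range.toAddSubgroup

/-- The inverse different `𝔡 = (i/√D) 𝔬`, as a lattice in `ℂ`. -/
def invDiff : AddSubgroup ℂ :=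
  (intLattice ι).map (AddMonoidHom.mulLeft (Complex.I / (Real.sqrt (absDisc K) : ℂ)))

/-- The finite group `[𝔡] = 𝔡/𝔬`. -/
abbrev DiscGroup : Type := invDiff ι ⧸ (intLattice ι).addSubgroupOf (invDiff ι)

/-- For a class `u ∈ [𝔡]`, the number `D|u|²`, which is an integer for each representative of `u`
and whose residue modulo `D` does not depend on the representative. -/
def normD (u : DiscGroup ι) : ℤ :=
  ⌊(absDisc K : ℝ) * Complex.normSq (u.out : ℂ)⌋

/-- `a_D(ℓ)` is the number of `u ∈ [𝔡]` with `D|u|² ≡ -ℓ mod D`. -/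
def aD (ℓ : ℤ) : ℕ :=
  Nat.card {u : DiscGroup ι // normD ι u ≡ -ℓ [ZMOD (absDisc K : ℤ)]}

end Field

/-- The component `χ_p` of the quadratic character of discriminant `-D`, for a prime `p ∣ D`:
the Legendre symbol modulo `p` if `p` is odd; for `p = 2` one of the characters
`(-4|·)`, `(-8|·)`, `(8|·)`. -/
def chiP (D p : ℕ) (n : ℤ) : ℤ :=
  if p = 2 then
    if ¬ 8 ∣ D then ZMod.χ₄ (n : ZMod 4)
    else if (D / 8) % 4 = 1 then ZMod.χ₈' (n : ZMod 8)
    else ZMod.χ₈ (n : ZMod 8)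
  else jacobiSym n p

/-- The quadratic character `χ = ∏_{p ∣ D} χ_p` modulo `D` attached to the imaginary quadratic
field of discriminant `-D`, as a function on the integers. -/
def chi (D : ℕ) (n : ℤ) : ℤ := ∏ p ∈ D.primeFactors, chiP D p n

/-! ### Elliptic modular forms with nebentypus and plus forms -/

/-- The space of holomorphic modular forms of weight `k` for `Γ₁(M)`. -/
abbrev MFGamma1 (M : ℕ) (k : ℤ) : Type :=
  ModularForm ((Gamma1 M).map (Matrix.SpecialLinearGroup.mapGL ℝ)) k

/-- The space `𝔐_k(M, ψ)` of modular forms on `Γ₀(M)` with nebentypus `ψ`, a Dirichlet character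
modulo `M` given through its values on integers. -/
def modularForms (M : ℕ) (k : ℤ) (ψ : ℤ → ℂ) : Submodule ℂ (MFGamma1 M k) where
  carrier := {f | ∀ γ ∈ Gamma0 M, (⇑f ∣[k] γ) = ψ (γ 1 1) • ⇑f}
  zero_mem' := by
    intro γ _
    simp
  add_mem' := by
    intro f g hf hg γ hγ
    have h1 := hf γ hγ
    have h2 := hg γ hγ
    simp only [FunLike.coe_add, SlashAction.add_slash, smul_add, h1, h2]
  smul_mem' := by
    intro c f hf γ hγ
    have h1 := hf γ hγ
    rw [FunLike.coe_smul, ModularForm.SL_smul_slash, h1, smul_comm]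

/-- The `ℓ`-th Fourier coefficient `a_ℓ(f)`, where `f = ∑ a_ℓ(f) 𝖾[ℓτ]`. -/
def coeff {M : ℕ} {k : ℤ} (f : MFGamma1 M k) (ℓ : ℕ) : ℂ :=
  (UpperHalfPlane.qExpansion 1 f).coeff ℓ

theorem one_mem_strictPeriods (M : ℕ) :
    (1 : ℝ) ∈ ((Gamma1 M).map (Matrix.SpecialLinearGroup.mapGL ℝ)).strictPeriods := by
  simp [CongruenceSubgroup.strictPeriods_Gamma1]

theorem coeff_add {M : ℕ} {k : ℤ} (f g : MFGamma1 M k) (ℓ : ℕ) :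
    coeff (f + g) ℓ = coeff f ℓ + coeff g ℓ := by
  simp only [coeff, FunLike.coe_add]
  rw [ModularForm.qExpansion_add one_pos (one_mem_strictPeriods M), map_add]

theorem coeff_smul {M : ℕ} {k : ℤ} (c : ℂ) (f : MFGamma1 M k) (ℓ : ℕ) :
    coeff (c • f) ℓ = c * coeff f ℓ := by
  simp only [coeff, FunLike.coe_smul]
  rw [ModularForm.qExpansion_smul one_pos (one_mem_strictPeriods M)]
  simp

section Spaces

variable {K : Type*} [Field K] [NumberField K] (ι : K →+* ℂ)

/-- The plus space `𝔐_k⁺(DN, χ)`: the forms `g ∈ 𝔐_k(DN, χ)` with `a_ℓ(g) = 0` whenever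
`a_D(ℓ) = 0`. -/
def plusForms (k : ℤ) (N : ℕ) : Submodule ℂ (MFGamma1 (absDisc K * N) k) where
  carrier := {g | g ∈ modularForms (absDisc K * N) k (fun d => (chi (absDisc K) d : ℂ)) ∧
    ∀ ℓ : ℕ, aD ι ℓ = 0 → coeff g ℓ = 0}
  zero_mem' := by
    refine ⟨Submodule.zero_mem _, fun ℓ _ => ?_⟩
    have := coeff_smul (0 : ℂ) (0 : MFGamma1 (absDisc K * N) k) ℓ
    simpa using this
  add_mem' := by
    rintro f g ⟨hf, hf'⟩ ⟨hg, hg'⟩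
    exact ⟨Submodule.add_mem _ hf hg, fun ℓ h => by
      rw [coeff_add, hf' ℓ h, hg' ℓ h, add_zero]⟩
  smul_mem' := by
    rintro c f ⟨hf, hf'⟩
    exact ⟨Submodule.smul_mem _ c hf, fun ℓ h => by rw [coeff_smul, hf' ℓ h, mul_zero]⟩

/-! ### Hermitian Jacobi forms

Functions on `ℍ × ℂ²` are written in curried form `φ τ z w`. -/

/-- The action `φ|_{k,m}[ε A]` for `A ∈ SL₂(ℤ)` and `ε` a unit of `𝔬` (seen in `ℂ`). -/
def slashJ (k : ℤ) (m : ℕ) (ε : ℂ) (A : SL(2, ℤ)) (φ : ℍ → ℂ → ℂ → ℂ) : ℍ → ℂ → ℂ → ℂ :=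
  fun τ z w =>
    let j : ℂ := (A 1 0 : ℂ) * τ + (A 1 1 : ℂ)
    j ^ (-k) * ef (-(m * ((A 1 0 : ℂ) * z * w / j))) *
      φ (A • τ) (ε * z / j) ((starRingEnd ℂ) ε * w / j)

/-- The action `φ|_{k,m}[lam, μ]` for `lam, μ ∈ 𝔬`. -/
def slashH (m : ℕ) (lam μ : ℂ) (φ : ℍ → ℂ → ℂ → ℂ) : ℍ → ℂ → ℂ → ℂ :=
  fun τ z w =>
    ef (m * ((Complex.normSq lam : ℂ) * τ + (starRingEnd ℂ) lam * z + lam * w)) *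
      φ τ (z + lam * τ + μ) (w + (starRingEnd ℂ) lam * τ + (starRingEnd ℂ) μ)

/-- `φ(τ,z,w) = ∑ c(ℓ,t) 𝖾[ℓτ/ν + t̄z + tw]`, the (absolutely convergent) sum being over integers
`ℓ ≥ 0` and `t ∈ 𝔡` with `ν|t|² ≤ ℓm`; the coefficients outside of this range are set to `0`. -/
def HasFourierExpansion (m ν : ℕ) (c : ℕ → invDiff ι → ℂ) (φ : ℍ → ℂ → ℂ → ℂ) : Prop :=
  (∀ (ℓ : ℕ) (t : invDiff ι), (ℓ : ℝ) * m < ν * Complex.normSq (t : ℂ) → c ℓ t = 0) ∧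
  ∀ (τ : ℍ) (z w : ℂ),
    HasSum (fun p : ℕ × invDiff ι =>
      c p.1 p.2 * ef ((p.1 : ℂ) / ν * τ + (starRingEnd ℂ) (p.2 : ℂ) * z + (p.2 : ℂ) * w)) (φ τ z w)

/-- `φ` is a Hermitian Jacobi form of weight `k`, index `m` and level `N`. -/
structure IsJacobiForm (k : ℤ) (m N : ℕ) (φ : ℍ → ℂ → ℂ → ℂ) : Prop where
  holo : DifferentiableOn ℂ (fun p : ℂ × ℂ × ℂ => φ (UpperHalfPlane.ofComplex p.1) p.2.1 p.2.2)
    {p | 0 < p.1.im}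
  modular : ∀ (ε : (NumberField.RingOfIntegers K)ˣ), ∀ A ∈ Gamma0 N,
    slashJ k m (ι (ε : NumberField.RingOfIntegers K)) A φ = φ
  elliptic : ∀ lam ∈ intLattice ι, ∀ μ ∈ intLattice ι, slashH m lam μ φ = φ
  fourier : ∀ A : SL(2, ℤ), ∃ ν : ℕ, 0 < ν ∧ (A = 1 → ν = 1) ∧
    ∃ c, HasFourierExpansion ι m ν c (slashJ k m 1 A φ)

/-- `φ` has a Fourier expansion whose coefficients `c(ℓ,t)` only depend on `ℓ - |t|²`. (Fourier
coefficients are unique.) -/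
def IsSpecial (φ : ℍ → ℂ → ℂ → ℂ) : Prop :=
  ∃ c, HasFourierExpansion ι 1 1 c φ ∧
    ∀ (ℓ ℓ' : ℕ) (t t' : invDiff ι),
      (ℓ : ℝ) - Complex.normSq (t : ℂ) = ℓ' - Complex.normSq (t' : ℂ) → c ℓ t = c ℓ' t'

variable {ι}

theorem HasFourierExpansion.add {m ν : ℕ} {c c' : ℕ → invDiff ι → ℂ} {φ φ' : ℍ → ℂ → ℂ → ℂ}
    (h : HasFourierExpansion ι m ν c φ) (h' : HasFourierExpansion ι m ν c' φ') :
    HasFourierExpansion ι m ν (c + c') (φ + φ') := by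
  refine ⟨fun ℓ t hl => ?_, fun τ z w => ?_⟩
  · simp [h.1 ℓ t hl, h'.1 ℓ t hl]
  · simpa [add_mul] using (h.2 τ z w).add (h'.2 τ z w)

theorem HasFourierExpansion.smul {m ν : ℕ} {c : ℕ → invDiff ι → ℂ} {φ : ℍ → ℂ → ℂ → ℂ}
    (h : HasFourierExpansion ι m ν c φ) (a : ℂ) :
    HasFourierExpansion ι m ν (a • c) (a • φ) := by
  refine ⟨fun ℓ t hl => ?_, fun τ z w => ?_⟩
  · simp [h.1 ℓ t hl]
  · simpa [mul_assoc] using (h.2 τ z w).mul_left a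

theorem hasFourierExpansion_zero (m ν : ℕ) :
    HasFourierExpansion ι m ν (fun _ _ => 0) (0 : ℍ → ℂ → ℂ → ℂ) := by
  refine ⟨fun ℓ t hl => rfl, fun τ z w => ?_⟩
  simp [hasSum_zero]

/-- An expansion in `𝖾[τ/ν]` is also an expansion in `𝖾[τ/(rν)]`. -/
theorem HasFourierExpansion.rescale {m ν : ℕ} {c : ℕ → invDiff ι → ℂ} {φ : ℍ → ℂ → ℂ → ℂ}
    (h : HasFourierExpansion ι m ν c φ) {r : ℕ} (hr : 0 < r) :
    HasFourierExpansion ι m (r * ν) (fun ℓ t => if r ∣ ℓ then c (ℓ / r) t else 0) φ := by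
  have hr' : (0 : ℝ) < r := by exact_mod_cast hr
  have hrc : (r : ℂ) ≠ 0 := by exact_mod_cast hr.ne'
  refine ⟨fun ℓ t hl => ?_, fun τ z w => ?_⟩
  · dsimp only
    split_ifs with hd
    · obtain ⟨l, rfl⟩ := hd
      rw [Nat.mul_div_cancel_left _ hr]
      apply h.1
      push_cast at hl
      have : (r : ℝ) * (l * m) < r * (ν * Complex.normSq (t : ℂ)) := by linarith
      exact lt_of_mul_lt_mul_left this hr'.le
    · rfl
  · have hinj : Function.Injective (fun p : ℕ × invDiff ι => (r * p.1, p.2)) := by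
      rintro ⟨a, b⟩ ⟨a', b'⟩ hab
      simp only [Prod.mk.injEq] at hab
      exact Prod.ext (Nat.eq_of_mul_eq_mul_left hr hab.1) hab.2
    refine (hinj.hasSum_iff ?_).mp ?_
    · rintro ⟨l, t⟩ hnot
      have : ¬ r ∣ l := by
        rintro ⟨l', rfl⟩
        exact hnot ⟨(l', t), rfl⟩
      simp [this]
    · convert h.2 τ z w using 2 with p
      simp only [Function.comp, dvd_mul_right, if_true, Nat.mul_div_cancel_left _ hr]
      congr 3
      push_cast
      rw [mul_div_mul_left _ _ hrc]

theorem slashJ_add (k : ℤ) (m : ℕ) (ε : ℂ) (A : SL(2, ℤ)) (φ φ' : ℍ → ℂ → ℂ → ℂ) :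
    slashJ k m ε A (φ + φ') = slashJ k m ε A φ + slashJ k m ε A φ' := by
  funext τ z w
  simp [slashJ, mul_add]

theorem slashJ_smul (k : ℤ) (m : ℕ) (ε : ℂ) (A : SL(2, ℤ)) (a : ℂ) (φ : ℍ → ℂ → ℂ → ℂ) :
    slashJ k m ε A (a • φ) = a • slashJ k m ε A φ := by
  funext τ z w
  simp [slashJ, mul_left_comm]

theorem slashJ_zero (k : ℤ) (m : ℕ) (ε : ℂ) (A : SL(2, ℤ)) :
    slashJ k m ε A (0 : ℍ → ℂ → ℂ → ℂ) = 0 := by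
  funext τ z w
  simp [slashJ]

variable (ι)

/-- The space `𝔍_{k,m}(N)` of Hermitian Jacobi forms. -/
def jacobiForms (k : ℤ) (m N : ℕ) : Submodule ℂ (ℍ → ℂ → ℂ → ℂ) where
  carrier := {φ | IsJacobiForm ι k m N φ}
  zero_mem' := by
    refine ⟨differentiableOn_const (0 : ℂ), fun ε A _ => slashJ_zero k m _ A,
      fun lam _ μ _ => ?_, fun A => ⟨1, one_pos, fun _ => rfl, fun _ _ => 0, ?_⟩⟩
    · funext τ z w
      simp [slashH]
    · rw [slashJ_zero]
      exact hasFourierExpansion_zero m 1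
  add_mem' := by
    intro φ φ' h h'
    refine ⟨h.holo.add h'.holo, fun ε A hA => ?_, fun lam hlam μ hμ => ?_, fun A => ?_⟩
    · rw [slashJ_add, h.modular ε A hA, h'.modular ε A hA]
    · have h1 := h.elliptic lam hlam μ hμ
      have h2 := h'.elliptic lam hlam μ hμ
      conv_rhs => rw [← h1, ← h2]
      funext τ z w
      simp [slashH, mul_add]
    · obtain ⟨ν, hν, hν1, c, hc⟩ := h.fourier A
      obtain ⟨ν', hν', hν1', c', hc'⟩ := h'.fourier A
      refine ⟨ν' * ν, Nat.mul_pos hν' hν, fun hA => by rw [hν1 hA, hν1' hA], ?_⟩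
      have hc2 := hc'.rescale hν
      rw [mul_comm ν ν'] at hc2
      rw [slashJ_add]
      exact ⟨_, (hc.rescale hν').add hc2⟩
  smul_mem' := by
    intro a φ h
    refine ⟨h.holo.const_smul a, fun ε A hA => ?_, fun lam hlam μ hμ => ?_, fun A => ?_⟩
    · rw [slashJ_smul, h.modular ε A hA]
    · conv_rhs => rw [← h.elliptic lam hlam μ hμ]
      funext τ z w
      simp [slashH, mul_left_comm]
    · obtain ⟨ν, hν, hν1, c, hc⟩ := h.fourier A
      rw [slashJ_smul]
      exact ⟨ν, hν, hν1, _, hc.smul a⟩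

/-- The space `𝔍*_{k,1}(N)` of special Hermitian Jacobi forms. -/
def specialJacobiForms (k : ℤ) (N : ℕ) : Submodule ℂ (ℍ → ℂ → ℂ → ℂ) where
  carrier := {φ | φ ∈ jacobiForms ι k 1 N ∧ IsSpecial ι φ}
  zero_mem' := ⟨Submodule.zero_mem _, _, hasFourierExpansion_zero 1 1, fun _ _ _ _ _ => rfl⟩
  add_mem' := by
    rintro φ φ' ⟨h, c, hc, hs⟩ ⟨h', c', hc', hs'⟩
    refine ⟨Submodule.add_mem _ h h', _, hc.add hc', fun ℓ ℓ' t t' hl => ?_⟩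
    simp [hs ℓ ℓ' t t' hl, hs' ℓ ℓ' t t' hl]
  smul_mem' := by
    rintro a φ ⟨h, c, hc, hs⟩
    refine ⟨Submodule.smul_mem _ a h, _, hc.smul a, fun ℓ ℓ' t t' hl => ?_⟩
    simp [hs ℓ ℓ' t t' hl]

/-! ### Theta decomposition and the map from special Jacobi forms to elliptic modular forms -/

/-- `ϑ_u(τ,z,w) = ∑_{a ∈ u + 𝔬} 𝖾[|a|²τ + āz + aw]`. -/
def theta (u : DiscGroup ι) (τ : ℍ) (z w : ℂ) : ℂ :=
  ∑' a : {a : invDiff ι // (QuotientAddGroup.mk a : DiscGroup ι) = u},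
    ef ((Complex.normSq (a.1 : ℂ) : ℂ) * τ + (starRingEnd ℂ) (a.1 : ℂ) * z + (a.1 : ℂ) * w)

open Classical in
/-- The Fourier coefficients `c_φ(ℓ,t)` of a function with a Fourier expansion of index `1`. -/
def jacobiCoeff (φ : ℍ → ℂ → ℂ → ℂ) : ℕ → invDiff ι → ℂ :=
  if h : ∃ c, HasFourierExpansion ι 1 1 c φ then h.choose else 0

open Classical in
/-- The coefficients `α*_φ(ℓ)` of a special Jacobi form: `α*_φ(D(m - |u|²)) = c_φ(m,u)`, and
`α*_φ(ℓ) = 0` if `ℓ` is not of the form `D(m - |u|²)`. -/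
def alphaStar (φ : ℍ → ℂ → ℂ → ℂ) (ℓ : ℕ) : ℂ :=
  if h : ∃ p : ℕ × invDiff ι, (ℓ : ℝ) = absDisc K * (p.1 - Complex.normSq (p.2 : ℂ)) then
    jacobiCoeff ι φ h.choose.1 h.choose.2 else 0

open Classical in
/-- The components `f_u(τ) = ∑_{ℓ ≥ 0, ℓ ≡ -D|u|² mod D} α*_φ(ℓ) 𝖾[ℓτ/D]` of the theta
decomposition `φ = ∑_u f_u ϑ_u` of a special Jacobi form. -/
def thetaComponent (φ : ℍ → ℂ → ℂ → ℂ) (u : DiscGroup ι) (τ : ℍ) : ℂ :=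
  ∑' ℓ : ℕ, if (ℓ : ℤ) ≡ -normD ι u [ZMOD (absDisc K : ℤ)] then
    alphaStar ι φ ℓ * ef ((ℓ : ℂ) * τ / absDisc K) else 0

/-- The action `(f|_k W)(τ) = (cτ+d)^{-k} f((aτ+b)/(cτ+d))` (no power of the determinant) of an
integral matrix `W` of positive determinant. -/
def slashW (k : ℤ) (W : Matrix (Fin 2) (Fin 2) ℤ) (f : ℍ → ℂ) : ℍ → ℂ := fun τ =>
  ((W 1 0 : ℂ) * τ + (W 1 1 : ℂ)) ^ (-k) *
    f (UpperHalfPlane.ofComplex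
      (((W 0 0 : ℂ) * τ + (W 0 1 : ℂ)) / ((W 1 0 : ℂ) * τ + (W 1 1 : ℂ))))

/-- The function `f_0|_{k-1} W_D` attached to a special Jacobi form `φ = ∑_u f_u ϑ_u` of weight `k`
and level `N`, where `W_D = (1 0; N 1)(D y; 0 1)`. -/
def toElliptic (k : ℤ) (N : ℕ) (y : ℤ) (φ : ℍ → ℂ → ℂ → ℂ) : ℍ → ℂ :=
  slashW (k - 1) (!![1, 0; (N : ℤ), 1] * !![(absDisc K : ℤ), y; 0, 1]) (thetaComponent ι φ 0)

variable {ι}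

open Classical in
/-- `g_u(τ) = χ(N) (-i√D / a_D(-D|u|²)) ∑_{ℓ ≥ 0, ℓ ≡ -D|u|² mod D} a_ℓ(g) 𝖾[ℓτ/D]`. -/
def liftComponent {M : ℕ} {k : ℤ} (ι : K →+* ℂ) (N : ℕ) (g : MFGamma1 M k) (u : DiscGroup ι)
    (τ : ℍ) : ℂ :=
  (chi (absDisc K) N : ℂ) *
    (-Complex.I * (Real.sqrt (absDisc K) : ℂ) / (aD ι (-normD ι u) : ℂ)) *
    ∑' ℓ : ℕ, if (ℓ : ℤ) ≡ -normD ι u [ZMOD (absDisc K : ℤ)] then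
      coeff g ℓ * ef ((ℓ : ℂ) * τ / absDisc K) else 0

/-- `φ_g = ∑_{u ∈ [𝔡]} g_u ϑ_u` (the group `[𝔡]` is finite, of order `D`). -/
def phiLift {M : ℕ} {k : ℤ} (ι : K →+* ℂ) (N : ℕ) (g : MFGamma1 M k) : ℍ → ℂ → ℂ → ℂ :=
  fun τ z w => ∑ᶠ u : DiscGroup ι, liftComponent ι N g u τ * theta ι u τ z w

end Spaces

end HermitianMaass

end

open HermitianMaass

/-! For fixed `τ` the functions `ϑ_u` are linearly independent, and in weight 1 they span a unitary
representation `ρ` of `SL₂(ℤ)`, the Weil representation of `[𝔡]`. So a theta expansion `∑ f_u ϑ_u`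
is invariant under `A` exactly when `f_v|A = ∑_u conj(ρ(A)_{vu}) f_u` in weight `k-1`
(`slashJ_sum_theta_eq_iff`), and the theorem becomes a statement about vectors `(f_u)`.

Three facts about `ρ` are needed. `ρ(T)` is diagonal with entries `𝖾[|u|²]`. `ρ(S)` is `-i/√D` times
the character table of `[𝔡]`; this is the inversion formula, which exchanges `𝔬` with its trace dual
`𝔡` and is deduced from the functional equation of Jacobi theta functions. On `Γ₀(D)`, `ϑ_0` is
multiplied by `χ(d)`: for prime `d` this is a Gauss sum over a finite field, and Dirichlet's theorem
on primes in progressions reduces every `d` to a prime. Conjugation by `S` then shows that the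
constant function `1` on `[𝔡]` transforms by `χ` under `Γ⁰(D)` in the dual representation.

From Jacobi forms to plus forms: for a special `φ` the sum `F = ∑ f_u` has `a_D(ℓ) α*(ℓ)` as
coefficients and transforms by `χ` under `Γ₀(N) ∩ Γ⁰(D)`, so a multiple of `F(Dτ)` is a plus form,
whose lift is `φ` (`exists_phiLift_eq`).

The main difficulty is that the lift of a plus form `g` is modular. Set `G(τ) = g(τ/D)`. Both `G`
and the constant `1` are "plus vectors": they transform by `χ` under `Γ₀(N) ∩ Γ⁰(D)`, and at every
`p ∣ D` certain combinations of their `T`-translates vanish. For `1` the vanishing holds because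
`D|u|²` is a norm and so never has `χ_p = -1`; for `G` it is the plus condition. The key lemma
`IsPlusVector.act_mem` says that for any plus vector the span of the `T`-translates contains every
translate by `Γ₀(N)`. It is applied to the pair `(G, 1)`: the linear map `L(x) = ∑ x_u g_u` sends
`1|T^n` to a constant multiple of `G|T^n`, so the graph of this relation contains all `T`-translates
of the pair, hence all its `Γ₀(N)`-translates. Therefore `L` intertwines the two actions on the
functions of `D|u|²`, which gives the transformation law of the `g_u` (`liftComponent_slash`).

Finally, the zeroth row of `ρ((1 0; N 1)T^y)` is constant, so `g_0|W_D` is a multiple of `(∑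
g_u)(Dτ)`, and the normalisation makes it equal to `g`. Thus `ι` is a left inverse of the lift, and
the lift is onto. -/

noncomputable section

namespace HermitianMaass

section


/-- `-D` is a fundamental discriminant. -/
def IsFundamental (D : ℕ) : Prop :=
  (D % 4 = 3 ∧ Squarefree D) ∨ ∃ m, D = 4 * m ∧ (m % 4 = 1 ∨ m % 4 = 2) ∧ Squarefree m

/-- `ω = (D + √-D)/2`, which together with `1` generates the ring of integers. -/
def omega (D : ℕ) : ℂ := ((D : ℂ) + Complex.I * (Real.sqrt D : ℂ)) / 2

/-! ### Discriminant and ring of integers of an imaginary quadratic field -/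

section QuadraticField

open NumberField Module

variable {K : Type*} [Field K] [NumberField K]

/-- The vector `1` is primitive: a prime dividing both of its coordinates would be a unit of `𝓞 K`,
hence of `ℤ`. Bézout coefficients of the coordinates then give a complementary basis vector. -/
theorem exists_basis_one (hdeg : Module.finrank ℚ K = 2) :
    ∃ b : Basis (Fin 2) ℤ (𝓞 K), b 0 = 1 := by
  have hr : Module.finrank ℤ (𝓞 K) = 2 := by rw [RingOfIntegers.rank, hdeg]
  let e : Basis (Fin 2) ℤ (𝓞 K) := Module.finBasisOfFinrankEq ℤ (𝓞 K) hr
  set m := e.repr 1 0 with hm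
  set n := e.repr 1 1 with hn
  have h1 : (1 : 𝓞 K) = m • e 0 + n • e 1 := by
    have := e.sum_repr 1
    rw [Fin.sum_univ_two] at this
    exact this.symm
  have hcop : IsCoprime m n := by
    rw [Int.isCoprime_iff_gcd_eq_one]
    by_contra hg
    obtain ⟨p, hp, hpd⟩ := Nat.exists_prime_and_dvd hg
    obtain ⟨m', hm'⟩ : (p : ℤ) ∣ m := (Int.natCast_dvd_natCast.mpr hpd).trans (Int.gcd_dvd_left ..)
    obtain ⟨n', hn'⟩ : (p : ℤ) ∣ n := (Int.natCast_dvd_natCast.mpr hpd).trans (Int.gcd_dvd_right ..)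
    have h2 : (p : ℤ) • (m' • e 0 + n' • e 1) = (1 : 𝓞 K) := by
      rw [h1, hm', hn', smul_add, smul_smul, smul_smul]
    have h3 : IsUnit (p : ℤ) := by
      have hu : IsUnit (algebraMap ℤ (𝓞 K) p) := by
        refine IsUnit.of_mul_eq_one (m' • e 0 + n' • e 1) ?_
        rw [← Algebra.smul_def, h2]
      by_contra hnu
      have hloc : IsLocalHom (algebraMap ℤ (𝓞 K)) := by
        infer_instance
      exact hnu ((isUnit_map_iff (algebraMap ℤ (𝓞 K)) _).mp hu)
    exact (Nat.prime_iff_prime_int.mp hp).not_isUnit h3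
  obtain ⟨u, v, huv⟩ := hcop
  let eta : 𝓞 K := (-v) • e 0 + u • e 1
  have hdet : e.det ![1, eta] = 1 := by
    rw [Basis.det_apply, Matrix.det_fin_two]
    have heta0 : e.repr eta 0 = -v := by
      simp only [eta, map_add, map_smul, e.repr_self, Finsupp.add_apply, Finsupp.smul_apply]; simp
    have heta1 : e.repr eta 1 = u := by
      simp only [eta, map_add, map_smul, e.repr_self, Finsupp.add_apply, Finsupp.smul_apply]; simp
    simp only [Basis.toMatrix_apply, Matrix.cons_val_zero, Matrix.cons_val_one]
    rw [heta0, heta1, ← hm, ← hn]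
    linarith
  have hb := e.is_basis_iff_det.mpr (by rw [hdet]; exact isUnit_one)
  exact ⟨Basis.mk hb.1 hb.2.ge, by simp⟩

/-- With `η² = tη - n` the trace matrix of `(1, η)` is `(2, t; t, t² - 2n)`. -/
theorem discr_of_basis_one (b : Basis (Fin 2) ℤ (𝓞 K)) (hb : b 0 = 1) :
    ∃ t n : ℤ, b 1 * b 1 = t • b 1 - n • 1 ∧ discr K = t ^ 2 - 4 * n := by
  set eta := b 1 with heta
  have h2 := b.sum_repr (eta * eta)
  rw [Fin.sum_univ_two, hb, ← heta] at h2
  set t := b.repr (eta * eta) 1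
  set m := b.repr (eta * eta) 0
  have r0 : b.repr 1 = Finsupp.single 0 1 := by rw [← hb, b.repr_self]
  have r1 : b.repr eta = Finsupp.single 1 1 := by rw [heta, b.repr_self]
  have htr1 : Algebra.trace ℤ (𝓞 K) 1 = 2 := by
    rw [Algebra.trace_eq_matrix_trace b, Matrix.trace_fin_two, Algebra.leftMulMatrix_eq_repr_mul,
      Algebra.leftMulMatrix_eq_repr_mul]
    simp
  have htreta : Algebra.trace ℤ (𝓞 K) eta = t := by
    rw [Algebra.trace_eq_matrix_trace b, Matrix.trace_fin_two, Algebra.leftMulMatrix_eq_repr_mul,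
      Algebra.leftMulMatrix_eq_repr_mul, hb, ← heta, mul_one, r1]
    simp [t]
  refine ⟨t, -m, by rw [← h2]; simp [add_comm], ?_⟩
  have htr2 : Algebra.trace ℤ (𝓞 K) (eta * eta) = m * 2 + t * t := by
    rw [← h2, map_add, map_smul, map_smul, htr1, htreta]; simp
  rw [← NumberField.discr_eq_discr K b, Algebra.discr_def, Matrix.det_fin_two]
  simp only [Algebra.traceMatrix_apply, Algebra.traceForm_apply, hb, ← heta, one_mul, mul_one, htr1,
    htreta, htr2]
  ring

theorem isIntegral_of_mul_self_eq {L : Type*} [Field L] {x : L} {u v : ℤ} (h : x * x = u * x + v) : IsIntegral ℤ x := by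
  refine ⟨Polynomial.X ^ 2 - Polynomial.C u * Polynomial.X - Polynomial.C v, by monicity!, ?_⟩
  rw [← Polynomial.aeval_def]
  simp [sq, h]

theorem natCast_absDisc (hdisc : discr K < 0) : (absDisc K : ℤ) = -discr K := by
  rw [absDisc, Int.natCast_natAbs, abs_of_neg hdisc]

/-- An integral element has integral coordinates in the basis `(1, η)`. This is tested on `(2η -
t)/q`, where `2η - t` is a square root of the discriminant, and, for `D = 4m`, on the halves of
`√-m` and `1 + √-m`. -/
theorem isFundamental_absDisc (hdeg : Module.finrank ℚ K = 2) (hdisc : discr K < 0) :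
    IsFundamental (absDisc K) := by
  obtain ⟨b, hb⟩ := exists_basis_one hdeg
  obtain ⟨t, n, heta, hd⟩ := discr_of_basis_one b hb
  have hD := natCast_absDisc hdisc
  set D := absDisc K
  set eta := b 1 with hetadef
  have hcoef : ∀ (z : 𝓞 K) (q r s : ℤ), q • z = r • eta + s • 1 → q ∣ r := by
    intro z q r s h
    refine ⟨b.repr z 1, ?_⟩
    have := congrArg (fun x => b.repr x 1) h
    simp only [map_smul, map_add, ← hb, hetadef, b.repr_self, Finsupp.smul_apply, Finsupp.add_apply]
      at this
    simpa using this.symm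
  have hKeta : (eta : K) * eta = t * eta - n := by
    have := congrArg (algebraMap (𝓞 K) K) heta
    simpa using this
  have hint : ∀ (x : K) (u v : ℤ), x * x = u * x + v → ∃ z : 𝓞 K, (z : K) = x := by
    intro x u v h
    exact ⟨⟨x, isIntegral_of_mul_self_eq h⟩, rfl⟩
  have hlift : ∀ (x : K) (u v : ℤ), x * x = u * x + v → ∀ q r s : ℤ,
      (q : K) * x = r * eta + s → q ∣ r := by
    intro x u v h q r s hx
    obtain ⟨z, hz⟩ := hint x u v h
    refine hcoef z q r s ?_
    apply RingOfIntegers.ext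
    push_cast [← hz] at hx ⊢
    simpa using hx
  -- The square of `(2η - t)/q` is `-D/q² = -w`, so this element is integral and its `η`-coordinate
  -- `2/q` must be an integer.
  have hsq : ∀ q : ℤ, q ≠ 0 → q * q ∣ (D : ℤ) → q ∣ 2 := by
    intro q hq ⟨w, hw⟩
    have hqK : (q : K) ≠ 0 := by exact_mod_cast hq
    refine hlift ((2 * eta - t) / q) 0 (-w) ?_ q 2 (-t) ?_
    · have h4 : ((2 : K) * eta - t) * (2 * eta - t) = -(q * q * w) := by
        have : ((q * q * w : ℤ) : K) = ((4 * n - t ^ 2 : ℤ) : K) := by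
          rw [← hw, hD, hd]; ring_nf
        push_cast at this
        rw [this]
        linear_combination 4 * hKeta
      rw [div_mul_div_comm, h4]
      field_simp
      push_cast; ring
    · field_simp
      push_cast; ring
  have hmod : D % 4 = 0 ∨ D % 4 = 3 := by
    have : (D : ℤ) = 4 * n - t ^ 2 := by rw [hD, hd]; ring
    rcases Int.even_or_odd' t with ⟨s, hs | hs⟩
    · left
      have : (D : ℤ) = 4 * (n - s ^ 2) := by rw [this, hs]; ring
      omega
    · right
      have : (D : ℤ) = 4 * (n - s ^ 2 - s) - 1 := by rw [this, hs]; ring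
      omega
  have hodd : ∀ p : ℕ, p.Prime → p ≠ 2 → ¬ p * p ∣ D := by
    intro p hp hp2 hpd
    have h := hsq p (by exact_mod_cast hp.ne_zero) (by exact_mod_cast hpd)
    have h' : p ∣ 2 := by exact_mod_cast h
    exact hp2 ((Nat.prime_dvd_prime_iff_eq hp Nat.prime_two).mp h')
  rcases hmod with h0 | h3
  · right
    obtain ⟨m, hm⟩ := Nat.dvd_of_mod_eq_zero h0
    have htn : (4 : ℤ) * m = 4 * n - t ^ 2 := by
      have : (D : ℤ) = 4 * n - t ^ 2 := by rw [hD, hd]; ring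
      rw [← this, hm]; push_cast; ring
    obtain ⟨s, hs⟩ : ∃ s, t = 2 * s := by
      rcases Int.even_or_odd' t with ⟨s, hs | hs⟩
      · exact ⟨s, hs⟩
      · exfalso
        rw [hs] at htn
        ring_nf at htn
        omega
    have hmn : (m : ℤ) = n - s ^ 2 := by rw [hs] at htn; linarith [htn]
    have hδ : ((eta : K) - s) * (eta - s) = -m := by
      have : (m : K) = ((n - s ^ 2 : ℤ) : K) := by rw [← hmn]; simp
      rw [this]
      push_cast
      rw [hs] at hKeta
      push_cast at hKeta
      linear_combination hKeta
    -- For `m = 4w - 1` the element `(1 + √-m)/2` is a root of `x² - x + w`, yet has `η`-coordinate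
    -- `1/2`.
    have hnot3 : m % 4 ≠ 3 := by
      intro h3
      obtain ⟨w, hw⟩ : ∃ w : ℤ, (m : ℤ) = 4 * w - 1 := ⟨m / 4 + 1, by omega⟩
      have h2 := hlift ((1 + (eta - s)) / 2) 1 (-w) ?_ 2 1 (1 - s) ?_
      · norm_num at h2
      · have hw' : (m : K) = 4 * w - 1 := by exact_mod_cast congrArg (Int.cast : ℤ → K) hw
        rw [hw'] at hδ
        push_cast
        linear_combination hδ / 4
      · push_cast; ring
    -- For `m = 4w` the element `√-m/2` has square `-w`.
    have hnot0 : m % 4 ≠ 0 := by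
      intro h0
      obtain ⟨w, hw⟩ : ∃ w : ℤ, (m : ℤ) = 4 * w := ⟨m / 4, by omega⟩
      have h2 := hlift ((eta - s) / 2) 0 (-w) ?_ 2 1 (- s) ?_
      · norm_num at h2
      · have hw' : (m : K) = 4 * w := by exact_mod_cast congrArg (Int.cast : ℤ → K) hw
        rw [hw'] at hδ
        push_cast
        linear_combination hδ / 4
      · push_cast; ring
    refine ⟨m, hm, by omega, Nat.squarefree_iff_prime_squarefree.mpr ?_⟩
    intro p hp hpd
    by_cases hp2 : p = 2
    · subst hp2; omega
    · exact hodd p hp hp2 (hm ▸ hpd.mul_left 4)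
  · left
    refine ⟨h3, Nat.squarefree_iff_prime_squarefree.mpr ?_⟩
    intro p hp hpd
    by_cases hp2 : p = 2
    · subst hp2; omega
    · exact hodd p hp hp2 hpd

/-- The second basis vector goes to `(t ± √-D)/2` with `t ≡ D mod 2`, which differs from `ω` or `-ω`
by an integer. -/
theorem mem_intLattice (ι : K →+* ℂ) (hdeg : Module.finrank ℚ K = 2) (hdisc : discr K < 0) (x : ℂ) :
    x ∈ intLattice ι ↔ ∃ a b : ℤ, x = a + b * omega (absDisc K) := by
  obtain ⟨b, hb⟩ := exists_basis_one hdeg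
  obtain ⟨t, n, heta, hd⟩ := discr_of_basis_one b hb
  have hD := natCast_absDisc hdisc
  set D := absDisc K
  set f := ι.comp (algebraMap (𝓞 K) K) with hf
  set y := f (b 1) with hy
  have hmem : x ∈ intLattice ι ↔ ∃ a c : ℤ, x = a + c * y := by
    constructor
    · rintro ⟨z, rfl⟩
      refine ⟨b.repr z 0, b.repr z 1, ?_⟩
      have h := congrArg f (b.sum_repr z)
      rw [Fin.sum_univ_two, hb, map_add, zsmul_eq_mul, zsmul_eq_mul, map_mul, map_mul, map_one,
        map_intCast, map_intCast, mul_one] at h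
      exact h.symm
    · rintro ⟨a, c, rfl⟩
      exact ⟨a + c * b 1, by simp [hy, hf]⟩
  have hyy : y * y = t * y - n := by
    have h := congrArg f heta
    simpa [hy, zsmul_eq_mul] using h
  have hDt : (D : ℂ) = 4 * n - t ^ 2 := by
    have : (D : ℤ) = 4 * n - t ^ 2 := by rw [hD, hd]; ring
    exact_mod_cast congrArg (Int.cast : ℤ → ℂ) this
  have hsqrt : ((Real.sqrt D : ℝ) : ℂ) ^ 2 = D := by
    rw [← Complex.ofReal_pow, Real.sq_sqrt (Nat.cast_nonneg _)]; simp
  have hpar : ∃ s : ℤ, t = D + 2 * s := by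
    have h : (D : ℤ) = 4 * n - t ^ 2 := by rw [hD, hd]; ring
    rcases Int.even_or_odd' t with ⟨u, hu | hu⟩
    · exact ⟨u - 2 * n + 2 * u ^ 2, by rw [h, hu]; ring⟩
    · exact ⟨u - 2 * n + 2 * u ^ 2 + 2 * u + 1, by rw [h, hu]; ring⟩
  obtain ⟨s, hs⟩ := hpar
  have hs' : (t : ℂ) = D + 2 * s := by exact_mod_cast congrArg (Int.cast : ℤ → ℂ) hs
  have hfac : (2 * y - t - Complex.I * (Real.sqrt D : ℂ)) *
      (2 * y - t + Complex.I * (Real.sqrt D : ℂ)) = 0 := by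
    linear_combination 4 * hyy + hDt + hsqrt - (Real.sqrt D : ℂ) ^ 2 * Complex.I_sq
  rw [hmem]
  rcases mul_eq_zero.mp hfac with h | h
  · have hyo : y = s + omega D := by
      rw [omega]; linear_combination h / 2 + hs' / 2
    constructor
    · rintro ⟨a, c, rfl⟩
      exact ⟨a + c * s, c, by rw [hyo]; push_cast; ring⟩
    · rintro ⟨a, c, rfl⟩
      exact ⟨a - c * s, c, by rw [hyo]; push_cast; ring⟩
  · have hyo : y = s + D - omega D := by
      rw [omega]; linear_combination h / 2 + hs' / 2
    constructor
    · rintro ⟨a, c, rfl⟩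
      exact ⟨a + c * (s + D), -c, by rw [hyo]; push_cast; ring⟩
    · rintro ⟨a, c, rfl⟩
      exact ⟨a + c * (s + D), -c, by rw [hyo]; push_cast; ring⟩

end QuadraticField

end

section


/-! ### The quadratic character -/

/-- The `p`-part of `D` for a fundamental discriminant `-D` and a prime `p ∣ D`. -/
def pPart (D p : ℕ) : ℕ := if p = 2 then (if 8 ∣ D then 8 else 4) else p

theorem pPart_pos {D p : ℕ} (hp : p.Prime) : 0 < pPart D p := by
  unfold pPart; split_ifs <;> first | exact hp.pos | norm_num

theorem chiP_congr {D p : ℕ} {a b : ℤ} (h : a ≡ b [ZMOD pPart D p]) :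
    chiP D p a = chiP D p b := by
  unfold chiP
  unfold pPart at h
  split_ifs at h ⊢ with h2 h8
  · have := (ZMod.intCast_eq_intCast_iff a b 8).mpr (by simpa using h)
    rw [this]
  · have := (ZMod.intCast_eq_intCast_iff a b 8).mpr (by simpa using h)
    rw [this]
  · have := (ZMod.intCast_eq_intCast_iff a b 4).mpr (by simpa using h)
    rw [this]
  · exact jacobiSym.mod_left' h

theorem chiP_one (D p : ℕ) : chiP D p 1 = 1 := by
  unfold chiP; split_ifs <;> simp

theorem chiP_mul (D p : ℕ) (a b : ℤ) : chiP D p (a * b) = chiP D p a * chiP D p b := by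
  unfold chiP
  split_ifs <;> first | exact jacobiSym.mul_left a b p | (push_cast; exact map_mul _ _ _)

theorem chi_one (D : ℕ) : chi D 1 = 1 := by simp [chi, chiP_one]

theorem chi_mul (D : ℕ) (a b : ℤ) : chi D (a * b) = chi D a * chi D b := by
  simp [chi, chiP_mul, Finset.prod_mul_distrib]

namespace IsFundamental

variable {D : ℕ}

theorem pos (hD : IsFundamental D) : 0 < D := by
  rcases hD with ⟨h, -⟩ | ⟨m, h, h', -⟩ <;> omega

theorem two_lt (hD : IsFundamental D) : 2 < D := by
  rcases hD with ⟨h, -⟩ | ⟨m, h, h', -⟩ <;> omega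

theorem mod_four (hD : IsFundamental D) : D % 4 = 0 ∨ D % 4 = 3 := by
  rcases hD with ⟨h, -⟩ | ⟨m, h, h', -⟩ <;> omega

theorem not_sq_dvd (hD : IsFundamental D) {p : ℕ} (hp : p.Prime) (h2 : p ≠ 2) : ¬ p * p ∣ D := by
  rcases hD with ⟨-, h⟩ | ⟨m, rfl, -, h⟩
  · intro hd; exact hp.one_lt.ne' (Nat.isUnit_iff.mp (h p hd))
  · intro hd
    have : Nat.Coprime (p * p) 4 := by
      have : Nat.Coprime p 2 := (Nat.coprime_primes hp Nat.prime_two).mpr h2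
      simpa using Nat.Coprime.mul_left (this.mul_right this) (this.mul_right this)
    exact hp.one_lt.ne' (Nat.isUnit_iff.mp (h p (this.dvd_of_dvd_mul_left hd)))

theorem two_adic (hD : IsFundamental D) (h2 : 2 ∣ D) :
    (¬ 8 ∣ D ∧ ∃ m, D = 4 * m ∧ m % 4 = 1) ∨
      (8 ∣ D ∧ ∃ m, D = 8 * m ∧ (m % 4 = 1 ∨ m % 4 = 3)) := by
  rcases hD with ⟨h, -⟩ | ⟨m, h, h' | h', -⟩
  · omega
  · exact Or.inl ⟨by omega, m, h, h'⟩
  · exact Or.inr ⟨by omega, m / 2, by omega, by omega⟩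

theorem exists_eq_pPart_mul (hD : IsFundamental D) {p : ℕ} (hp : p.Prime) (hpD : p ∣ D) :
    ∃ D', D = pPart D p * D' ∧ Nat.Coprime (pPart D p) D' := by
  unfold pPart
  split_ifs with h2 h8
  · obtain ⟨m, hm⟩ := h8
    refine ⟨m, hm, ?_⟩
    subst h2
    have : Nat.Coprime 2 m := by
      rw [Nat.coprime_two_left, Nat.odd_iff]
      rcases hD.two_adic hpD with ⟨h, -⟩ | ⟨-, m', h, h'⟩ <;> omega
    exact this.pow_left 3
  · subst h2
    rcases hD.two_adic hpD with ⟨h, m, hm, h'⟩ | ⟨h, -⟩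
    · refine ⟨m, hm, ?_⟩
      have : Nat.Coprime 2 m := by rw [Nat.coprime_two_left, Nat.odd_iff]; omega
      exact this.pow_left 2
    · exact absurd h h8
  · obtain ⟨m, hm⟩ := hpD
    refine ⟨m, hm, (Nat.Prime.coprime_iff_not_dvd hp).mpr fun h => ?_⟩
    obtain ⟨c, hc⟩ := h
    exact hD.not_sq_dvd hp h2 ⟨c, by rw [hm, hc, mul_assoc]⟩

theorem pPart_dvd (hD : IsFundamental D) {p : ℕ} (hp : p.Prime) (hpD : p ∣ D) : pPart D p ∣ D := by
  obtain ⟨D', h, -⟩ := hD.exists_eq_pPart_mul hp hpD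
  exact ⟨D', h⟩

theorem coprime_pPart {p p' : ℕ} (hp : p.Prime) (hp' : p'.Prime) (h : p ≠ p') :
    Nat.Coprime (pPart D p) (pPart D p') := by
  have key : ∀ q : ℕ, q.Prime → q ≠ 2 → Nat.Coprime 8 q ∧ Nat.Coprime 4 q := by
    intro q hq h2
    have : Nat.Coprime 2 q := (Nat.coprime_primes Nat.prime_two hq).mpr h2.symm
    exact ⟨this.pow_left 3, this.pow_left 2⟩
  unfold pPart
  split_ifs with h1 h2 h3 h3 h3 h3
  all_goals first
    | exact absurd (h1.trans h3.symm) h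
    | exact (key _ hp' ‹_›).1
    | exact (key _ hp' ‹_›).2
    | exact (key _ hp ‹_›).1.symm
    | exact (key _ hp ‹_›).2.symm
    | exact (Nat.coprime_primes hp hp').mpr h

theorem chi_congr (hD : IsFundamental D) {a b : ℤ} (h : a ≡ b [ZMOD D]) : chi D a = chi D b := by
  refine Finset.prod_congr rfl fun p hp => chiP_congr ?_
  rw [Nat.mem_primeFactors] at hp
  exact h.of_dvd (by exact_mod_cast hD.pPart_dvd hp.1 hp.2.1)

/-- Every other factor `χ_{p'}` depends only on the residue modulo the `p'`-part of `D`, which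
divides `D'`. -/
theorem chi_eq_chiP (hD : IsFundamental D) {p D' : ℕ} (hp : p.Prime) (hpD : p ∣ D)
    (hD' : D = pPart D p * D') {a : ℤ} (h : a ≡ 1 [ZMOD D']) : chi D a = chiP D p a := by
  unfold chi
  refine Finset.prod_eq_single_of_mem p (Nat.mem_primeFactors.mpr ⟨hp, hpD, hD.pos.ne'⟩) ?_
  intro p' hp' hne
  rw [Nat.mem_primeFactors] at hp'
  rw [← chiP_one D p']
  refine chiP_congr (h.of_dvd ?_)
  have h1 := hD.pPart_dvd hp'.1 hp'.2.1
  rw [hD'] at h1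
  have h2 : pPart (pPart D p * D') p' = pPart D p' := by rw [← hD']
  rw [h2] at h1
  exact_mod_cast (coprime_pPart hp'.1 hp hne).dvd_of_dvd_mul_left h1

theorem chi_mul_self (hD : IsFundamental D) {a : ℤ} (h : IsCoprime a D) :
    chi D a * chi D a = 1 := by
  obtain ⟨u, v, huv⟩ := h
  have hz : ∀ p, chiP D p a = 0 ∨ chiP D p a = 1 ∨ chiP D p a = -1 := by
    intro p
    unfold chiP
    split_ifs
    · exact ZMod.isQuadratic_χ₈' _
    · exact ZMod.isQuadratic_χ₈ _
    · exact ZMod.isQuadratic_χ₄ _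
    · exact jacobiSym.trichotomy _ _
  have h1 : chi D (u * a) = 1 := by
    rw [← chi_one D]
    refine hD.chi_congr ((Int.modEq_iff_dvd).mpr ⟨v, by linarith⟩)
  rw [chi_mul] at h1
  have h2 : chi D a ≠ 0 := fun h => by rw [h, mul_zero] at h1; exact zero_ne_one h1
  rw [chi, ← Finset.prod_mul_distrib]
  refine Finset.prod_eq_one fun p hp => ?_
  have h3 : chiP D p a ≠ 0 := Finset.prod_ne_zero_iff.mp h2 p hp
  rcases hz p with h | h | h <;> simp_all

theorem chi_eq_of_mul_modEq_one (hD : IsFundamental D) {a d : ℤ} (h : a * d ≡ 1 [ZMOD D]) :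
    chi D a = chi D d := by
  have h1 : chi D a * chi D d = 1 := by rw [← chi_mul, hD.chi_congr h, chi_one]
  have hc : IsCoprime d D := by
    obtain ⟨c, hc⟩ := h.symm.dvd
    exact ⟨a, -c, by linarith⟩
  have h2 := hD.chi_mul_self hc
  calc chi D a = chi D a * (chi D d * chi D d) := by rw [h2, mul_one]
    _ = chi D d := by rw [← mul_assoc, h1, one_mul]

/-- The norm of `a + bω` is `a² + Dab + b²D(D+1)/4`; such integers are never non-residues. -/
theorem chiP_norm_ne (hD : IsFundamental D) {p : ℕ} (hp : p.Prime) (hpD : p ∣ D) (n a b : ℤ)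
    (hn : 4 * n = (2 * a + D * b) ^ 2 + D * b ^ 2) : chiP D p n ≠ -1 := by
  unfold chiP
  split_ifs with h2 h8 h8'
  · subst h2
    rcases hD.two_adic hpD with ⟨h, -⟩ | ⟨h, m, hm, h'⟩
    · exact absurd ‹8 ∣ D› h
    · obtain ⟨r, hr⟩ : ∃ r, m = 4 * r + 1 := ⟨m / 4, by omega⟩
      have : n = a ^ 2 + 8 * m * a * b + (16 * m * m + 2 * m) * b ^ 2 := by
        rw [hm] at hn; push_cast at hn; linarith
      -- Modulo 8 only `a² + 2m b²` survives, and `2m ≡ 2` for `m ≡ 1 mod 4`; the remaining finite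
      -- check is done by `decide`.
      have e : (n : ZMod 8) = a ^ 2 + 2 * b ^ 2 := by
        rw [this, hr]
        push_cast
        have h40 : (8 : ZMod 8) = 0 := rfl
        have h160 : (16 : ZMod 8) = 0 := rfl
        rw [h40, h160]
        have : (2 : ZMod 8) * (4 * (r : ZMod 8) + 1) = 8 * r + 2 := by ring
        rw [this, h40]
        ring
      rw [e]
      generalize (a : ZMod 8) = x
      generalize (b : ZMod 8) = y
      revert x y
      decide
  · subst h2
    rcases hD.two_adic hpD with ⟨h, -⟩ | ⟨h, m, hm, h'⟩
    · exact absurd ‹8 ∣ D› h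
    · obtain ⟨r, hr⟩ : ∃ r, m = 4 * r + 3 := ⟨m / 4, by omega⟩
      have : n = a ^ 2 + 8 * m * a * b + (16 * m * m + 2 * m) * b ^ 2 := by
        rw [hm] at hn; push_cast at hn; linarith
      have e : (n : ZMod 8) = a ^ 2 + 6 * b ^ 2 := by
        rw [this, hr]
        push_cast
        have h40 : (8 : ZMod 8) = 0 := rfl
        have h160 : (16 : ZMod 8) = 0 := rfl
        rw [h40, h160]
        have : (2 : ZMod 8) * (4 * (r : ZMod 8) + 3) = 8 * r + 6 := by ring
        rw [this, h40]
        ring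
      rw [e]
      generalize (a : ZMod 8) = x
      generalize (b : ZMod 8) = y
      revert x y
      decide
  · subst h2
    rcases hD.two_adic hpD with ⟨h, m, hm, h'⟩ | ⟨h, -⟩
    · obtain ⟨r, hr⟩ : ∃ r, m = 4 * r + 1 := ⟨m / 4, by omega⟩
      have : n = a ^ 2 + 4 * m * a * b + m * (4 * m + 1) * b ^ 2 := by
        rw [hm] at hn; push_cast at hn; linarith
      rw [this, hr]
      push_cast
      have h40 : (4 : ZMod 4) = 0 := rfl
      rw [h40]
      generalize (a : ZMod 4) = x
      generalize (b : ZMod 4) = y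
      simp only [zero_mul, zero_add, add_zero, one_mul]
      revert x y
      decide
    · exact absurd h ‹¬ 8 ∣ D›
  · obtain ⟨c, rfl⟩ := hpD
    intro h
    -- Modulo an odd `p ∣ D`, `4n` is the square of `2a + Db`.
    have h4 : jacobiSym (2 ^ 2 * n) p = jacobiSym ((2 * a + ((p * c : ℕ) : ℤ) * b) ^ 2) p := by
      apply jacobiSym.mod_left'
      have : (2 : ℤ) ^ 2 * n = (2 * a + ((p * c : ℕ) : ℤ) * b) ^ 2 + p * (c * b ^ 2) := by
        rw [show (2 : ℤ) ^ 2 * n = 4 * n by ring, hn]; push_cast; ring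
      rw [this, Int.add_mul_emod_self_left]
    have hcop : (2 : ℤ).gcd p = 1 := by
      have : Nat.Coprime 2 p := (Nat.coprime_primes Nat.prime_two hp).mpr (Ne.symm h2)
      exact_mod_cast this
    rw [jacobiSym.mul_left, jacobiSym.sq_one' hcop, one_mul, h, jacobiSym.pow_left] at h4
    nlinarith [sq_nonneg (jacobiSym (2 * a + ((p * c : ℕ) : ℤ) * b) p)]

theorem prod_jacobiSym_primeFactors {m : ℕ} (hm : Squarefree m) (a : ℤ) :
    ∏ p ∈ m.primeFactors, jacobiSym a p = jacobiSym a m := by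
  conv_rhs => rw [← Nat.prod_primeFactors_of_squarefree hm]
  have key : ∀ s : Finset ℕ, (∀ p ∈ s, p ≠ 0) →
      ∏ p ∈ s, jacobiSym a p = jacobiSym a (∏ p ∈ s, p) := by
    intro s
    induction s using Finset.induction_on with
    | empty => simp
    | insert q s hq ih =>
      intro h
      rw [Finset.prod_insert hq, Finset.prod_insert hq, ih fun p hp => h p (by simp [hp]),
        jacobiSym.mul_right' a (h q (by simp)) (Finset.prod_ne_zero_iff.mpr fun p hp => h p (by simp [hp]))]
  exact key _ fun p hp => (Nat.prime_of_mem_primeFactors hp).ne_zero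

theorem primeFactors_pow_two_mul {m : ℕ} (e : ℕ) (he : e ≠ 0) (hm : m ≠ 0) (h2 : ¬ 2 ∣ m) :
    (2 ^ e * m).primeFactors = insert 2 m.primeFactors ∧ 2 ∉ m.primeFactors := by
  refine ⟨?_, fun h => h2 (Nat.dvd_of_mem_primeFactors h)⟩
  rw [Nat.primeFactors_mul (by positivity) hm, Nat.primeFactors_prime_pow he Nat.prime_two]
  rfl

theorem chi_odd {m : ℕ} (hm : Squarefree m) (h2 : ¬ 2 ∣ m) (D : ℕ) (a : ℤ) :
    ∏ p ∈ m.primeFactors, chiP D p a = jacobiSym a m := by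
  rw [← prod_jacobiSym_primeFactors hm]
  refine Finset.prod_congr rfl fun p hp => ?_
  have : p ≠ 2 := by rintro rfl; exact h2 (Nat.dvd_of_mem_primeFactors hp)
  simp [chiP, this]

theorem neg_one_pow_half {l : ℕ} (hl : l % 2 = 1) : (-1 : ℤ) ^ (l / 2) = ZMod.χ₄ l := by
  rw [ZMod.χ₄_nat_eq_if_mod_four]
  rcases Nat.even_or_odd (l / 2) with h | h
  · rw [h.neg_one_pow, if_neg (by omega), if_pos (by rw [Nat.even_iff] at h; omega)]
  · rw [h.neg_one_pow, if_neg (by omega), if_neg (by rw [Nat.odd_iff] at h; omega)]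

theorem jacobiSym_reciprocity_three {m l : ℕ} (hm : m % 4 = 3) (hl : l % 2 = 1) :
    jacobiSym m l = ZMod.χ₄ l * jacobiSym l m := by
  rw [jacobiSym.quadratic_reciprocity (Nat.odd_iff.mpr (by omega)) (Nat.odd_iff.mpr hl),
    mul_comm (m / 2), pow_mul, neg_one_pow_half hl]
  congr 1
  have h : Odd (m / 2) := by rw [Nat.odd_iff]; omega
  have h1 : (ZMod.χ₄ (l : ZMod 4)) ^ 2 = 1 := by
    rw [ZMod.χ₄_nat_eq_if_mod_four]; split_ifs <;> omega
  obtain ⟨r, hr⟩ := h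
  rw [hr, pow_add, pow_mul, h1, one_pow, one_mul, pow_one]

/-- Quadratic reciprocity in the three shapes of `D`: the sign `(-1|l) = χ₄(l)` and, when `8 ∣ D`,
the symbol of `±2` account for the 2-part of `χ`. This identifies the value of the Gauss sum of the
norm form. -/
theorem chi_prime (hD : IsFundamental D) {l : ℕ} (hl : l % 2 = 1) :
    chi D l = jacobiSym (-(D : ℤ)) l := by
  have hlo : Odd l := Nat.odd_iff.mpr hl
  have hχ4 : ZMod.χ₄ (l : ZMod 4) * ZMod.χ₄ (l : ZMod 4) = 1 := by
    rw [ZMod.χ₄_nat_eq_if_mod_four]; split_ifs <;> omega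
  have hl2 : ((l : ℤ) : ZMod 4) = (l : ZMod 4) := by simp
  have hl8 : ((l : ℤ) : ZMod 8) = (l : ZMod 8) := by simp
  have h4 : jacobiSym 4 l = 1 := by
    have : (2 : ℤ).gcd l = 1 := by
      have : Nat.Coprime 2 l := by rw [Nat.coprime_two_left]; exact hlo
      exact_mod_cast this
    exact jacobiSym.sq_one' this
  rcases hD with ⟨h3, hsq⟩ | ⟨m, rfl, h1 | h2, hsq⟩
  · rw [chi, chi_odd hsq (by omega), jacobiSym.neg _ hlo, jacobiSym_reciprocity_three h3 hl,
      ← mul_assoc, hχ4, one_mul]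
  · obtain ⟨e, h2⟩ := primeFactors_pow_two_mul (m := m) 2 (by norm_num) (by omega) (by omega)
    rw [chi, show 4 * m = 2 ^ 2 * m by norm_num, e, Finset.prod_insert h2, chi_odd hsq (by omega),
      jacobiSym.neg _ hlo]
    have : ¬ 8 ∣ 2 ^ 2 * m := by omega
    simp only [chiP, if_true, this, not_false_eq_true]
    rw [hl2]
    push_cast
    rw [jacobiSym.mul_left, h4, one_mul,
      jacobiSym.quadratic_reciprocity_one_mod_four h1 hlo]
  · obtain ⟨r, rfl⟩ : ∃ r, m = 2 * r := ⟨m / 2, by omega⟩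
    have hsr : Squarefree r := hsq.of_mul_right
    obtain ⟨e, h2'⟩ := primeFactors_pow_two_mul (m := r) 3 (by norm_num) (by omega) (by omega)
    rw [chi, show 4 * (2 * r) = 2 ^ 3 * r by ring, e, Finset.prod_insert h2', chi_odd hsr (by omega)]
    have h8 : 8 ∣ 2 ^ 3 * r := ⟨r, by norm_num⟩
    have h8' : 2 ^ 3 * r / 8 = r := by omega
    simp only [chiP, if_true, h8, not_true_eq_false, if_false, h8']
    split_ifs with hr
    · have : (-((2 ^ 3 * r : ℕ) : ℤ)) = 4 * (-2 * r) := by push_cast; ring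
      rw [this, jacobiSym.mul_left, h4, one_mul, jacobiSym.mul_left, jacobiSym.at_neg_two hlo,
        jacobiSym.quadratic_reciprocity_one_mod_four hr hlo, hl8]
    · have : (-((2 ^ 3 * r : ℕ) : ℤ)) = 4 * (2 * (-r)) := by push_cast; ring
      rw [this, jacobiSym.mul_left, h4, one_mul, jacobiSym.mul_left, jacobiSym.at_two hlo,
        jacobiSym.neg _ hlo, jacobiSym_reciprocity_three (by omega) hl, ← mul_assoc (ZMod.χ₄ _),
        hχ4, one_mul, hl8]

/-- For each `p ∣ D` there are non-residues. -/
theorem exists_chiP_eq_neg_one {p : ℕ} (hp : p.Prime) (h2 : p ≠ 2) :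
    ∃ r : ℤ, chiP D p r = -1 := by
  have : Fact p.Prime := ⟨hp⟩
  obtain ⟨a, ha⟩ := quadraticChar_exists_neg_one (F := ZMod p) (by rwa [ZMod.ringChar_zmod_n])
  refine ⟨a.val, ?_⟩
  rw [chiP, if_neg h2, ← jacobiSym.legendreSym.to_jacobiSym, legendreSym]
  simpa using ha

end IsFundamental

end

section


/-! ### The exponential `𝖾` -/

theorem ef_add (x y : ℂ) : ef (x + y) = ef x * ef y := by
  rw [ef, ef, ef, ← Complex.exp_add]; congr 1; ring

theorem ef_zero : ef 0 = 1 := by simp [ef]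

theorem ef_neg (x : ℂ) : ef (-x) = (ef x)⁻¹ := by
  rw [ef, ef, ← Complex.exp_neg]; congr 1; ring

theorem ef_ne_zero (x : ℂ) : ef x ≠ 0 := Complex.exp_ne_zero _

theorem ef_intCast (n : ℤ) : ef n = 1 := by
  rw [ef, Complex.exp_eq_one_iff]; exact ⟨n, by ring⟩

theorem ef_nat_mul (n : ℕ) (x : ℂ) : ef (n * x) = ef x ^ n := by
  rw [ef, ef, ← Complex.exp_nat_mul]; congr 1; ring

theorem ef_int_mul (n : ℤ) (x : ℂ) : ef (n * x) = ef x ^ n := by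
  rw [ef, ef, ← Complex.exp_int_mul]; congr 1; ring

/-- `𝖾` only depends on the residue modulo `1`. -/
theorem ef_congr {x y : ℂ} (h : ∃ n : ℤ, x = y + n) : ef x = ef y := by
  obtain ⟨n, rfl⟩ := h; rw [ef_add, ef_intCast, mul_one]

theorem ef_eq_one_iff {x : ℂ} : ef x = 1 ↔ ∃ n : ℤ, x = n := by
  rw [ef, Complex.exp_eq_one_iff]
  refine exists_congr fun n => ?_
  rw [mul_comm (n : ℂ)]
  constructor
  · intro h; exact mul_left_cancel₀ Complex.two_pi_I_ne_zero h
  · rintro rfl; rfl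

theorem norm_ef (x : ℂ) : ‖ef x‖ = Real.exp (-(2 * Real.pi * x.im)) := by
  rw [ef, Complex.norm_exp]; congr 1; simp

theorem norm_ef_real (x : ℝ) : ‖ef x‖ = 1 := by rw [norm_ef]; simp

theorem conj_ef (x : ℂ) : (starRingEnd ℂ) (ef x) = ef (-(starRingEnd ℂ) x) := by
  rw [ef, ef, ← Complex.exp_conj]
  congr 1
  rw [map_mul, map_mul, map_mul, map_ofNat, Complex.conj_ofReal, Complex.conj_I]
  ring

theorem conj_ef_real (x : ℝ) : (starRingEnd ℂ) (ef x) = ef (-x) := by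
  rw [conj_ef, Complex.conj_ofReal]

theorem ef_int_div_congr {q : ℕ} (hq : q ≠ 0) {a b : ℤ} (h : a ≡ b [ZMOD q]) :
    ef ((a : ℂ) / q) = ef ((b : ℂ) / q) := by
  obtain ⟨c, hc⟩ := h.symm.dvd
  refine ef_congr ⟨c, ?_⟩
  have hq' : (q : ℂ) ≠ 0 := by exact_mod_cast hq
  have : (a : ℂ) = b + q * c := by
    have : a = b + q * c := by linarith
    exact_mod_cast congrArg (Int.cast : ℤ → ℂ) this
  rw [this]
  field_simp

/-- Orthogonality of the characters of `ℤ/q`. -/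
theorem sum_ef_div {q : ℕ} (hq : 0 < q) (n : ℤ) :
    ∑ j ∈ Finset.range q, ef ((j : ℂ) * n / q) = if (q : ℤ) ∣ n then (q : ℂ) else 0 := by
  have hq' : (q : ℂ) ≠ 0 := by exact_mod_cast hq.ne'
  have h : ∀ j ∈ Finset.range q, ef ((j : ℂ) * n / q) = ef ((n : ℂ) / q) ^ j := by
    intro j _; rw [← ef_nat_mul, mul_div_assoc]
  rw [Finset.sum_congr rfl h]
  split_ifs with hn
  · have : ef ((n : ℂ) / q) = 1 := by
      obtain ⟨c, rfl⟩ := hn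
      rw [ef_eq_one_iff]; exact ⟨c, by push_cast; field_simp⟩
    simp [this]
  · have hne : ef ((n : ℂ) / q) ≠ 1 := by
      rw [Ne, ef_eq_one_iff]
      rintro ⟨c, hc⟩
      refine hn ⟨c, ?_⟩
      rw [div_eq_iff hq'] at hc
      have : (n : ℂ) = (c * q : ℤ) := by rw [hc]; push_cast; ring
      rw [mul_comm]; exact_mod_cast this
    rw [geom_sum_eq hne, ← ef_nat_mul, mul_div_cancel₀ _ hq', ef_intCast]
    simp

/-! ### Gauss sums of the norm form -/

/-- The norm of `a + bω`. -/
def normForm (D : ℕ) (a b : ℤ) : ℤ := a ^ 2 + D * a * b + ((D * (D + 1) / 4 : ℕ) : ℤ) * b ^ 2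

theorem four_mul_normForm {D : ℕ} (hD : IsFundamental D) (a b : ℤ) :
    4 * normForm D a b = (2 * a + D * b) ^ 2 + D * b ^ 2 := by
  have h : 4 * (D * (D + 1) / 4) = D * (D + 1) := by
    refine Nat.mul_div_cancel' ?_
    rcases hD.mod_four with h | h
    · exact (Nat.dvd_of_mod_eq_zero h).mul_right _
    · exact Dvd.dvd.mul_left (by omega) _
  have h' : (4 : ℤ) * ((D * (D + 1) / 4 : ℕ) : ℤ) = D * (D + 1) := by exact_mod_cast h
  rw [normForm]
  linear_combination b ^ 2 * h'

section GaussSum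

variable {p : ℕ} [Fact p.Prime]

/-- An element `a` has `1 + (a|p)` square roots. The constant `1` sums to zero against a nontrivial
additive character and the Legendre symbol leaves the Gauss sum. -/
theorem sum_addChar_mul_sq (h2 : p ≠ 2) {c : ZMod p} (hc : c ≠ 0) :
    ∑ x : ZMod p, ZMod.stdAddChar (c * x ^ 2) =
      ((quadraticChar (ZMod p) c : ℤ) : ℂ) *
        gaussSum ((quadraticChar (ZMod p)).ringHomComp (Int.castRingHom ℂ)) ZMod.stdAddChar := by
  classical
  have hF : ringChar (ZMod p) ≠ 2 := by rwa [ZMod.ringChar_zmod_n]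
  have hprim := ZMod.isPrimitive_stdAddChar p
  set χ := (quadraticChar (ZMod p)).ringHomComp (Int.castRingHom ℂ) with hχ
  set ψ : AddChar (ZMod p) ℂ := ZMod.stdAddChar
  have h1 : ∑ x : ZMod p, ψ (c * x ^ 2) =
      ∑ a : ZMod p, ((quadraticChar (ZMod p) a : ℤ) + 1 : ℂ) * ψ (c * a) := by
    rw [← Finset.sum_fiberwise (s := Finset.univ) (g := fun x : ZMod p => x ^ 2)]
    refine Finset.sum_congr rfl fun a _ => ?_
    have hcard := quadraticChar_card_sqrts hF a
    have : ∀ x ∈ Finset.univ.filter (fun x : ZMod p => x ^ 2 = a), ψ (c * x ^ 2) = ψ (c * a) := by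
      intro x hx; rw [(Finset.mem_filter.mp hx).2]
    rw [Finset.sum_congr rfl this, Finset.sum_const, nsmul_eq_mul]
    congr 1
    have h3 : (({x : ZMod p | x ^ 2 = a}.toFinset.card : ℤ) : ℂ) =
      ((quadraticChar (ZMod p) a + 1 : ℤ) : ℂ) := by rw [hcard]
    push_cast at h3
    rw [← h3]
    congr 2
    ext x; simp
  have h2' : ∑ a : ZMod p, ψ (c * a) = 0 := by
    have := AddChar.sum_mulShift c hprim
    rw [if_neg hc] at this
    simpa [mul_comm] using this
  have h3 : ∑ a : ZMod p, ((quadraticChar (ZMod p) a : ℤ) : ℂ) * ψ (c * a) =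
      gaussSum χ (ψ.mulShift c) := by
    rw [gaussSum]; rfl
  have h4 := gaussSum_mulShift χ ψ (Units.mk0 c hc)
  have h5 : ((quadraticChar (ZMod p) c : ℤ) : ℂ) * ((quadraticChar (ZMod p) c : ℤ) : ℂ) = 1 := by
    have := quadraticChar_sq_one hc
    rw [sq] at this
    exact_mod_cast congrArg (Int.cast : ℤ → ℂ) this
  rw [h1]
  simp only [add_mul, one_mul, Finset.sum_add_distrib, h2', add_zero]
  rw [h3, ← h4]
  simp only [Units.val_mk0]
  have : χ c = ((quadraticChar (ZMod p) c : ℤ) : ℂ) := rfl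
  rw [this, ← mul_assoc, h5, one_mul]

/-- Modulo `p` the norm form is `(a + Db/2)² + (D/4)b²`, so the sum is a product of two quadratic
Gauss sums. With `g² = (-1|p)p` the symbols combine to `(-D|p)`; the unit `B` enters as a square. -/
theorem gaussSum_normForm {D : ℕ} (hD : IsFundamental D) (h2 : p ≠ 2) (hpD : ¬ p ∣ D) {B : ℤ}
    (hB : ¬ (p : ℤ) ∣ B) :
    ∑ r : Fin p × Fin p, ef ((B : ℂ) * normForm D (r.1 : ℕ) (r.2 : ℕ) / p) =
      (chi D p : ℂ) * p := by
  classical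
  have hp : p.Prime := Fact.out
  have hF : ringChar (ZMod p) ≠ 2 := by rwa [ZMod.ringChar_zmod_n]
  have : NeZero p := ⟨hp.ne_zero⟩
  set ψ : AddChar (ZMod p) ℂ := ZMod.stdAddChar
  have hB' : (B : ZMod p) ≠ 0 := by rwa [Ne, ZMod.intCast_zmod_eq_zero_iff_dvd]
  have hD' : (D : ZMod p) ≠ 0 := by rwa [Ne, ZMod.natCast_eq_zero_iff]
  have h20 : (2 : ZMod p) ≠ 0 := by
    have : ((2 : ℕ) : ZMod p) ≠ 0 := by
      rw [Ne, ZMod.natCast_eq_zero_iff]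
      intro h
      exact h2 ((Nat.prime_dvd_prime_iff_eq hp Nat.prime_two).mp h)
    exact_mod_cast this
  let e : Fin p ≃ ZMod p := (ZMod.finEquiv p).toEquiv
  have he : ∀ i : Fin p, (((i : ℕ) : ℤ) : ZMod p) = e i := by
    intro i
    obtain ⟨n, rfl⟩ : ∃ n, p = n + 1 := ⟨p - 1, (Nat.succ_pred_eq_of_pos hp.pos).symm⟩
    push_cast
    exact Fin.cast_val_eq_self i
  have hterm : ∀ r : Fin p × Fin p, ef ((B : ℂ) * normForm D (r.1 : ℕ) (r.2 : ℕ) / p) =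
      ψ ((B : ZMod p) * (e r.1 + D / 2 * e r.2) ^ 2) * ψ ((B * D / 4 : ZMod p) * (e r.2) ^ 2) := by
    intro r
    have h1 : ef ((B : ℂ) * normForm D (r.1 : ℕ) (r.2 : ℕ) / p) =
        ψ ((B * normForm D (r.1 : ℕ) (r.2 : ℕ) : ℤ) : ZMod p) := by
      rw [ZMod.stdAddChar_coe, ef]; congr 1; push_cast; ring
    rw [h1, ← AddChar.map_add_eq_mul]
    congr 1
    have h4 := congrArg (Int.cast : ℤ → ZMod p) (four_mul_normForm hD (r.1 : ℕ) (r.2 : ℕ))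
    push_cast at h4 ⊢
    have h40 : (4 : ZMod p) ≠ 0 := by
      have : (4 : ZMod p) = 2 * 2 := by norm_num
      rw [this]; exact mul_ne_zero h20 h20
    rw [← he, ← he]
    push_cast
    field_simp
    have : (4 : ZMod p) = 2 ^ 2 := by norm_num
    rw [this] at h4 ⊢
    linear_combination 2 ^ 2 * h4
  rw [Finset.sum_congr rfl fun r _ => hterm r]
  rw [Fintype.sum_prod_type_right]
  have hinner : ∀ y : Fin p, ∑ x : Fin p, ψ ((B : ZMod p) * (e x + D / 2 * e y) ^ 2) *
      ψ ((B * D / 4 : ZMod p) * (e y) ^ 2) =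
      (∑ x : ZMod p, ψ ((B : ZMod p) * x ^ 2)) * ψ ((B * D / 4 : ZMod p) * (e y) ^ 2) := by
    intro y
    rw [← Finset.sum_mul]
    congr 1
    rw [← Equiv.sum_comp (e.trans (Equiv.addRight ((D : ZMod p) / 2 * e y)))]
    rfl
  rw [Finset.sum_congr rfl fun y _ => hinner y, ← Finset.mul_sum,
    Equiv.sum_comp e fun y => ψ ((B * D / 4 : ZMod p) * y ^ 2)]
  have hBD : (B * D / 4 : ZMod p) ≠ 0 := by
    have : (4 : ZMod p) = 2 * 2 := by norm_num
    rw [this]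
    exact div_ne_zero (mul_ne_zero hB' hD') (mul_ne_zero h20 h20)
  rw [sum_addChar_mul_sq h2 hB', sum_addChar_mul_sq h2 hBD]
  set χ := (quadraticChar (ZMod p)).ringHomComp (Int.castRingHom ℂ) with hχ
  have hχ1 : χ ≠ 1 := by
    intro h
    obtain ⟨a, ha⟩ := quadraticChar_exists_neg_one' hF
    have h1 := congrArg (fun f : MulChar (ZMod p) ℂ => f a) h
    have h3 : χ a = -1 := by
      have : χ a = ((quadraticChar (ZMod p) a : ℤ) : ℂ) := rfl
      rw [this, ha]; norm_num
    simp only [h3, MulChar.one_apply_coe] at h1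
    norm_num at h1
  have hχ2 : χ.IsQuadratic := (quadraticChar_isQuadratic (ZMod p)).comp _
  have hsq := gaussSum_sq hχ1 hχ2 (ZMod.isPrimitive_stdAddChar p)
  have hsq' : gaussSum χ ψ ^ 2 = ((quadraticChar (ZMod p) (-1) : ℤ) : ℂ) * p := by
    rw [hsq, ZMod.card]; rfl
  have hfin : quadraticChar (ZMod p) B * quadraticChar (ZMod p) (B * D / 4) *
      quadraticChar (ZMod p) (-1) = chi D p := by
    have hodd : p % 2 = 1 := hp.eq_two_or_odd.resolve_left h2
    rw [hD.chi_prime hodd, ← jacobiSym.legendreSym.to_jacobiSym, legendreSym, ← map_mul, ← map_mul]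
    have : (B : ZMod p) * (B * D / 4) * (-1) = (B / 2) * (B / 2) * ((-(D : ℤ) : ℤ) : ZMod p) := by
      have : (4 : ZMod p) = 2 * 2 := by norm_num
      rw [this]
      push_cast
      field_simp
    rw [this, map_mul, map_mul, ← sq, quadraticChar_sq_one (div_ne_zero hB' h20), one_mul]
  rw [← hfin]
  push_cast
  linear_combination ((quadraticChar (ZMod p) B : ℤ) : ℂ) *
    ((quadraticChar (ZMod p) (B * D / 4) : ℤ) : ℂ) * hsq'

end GaussSum

end

section


/-! ### Theta series of the lattices `𝔬` and `𝔡` -/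

/-- The point `a + bω` of `𝔬`. -/
def latO (D : ℕ) (p : ℤ × ℤ) : ℂ := p.1 + p.2 * omega D

/-- The point `(i/√D)(a + bω)` of `𝔡`. -/
def latD (D : ℕ) (p : ℤ × ℤ) : ℂ := Complex.I / (Real.sqrt D : ℂ) * latO D p

/-- The general term of a Hermitian theta series. -/
def thTerm (a τ z w : ℂ) : ℂ :=
  ef ((Complex.normSq a : ℂ) * τ + (starRingEnd ℂ) a * z + a * w)

/-- The theta series of `𝔬`. -/
def thO (D : ℕ) (τ z w : ℂ) : ℂ := ∑' p : ℤ × ℤ, thTerm (latO D p) τ z w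

theorem sqrt_sq (D : ℕ) : ((Real.sqrt D : ℝ) : ℂ) * (Real.sqrt D : ℝ) = D := by
  rw [← Complex.ofReal_mul, Real.mul_self_sqrt (Nat.cast_nonneg _)]; simp

theorem sqrt_ne_zero {D : ℕ} (hD : 0 < D) : ((Real.sqrt D : ℝ) : ℂ) ≠ 0 := by
  have : (0 : ℝ) < D := by exact_mod_cast hD
  exact_mod_cast (Real.sqrt_pos.mpr this).ne'

theorem latO_eq (D : ℕ) (a b : ℤ) :
    latO D (a, b) = ((2 * a + D * b : ℤ) : ℂ) / 2 + Complex.I * (b * (Real.sqrt D : ℝ) / 2) := by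
  rw [latO, omega]; push_cast; ring

theorem conj_latO (D : ℕ) (a b : ℤ) :
    (starRingEnd ℂ) (latO D (a, b)) =
      ((2 * a + D * b : ℤ) : ℂ) / 2 - Complex.I * (b * (Real.sqrt D : ℝ) / 2) := by
  rw [latO_eq]
  simp only [map_add, map_mul, map_div₀, Complex.conj_I, Complex.conj_ofReal, map_intCast,
    map_ofNat]
  ring

theorem normSq_latO (D : ℕ) (a b : ℤ) :
    ((Complex.normSq (latO D (a, b)) : ℝ) : ℂ) =
      (((2 * a + D * b : ℤ) : ℂ) ^ 2 + D * b ^ 2) / 4 := by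
  rw [← Complex.mul_conj, conj_latO, latO_eq]
  linear_combination (-(b : ℂ) ^ 2 * (Real.sqrt D : ℝ) ^ 2 / 4) * Complex.I_sq +
    (b : ℂ) ^ 2 / 4 * sqrt_sq D

theorem normSq_latO_eq_normForm {D : ℕ} (hD : IsFundamental D) (p : ℤ × ℤ) :
    ((Complex.normSq (latO D p) : ℝ) : ℂ) = normForm D p.1 p.2 := by
  have h := congrArg (Int.cast : ℤ → ℂ) (four_mul_normForm hD p.1 p.2)
  rw [show p = (p.1, p.2) from rfl, normSq_latO]
  push_cast at h ⊢
  linear_combination -h / 4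

theorem latD_eq {D : ℕ} (hD : 0 < D) (a b : ℤ) :
    latD D (a, b) =
      -(b : ℂ) / 2 + Complex.I * (((2 * a + D * b : ℤ) : ℂ) / (2 * (Real.sqrt D : ℝ))) := by
  have h := sqrt_ne_zero hD
  rw [latD, latO_eq]
  field_simp
  linear_combination (b : ℂ) * (Real.sqrt D : ℝ) * Complex.I_sq

theorem conj_latD {D : ℕ} (hD : 0 < D) (a b : ℤ) :
    (starRingEnd ℂ) (latD D (a, b)) =
      -(b : ℂ) / 2 - Complex.I * (((2 * a + D * b : ℤ) : ℂ) / (2 * (Real.sqrt D : ℝ))) := by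
  rw [latD_eq hD]
  simp only [map_add, map_mul, map_div₀, Complex.conj_I, Complex.conj_ofReal, map_intCast,
    map_ofNat, map_neg]
  ring

theorem normSq_latD (D : ℕ) (p : ℤ × ℤ) :
    Complex.normSq (latD D p) = Complex.normSq (latO D p) / D := by
  rw [latD, Complex.normSq_mul, Complex.normSq_div, Complex.normSq_I, Complex.normSq_ofReal,
    Real.mul_self_sqrt (Nat.cast_nonneg _)]
  ring

theorem thTerm_add (a x τ z w : ℂ) :
    thTerm (a + x) τ z w = thTerm a τ z w * thTerm x τ (z + a * τ) (w + (starRingEnd ℂ) a * τ) := by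
  rw [thTerm, thTerm, thTerm, ← ef_add]
  congr 1
  rw [← Complex.mul_conj, ← Complex.mul_conj, ← Complex.mul_conj, map_add]
  ring

theorem jacobiTheta₂_term_eq (n : ℤ) (z τ : ℂ) :
    jacobiTheta₂_term n z τ = ef (n * z + n ^ 2 * τ / 2) := by
  rw [jacobiTheta₂_term, ef]; congr 1; ring

/-- The theta series of `𝔬` through Jacobi theta functions. -/
def thJacobi (D : ℕ) (τ z w : ℂ) (ε : ℂ) : ℂ :=
  jacobiTheta₂ ((z + w) / 2 + ε / 2) (τ / 2) *
    jacobiTheta₂ (Complex.I * (Real.sqrt D : ℝ) * (w - z) / 2 + ε * D / 2) (D * τ / 2)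

theorem HasSum.mul_int {f g : ℤ → ℂ} {a b : ℂ} (hf : HasSum f a) (hg : HasSum g b) :
    HasSum (fun q : ℤ × ℤ => f q.1 * g q.2) (a * b) :=
  hf.mul hg (summable_mul_of_summable_norm hf.summable.norm hg.summable.norm)

theorem hasSum_mul_jacobi {z z' τ τ' : ℂ} (h : 0 < τ.im) (h' : 0 < τ'.im) :
    HasSum (fun q : ℤ × ℤ => jacobiTheta₂_term q.1 z τ * jacobiTheta₂_term q.2 z' τ')
      (jacobiTheta₂ z τ * jacobiTheta₂ z' τ') := by
  have := HasSum.mul_int (hasSum_jacobiTheta₂_term z h) (hasSum_jacobiTheta₂_term z' h')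
  exact this

theorem im_half_pos {τ : ℂ} (h : 0 < τ.im) : 0 < (τ / 2).im := by
  have : (τ / 2).im = τ.im / 2 := by simp
  rw [this]; positivity

theorem im_mul_half_pos {D : ℕ} (hD : 0 < D) {τ : ℂ} (h : 0 < τ.im) : 0 < (D * τ / 2).im := by
  have : (D * τ / 2).im = D * τ.im / 2 := by simp
  have hD' : (0 : ℝ) < D := by exact_mod_cast hD
  rw [this]; positivity

theorem ef_half_int (n : ℤ) : ef ((n : ℂ) / 2) = if Even n then 1 else -1 := by
  split_ifs with h
  · obtain ⟨m, rfl⟩ := h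
    exact ef_eq_one_iff.mpr ⟨m, by push_cast; ring⟩
  · obtain ⟨m, rfl⟩ := Int.not_even_iff_odd.mp h
    have : ((2 * m + 1 : ℤ) : ℂ) / 2 = m + 1 / 2 := by push_cast; ring
    rw [this, ef_add, ef_intCast, one_mul, ef]
    have : 2 * (Real.pi : ℂ) * Complex.I * (1 / 2) = Real.pi * Complex.I := by ring
    rw [this, Complex.exp_pi_mul_I]

/-- With `m = 2a + Db`, the lattice `𝔬` becomes the set of pairs `(m, b)` with `m ≡ Db mod 2`,
carrying the diagonal form `(m² + Db²)/4`. Averaging the sign `(-1)^{ε(m - Db)}` over `ε = 0, 1`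
selects these pairs, and each signed sum over all pairs is a product of two Jacobi theta functions.
-/
theorem hasSum_thO {D : ℕ} (hD : 0 < D) {τ : ℂ} (hτ : 0 < τ.im) (z w : ℂ) :
    HasSum (fun p => thTerm (latO D p) τ z w)
      ((thJacobi D τ z w 0 + thJacobi D τ z w 1) / 2) := by
  have hsum : ∀ ε : ℂ, HasSum (fun q : ℤ × ℤ =>
      jacobiTheta₂_term q.1 ((z + w) / 2 + ε / 2) (τ / 2) *
        jacobiTheta₂_term q.2 (Complex.I * (Real.sqrt D : ℝ) * (w - z) / 2 + ε * D / 2) (D * τ / 2))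
      (thJacobi D τ z w ε) := fun ε =>
    hasSum_mul_jacobi (im_half_pos hτ) (im_mul_half_pos hD hτ)
  have h01 := ((hsum 0).add (hsum 1)).div_const 2
  have hinj : Function.Injective (fun p : ℤ × ℤ => (2 * p.1 + D * p.2, p.2)) := by
    rintro ⟨a, b⟩ ⟨a', b'⟩ h
    simp only [Prod.mk.injEq] at h
    obtain ⟨h1, rfl⟩ := h
    exact Prod.ext (by simpa using h1) rfl
  have key : ∀ (m b : ℤ) (ε : ℤ),
      jacobiTheta₂_term m ((z + w) / 2 + (ε : ℂ) / 2) (τ / 2) *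
        jacobiTheta₂_term b (Complex.I * (Real.sqrt D : ℝ) * (w - z) / 2 + ε * D / 2) (D * τ / 2) =
      ef ((ε * (m - D * b) : ℤ) / 2) * ef (((m : ℂ) ^ 2 + D * b ^ 2) / 4 * τ +
        (m / 2 - Complex.I * (b * (Real.sqrt D : ℝ) / 2)) * z +
        (m / 2 + Complex.I * (b * (Real.sqrt D : ℝ) / 2)) * w) := by
    intro m b ε
    rw [jacobiTheta₂_term_eq, jacobiTheta₂_term_eq, ← ef_add, ← ef_add]
    refine ef_congr ⟨ε * D * b, ?_⟩
    push_cast; ring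
  refine (hinj.hasSum_iff (f := fun q : ℤ × ℤ =>
      (jacobiTheta₂_term q.1 ((z + w) / 2 + 0 / 2) (τ / 2) *
        jacobiTheta₂_term q.2 (Complex.I * (Real.sqrt D : ℝ) * (w - z) / 2 + 0 * D / 2) (D * τ / 2) +
      jacobiTheta₂_term q.1 ((z + w) / 2 + 1 / 2) (τ / 2) *
        jacobiTheta₂_term q.2 (Complex.I * (Real.sqrt D : ℝ) * (w - z) / 2 + 1 * D / 2)
          (D * τ / 2)) / 2) ?_).mpr h01 |>.congr_fun ?_
  · rintro ⟨m, b⟩ hnot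
    have hodd : ¬ Even (1 * (m - D * b)) := by
      rintro ⟨a, ha⟩
      exact hnot ⟨(a, b), Prod.ext (by simp only; linarith) rfl⟩
    have h0 := key m b 0
    have h1 := key m b 1
    rw [ef_half_int, if_neg hodd] at h1
    simp only [Int.cast_zero, Int.cast_one, zero_mul, zero_div, ef_zero, one_mul] at h0 h1
    simp only [zero_mul, zero_div, one_mul]
    rw [h0, h1]
    ring
  · rintro ⟨a, b⟩
    have hev : Even (1 * (2 * a + D * b - D * b)) := ⟨a, by ring⟩
    have h0 := key (2 * a + D * b) b 0
    have h1 := key (2 * a + D * b) b 1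
    rw [ef_half_int, if_pos hev] at h1
    simp only [Int.cast_zero, Int.cast_one, zero_mul, zero_div, ef_zero, one_mul] at h0 h1
    simp only [Function.comp, zero_mul, zero_div, one_mul]
    rw [h0, h1, thTerm, normSq_latO, conj_latO, latO_eq]
    push_cast
    ring

theorem thO_eq {D : ℕ} (hD : 0 < D) {τ : ℂ} (hτ : 0 < τ.im) (z w : ℂ) :
    thO D τ z w = (thJacobi D τ z w 0 + thJacobi D τ z w 1) / 2 :=
  (hasSum_thO hD hτ z w).tsum_eq

theorem hasSum_thO' {D : ℕ} (hD : 0 < D) {τ : ℂ} (hτ : 0 < τ.im) (z w : ℂ) :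
    HasSum (fun p => thTerm (latO D p) τ z w) (thO D τ z w) :=
  (hasSum_thO hD hτ z w).summable.hasSum

theorem differentiableAt_thO {D : ℕ} (hD : 0 < D) {x : ℂ × ℂ × ℂ} (hx : 0 < x.1.im) :
    DifferentiableAt ℂ (fun p : ℂ × ℂ × ℂ => thO D p.1 p.2.1 p.2.2) x := by
  have hJ : ∀ ε : ℂ, DifferentiableAt ℂ
      (fun p : ℂ × ℂ × ℂ => thJacobi D p.1 p.2.1 p.2.2 ε) x := by
    intro ε
    have h1 := (hasFDerivAt_jacobiTheta₂ ((x.2.1 + x.2.2) / 2 + ε / 2)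
      (im_half_pos hx)).differentiableAt
    have h2 := (hasFDerivAt_jacobiTheta₂
      (Complex.I * (Real.sqrt D : ℝ) * (x.2.2 - x.2.1) / 2 + ε * D / 2)
      (im_mul_half_pos hD hx)).differentiableAt
    have g1 : DifferentiableAt ℂ (fun p : ℂ × ℂ × ℂ =>
        (((p.2.1 + p.2.2) / 2 + ε / 2, p.1 / 2) : ℂ × ℂ)) x := by fun_prop
    have g2 : DifferentiableAt ℂ (fun p : ℂ × ℂ × ℂ =>
        ((Complex.I * (Real.sqrt D : ℝ) * (p.2.2 - p.2.1) / 2 + ε * D / 2, D * p.1 / 2) :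
          ℂ × ℂ)) x := by fun_prop
    have c1 : DifferentiableAt ℂ (fun p : ℂ × ℂ × ℂ =>
        jacobiTheta₂ ((p.2.1 + p.2.2) / 2 + ε / 2) (p.1 / 2)) x :=
      DifferentiableAt.comp x (g := fun p : ℂ × ℂ => jacobiTheta₂ p.1 p.2) h1 g1
    have c2 : DifferentiableAt ℂ (fun p : ℂ × ℂ × ℂ =>
        jacobiTheta₂ (Complex.I * (Real.sqrt D : ℝ) * (p.2.2 - p.2.1) / 2 + ε * D / 2)
          (D * p.1 / 2)) x :=
      DifferentiableAt.comp x (g := fun p : ℂ × ℂ => jacobiTheta₂ p.1 p.2) h2 g2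
    exact c1.mul c2
  have heq : (fun p : ℂ × ℂ × ℂ => thO D p.1 p.2.1 p.2.2) =ᶠ[nhds x] fun p =>
      (thJacobi D p.1 p.2.1 p.2.2 0 + thJacobi D p.1 p.2.1 p.2.2 1) / 2 := by
    have : ∀ᶠ p : ℂ × ℂ × ℂ in nhds x, 0 < p.1.im :=
      (Complex.continuous_im.comp continuous_fst).continuousAt.eventually (lt_mem_nhds hx)
    filter_upwards [this] with p hp using thO_eq hD hp _ _
  have hs : DifferentiableAt ℂ (fun p : ℂ × ℂ × ℂ =>
      (thJacobi D p.1 p.2.1 p.2.2 0 + thJacobi D p.1 p.2.1 p.2.2 1) / 2) x := by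
    simp only [div_eq_mul_inv]
    exact ((hJ 0).fun_add (hJ 1)).mul_const _
  exact hs.congr_of_eventuallyEq heq

/-! ### The inversion formula -/

/-- Since `D` is a positive real, principal logarithms add, and no sign ambiguity arises in the
product of the two square roots. -/
theorem cpow_half_mul {D : ℕ} (hD : 0 < D) {τ : ℂ} (hτ : τ ≠ 0) :
    (-Complex.I * (τ / 2)) ^ (1 / 2 : ℂ) * (-Complex.I * (D * τ / 2)) ^ (1 / 2 : ℂ) =
      (Real.sqrt D : ℝ) * (-Complex.I * (τ / 2)) := by
  have h0 : -Complex.I * (τ / 2) ≠ 0 := by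
    simp [hτ, Complex.I_ne_zero]
  have hD' : (0 : ℝ) < D := by exact_mod_cast hD
  have hDc : ((D : ℝ) : ℂ) ≠ 0 := by exact_mod_cast hD'.ne'
  have h1 : -Complex.I * (D * τ / 2) = ((D : ℝ) : ℂ) * (-Complex.I * (τ / 2)) := by
    push_cast; ring
  have h2 : (((D : ℝ) : ℂ)) ^ (1 / 2 : ℂ) = (Real.sqrt D : ℝ) := by
    rw [Real.sqrt_eq_rpow, Complex.ofReal_cpow hD'.le]
    norm_num
  have h3 : (((D : ℝ) : ℂ) * (-Complex.I * (τ / 2))) ^ (1 / 2 : ℂ) =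
      ((D : ℝ) : ℂ) ^ (1 / 2 : ℂ) * (-Complex.I * (τ / 2)) ^ (1 / 2 : ℂ) := by
    rw [Complex.cpow_def_of_ne_zero (mul_ne_zero hDc h0), Complex.cpow_def_of_ne_zero hDc,
      Complex.cpow_def_of_ne_zero h0, Complex.log_ofReal_mul hD' h0, ← Complex.exp_add,
      Complex.ofReal_log hD'.le]
    congr 1
    ring
  have h4 : (-Complex.I * (τ / 2)) ^ (1 / 2 : ℂ) * (-Complex.I * (τ / 2)) ^ (1 / 2 : ℂ) =
      -Complex.I * (τ / 2) := by
    rw [← Complex.cpow_add _ _ h0]; norm_num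
  rw [h1, h3, h2]
  linear_combination (Real.sqrt D : ℂ) * h4

/-- The functional equation is applied to both Jacobi factors. The sign twist by `ε` turns into a
shift of the two summation indices by `ε/2` and `εD/2`, so the summands are the points of `𝔡` whose
second coordinate has the parity of `ε`. -/
theorem hasSum_thD_aux {D : ℕ} (hD : 0 < D) {τ : ℂ} (hτ : 0 < τ.im) (z w : ℂ) (ε : ℤ) :
    HasSum (fun q : ℤ × ℤ => thTerm (latD D (q.2 - ε * D + q.1 * D, ε - 2 * q.1))
        (-1 / τ) (z / τ) (w / τ))
      (ef (z * w / τ) * ((Real.sqrt D : ℝ) * (-Complex.I * (τ / 2))) * thJacobi D τ z w ε) := by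
  have hτ0 : τ ≠ 0 := by rintro rfl; simp at hτ
  have hDc : (D : ℂ) ≠ 0 := by exact_mod_cast hD.ne'
  have hs := sqrt_ne_zero hD
  have him : ∀ x : ℂ, 0 < x.im → 0 < (-1 / x).im := by
    intro x hx
    rw [neg_div, Complex.neg_im, one_div, Complex.inv_im, neg_div, neg_neg]
    have : x ≠ 0 := by rintro rfl; simp at hx
    exact div_pos hx (Complex.normSq_pos.mpr this)
  set Z1 := (z + w) / 2 + (ε : ℂ) / 2 with hZ1
  set Z2 := Complex.I * (Real.sqrt D : ℝ) * (w - z) / 2 + ε * D / 2 with hZ2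
  have hP := hasSum_mul_jacobi (z := Z1 / (τ / 2)) (z' := Z2 / (D * τ / 2))
    (him _ (im_half_pos hτ)) (him _ (im_mul_half_pos hD hτ))
  have hJ : thJacobi D τ z w ε = (1 / ((Real.sqrt D : ℝ) * (-Complex.I * (τ / 2)))) *
      (ef (-(Z1 ^ 2 / τ)) * ef (-(Z2 ^ 2 / (D * τ)))) *
      (jacobiTheta₂ (Z1 / (τ / 2)) (-1 / (τ / 2)) *
        jacobiTheta₂ (Z2 / (D * τ / 2)) (-1 / (D * τ / 2))) := by
    rw [thJacobi, jacobiTheta₂_functional_equation _ (τ / 2),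
      jacobiTheta₂_functional_equation _ (D * τ / 2), ← cpow_half_mul hD hτ0]
    have e1 : ef (-(Z1 ^ 2 / τ)) = Complex.exp (-Real.pi * Complex.I * Z1 ^ 2 / (τ / 2)) := by
      rw [ef]; congr 1; field_simp
    have e2 : ef (-(Z2 ^ 2 / (D * τ))) =
        Complex.exp (-Real.pi * Complex.I * Z2 ^ 2 / (D * τ / 2)) := by
      rw [ef]; congr 1; field_simp
    rw [e1, e2, ← hZ1, ← hZ2]
    ring
  have hne : ((Real.sqrt D : ℝ) : ℂ) * (-Complex.I * (τ / 2)) ≠ 0 := by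
    refine mul_ne_zero hs ?_
    simp [hτ0, Complex.I_ne_zero]
  have hval : ef (z * w / τ) * ((Real.sqrt D : ℝ) * (-Complex.I * (τ / 2))) * thJacobi D τ z w ε =
      (ef (z * w / τ) * (ef (-(Z1 ^ 2 / τ)) * ef (-(Z2 ^ 2 / (D * τ))))) *
      (jacobiTheta₂ (Z1 / (τ / 2)) (-1 / (τ / 2)) *
        jacobiTheta₂ (Z2 / (D * τ / 2)) (-1 / (D * τ / 2))) := by
    rw [hJ]; field_simp
  rw [hval]
  refine (hP.mul_left _).congr_fun ?_
  rintro ⟨n, m⟩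
  simp only
  rw [thTerm, normSq_latD, conj_latD hD, latD_eq hD, jacobiTheta₂_term_eq, jacobiTheta₂_term_eq,
    ← ef_add, ← ef_add, ← ef_add, ← ef_add]
  congr 1
  rw [Complex.ofReal_div, normSq_latO]
  push_cast
  rw [hZ1, hZ2]
  have hsq := sqrt_sq D
  generalize ((Real.sqrt D : ℝ) : ℂ) = r at hs hsq ⊢
  rw [← hsq]
  field_simp
  ring_nf
  simp only [Complex.I_sq]
  ring

/-- The inversion formula: `𝔡` is the disjoint union of its two parity classes, and the average over
`ε` in `thO_eq` supplies both. -/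
theorem hasSum_thD {D : ℕ} (hD : 0 < D) {τ : ℂ} (hτ : 0 < τ.im) (z w : ℂ) :
    HasSum (fun p => thTerm (latD D p) (-1 / τ) (z / τ) (w / τ))
      (-Complex.I * τ * (Real.sqrt D : ℝ) * ef (z * w / τ) * thO D τ z w) := by
  have h0 := hasSum_thD_aux hD hτ z w 0
  have h1 := hasSum_thD_aux hD hτ z w 1
  have hinj : ∀ ε : ℤ, Function.Injective
      (fun q : ℤ × ℤ => (q.2 - ε * D + q.1 * D, ε - 2 * q.1)) := by
    rintro ε ⟨a, b⟩ ⟨a', b'⟩ h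
    simp only [Prod.mk.injEq] at h
    obtain ⟨h1, h2⟩ := h
    obtain rfl : a = a' := by linarith
    exact Prod.ext rfl (by simpa using h1)
  set F : ℤ × ℤ → ℂ := fun p => thTerm (latD D p) (-1 / τ) (z / τ) (w / τ) with hF
  have k0 : HasSum (fun p : ℤ × ℤ => if Even p.2 then F p else 0) _ :=
    ((hinj 0).hasSum_iff (f := fun p : ℤ × ℤ => if Even p.2 then F p else 0) (by
      rintro ⟨a, b⟩ hnot
      refine if_neg ?_
      rintro ⟨c, hc⟩
      refine hnot ⟨(-c, a + c * D), ?_⟩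
      simp only at hc
      simp only [Prod.mk.injEq]
      exact ⟨by ring, by rw [hc]; ring⟩)).mp (h0.congr_fun fun q => by
        have : Even (0 - 2 * q.1) := ⟨-q.1, by ring⟩
        simp only [Function.comp, this, if_true, hF])
  have k1 : HasSum (fun p : ℤ × ℤ => if Even p.2 then 0 else F p) _ :=
    ((hinj 1).hasSum_iff (f := fun p : ℤ × ℤ => if Even p.2 then 0 else F p) (by
      rintro ⟨a, b⟩ hnot
      refine if_pos ?_
      by_contra hb
      obtain ⟨c, hc⟩ := Int.not_even_iff_odd.mp hb
      refine hnot ⟨(-c, a + D + c * D), ?_⟩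
      simp only at hc
      simp only [Prod.mk.injEq]
      exact ⟨by ring, by rw [hc]; ring⟩)).mp (h1.congr_fun fun q => by
        have : ¬ Even (1 - 2 * q.1) := by
          rw [Int.not_even_iff_odd]; exact ⟨-q.1, by ring⟩
        simp only [Function.comp, this, if_false, hF])
  have hval : -Complex.I * τ * (Real.sqrt D : ℝ) * ef (z * w / τ) * thO D τ z w =
      ef (z * w / τ) * ((Real.sqrt D : ℝ) * (-Complex.I * (τ / 2))) * thJacobi D τ z w (0 : ℤ) +
      ef (z * w / τ) * ((Real.sqrt D : ℝ) * (-Complex.I * (τ / 2))) * thJacobi D τ z w (1 : ℤ) := by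
    rw [thO_eq hD hτ]; push_cast; ring
  rw [hval]
  refine (k0.add k1).congr_fun fun p => ?_
  split_ifs <;> simp

end

section


/-! ### The theta series of `𝔬` under `Γ₀(D)` -/

theorem sum_fin_shift {p : ℕ} [Fact p.Prime] (h : ZMod p → ZMod p → ℂ) (x y : ZMod p) :
    ∑ r : Fin p × Fin p, h ((r.1 : ℕ) + x) ((r.2 : ℕ) + y) =
      ∑ r : Fin p × Fin p, h (r.1 : ℕ) (r.2 : ℕ) := by
  have : NeZero p := ⟨(Fact.out : p.Prime).ne_zero⟩
  let e : Fin p ≃ ZMod p := (ZMod.finEquiv p).toEquiv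
  have he : ∀ i : Fin p, ((i : ℕ) : ZMod p) = e i := by
    intro i
    obtain ⟨n, rfl⟩ : ∃ n, p = n + 1 := ⟨p - 1, (Nat.succ_pred_eq_of_pos (Nat.pos_of_neZero p)).symm⟩
    exact Fin.cast_val_eq_self i
  simp only [he]
  have h1 := Equiv.sum_comp (Equiv.prodCongr e e) (fun q : ZMod p × ZMod p => h q.1 q.2)
  have h2 := Equiv.sum_comp ((Equiv.prodCongr e e).trans
    (Equiv.prodCongr (Equiv.addRight x) (Equiv.addRight y)))
    (fun q : ZMod p × ZMod p => h q.1 q.2)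
  exact h2.trans h1.symm

/-- The norm form has discriminant `-D` and `-Dc'` inverts `b` modulo `p`, so a translation of the
summation variables absorbs the linear form at the cost of a constant phase. -/
theorem gaussSum_normForm_linear {D : ℕ} (hD : IsFundamental D) {p : ℕ} [Fact p.Prime]
    (h2 : p ≠ 2) (hpD : ¬ p ∣ D) {b c' : ℤ} (hbc : ∃ e : ℤ, b * (D * c') = e * p - 1) (q : ℤ × ℤ) :
    ∑ r : Fin p × Fin p, ef (((b * normForm D (r.1 : ℕ) (r.2 : ℕ) + (q.1 * (r.2 : ℕ) -
        q.2 * (r.1 : ℕ)) : ℤ) : ℂ) / p) =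
      (chi D p : ℂ) * p * ef (((c' * normForm D q.1 q.2 : ℤ) : ℂ) / p) := by
  have hp : p.Prime := Fact.out
  have hp0 : p ≠ 0 := hp.ne_zero
  obtain ⟨e, he⟩ := hbc
  have hb : ¬ (p : ℤ) ∣ b := by
    rintro ⟨t, rfl⟩
    have : (p : ℤ) ∣ 1 := ⟨e - t * (D * c'), by linarith⟩
    exact hp.one_lt.ne' (by exact_mod_cast Int.eq_one_of_dvd_one (by positivity) this)
  set κ : ℤ := ((D * (D + 1) / 4 : ℕ) : ℤ) with hκ
  have hκ4 : 4 * κ = D * (D + 1) := by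
    have h := four_mul_normForm hD 0 1
    rw [normForm, ← hκ] at h
    linarith
  set x : ℤ := c' * (D * q.1 + 2 * κ * q.2) with hx
  set y : ℤ := -(c' * (2 * q.1 + D * q.2)) with hy
  have hterm : ∀ r : Fin p × Fin p,
      ef (((b * normForm D (r.1 : ℕ) (r.2 : ℕ) + (q.1 * (r.2 : ℕ) - q.2 * (r.1 : ℕ)) : ℤ) : ℂ) / p) =
      ef (((b * normForm D ((r.1 : ℕ) + x) ((r.2 : ℕ) + y) : ℤ) : ℂ) / p) *
        ef (((c' * normForm D q.1 q.2 : ℤ) : ℂ) / p) := by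
    intro r
    rw [← ef_add, ← add_div, ← Int.cast_add]
    refine ef_int_div_congr hp0 (Int.modEq_iff_dvd.mpr
      ⟨e * (q.2 * (r.1 : ℕ) - q.1 * (r.2 : ℕ) + c' * normForm D q.1 q.2), ?_⟩)
    simp only [normForm, ← hκ, hx, hy]
    linear_combination (q.2 * (r.1 : ℕ) - q.1 * (r.2 : ℕ) + c' * (q.1 ^ 2 + D * q.1 * q.2 +
      κ * q.2 ^ 2)) * he + (b * c' * q.2 * (r.1 : ℕ) - b * c' * q.1 * (r.2 : ℕ) +
      b * c' ^ 2 * (q.1 ^ 2 + D * q.1 * q.2 + κ * q.2 ^ 2)) * hκ4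
  rw [Finset.sum_congr rfl fun r _ => hterm r, ← Finset.sum_mul]
  congr 1
  rw [← gaussSum_normForm hD h2 hpD hb]
  have hψ : ∀ a b' : ℤ, ef (((b * normForm D a b' : ℤ) : ℂ) / p) =
      ZMod.stdAddChar (N := p) ((b : ZMod p) * ((a : ZMod p) ^ 2 + D * a * b' + κ * b' ^ 2)) := by
    intro a b'
    have : (b : ZMod p) * ((a : ZMod p) ^ 2 + D * a * b' + κ * b' ^ 2) =
        ((b * normForm D a b' : ℤ) : ZMod p) := by
      rw [normForm, ← hκ]; push_cast; ring
    rw [this, ZMod.stdAddChar_coe, ef]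
    congr 1; push_cast; ring
  have h1 : ∀ r : Fin p × Fin p, ef ((b : ℂ) * normForm D (r.1 : ℕ) (r.2 : ℕ) / p) =
      ZMod.stdAddChar (N := p) ((b : ZMod p) * (((r.1 : ℕ) : ZMod p) ^ 2 + D * ((r.1 : ℕ) : ZMod p) *
        ((r.2 : ℕ) : ZMod p) + κ * ((r.2 : ℕ) : ZMod p) ^ 2)) := by
    intro r
    have := hψ (r.1 : ℕ) (r.2 : ℕ)
    push_cast at this ⊢
    exact this
  rw [Finset.sum_congr rfl fun r _ => h1 r, ← sum_fin_shift (fun u v => ZMod.stdAddChar (N := p)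
    ((b : ZMod p) * (u ^ 2 + (D : ZMod p) * u * v + (κ : ZMod p) * v ^ 2))) x y]
  refine Finset.sum_congr rfl fun r _ => ?_
  rw [hψ]
  push_cast
  rfl

theorem trace_latD_latO {D : ℕ} (hD : 0 < D) (q r : ℤ × ℤ) :
    (starRingEnd ℂ) (latD D q) * latO D r + latD D q * (starRingEnd ℂ) (latO D r) =
      ((q.1 * r.2 - q.2 * r.1 : ℤ) : ℂ) := by
  have hs := sqrt_ne_zero hD
  obtain ⟨a, b⟩ := q
  obtain ⟨x, y⟩ := r
  rw [conj_latD hD, latD_eq hD, conj_latO, latO_eq]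
  push_cast
  field_simp
  ring_nf
  simp only [Complex.I_sq]
  ring

/-- One has `γτ = b/p + s/p²` with `s = pτ/(Dc'τ + p)`. Splitting `𝔬` into classes modulo `p` leaves
a theta series at `s` for each class. Inversion moves these to `𝔡` at `-1/s = -1/τ - Dc'/p`; there
the sum over classes is a Gauss sum with linear term, and what remains is the inversion formula at
`τ`. A prime lower right entry keeps the Gauss sum over a field. -/
theorem thO_Gamma0 {D : ℕ} (hD : IsFundamental D) {a b c' : ℤ} {p : ℕ} [Fact p.Prime] (h2 : p ≠ 2)
    (hpD : ¬ p ∣ D) (hdet : a * p - b * (D * c') = 1) {τ : ℂ} (hτ : 0 < τ.im) (z w : ℂ) :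
    thO D ((a * τ + b) / (D * c' * τ + p)) (z / (D * c' * τ + p)) (w / (D * c' * τ + p)) =
      chi D p * ((D * c' * τ + p) * ef (D * c' * z * w / (D * c' * τ + p)) * thO D τ z w) := by
  have hp : p.Prime := Fact.out
  have hp0 : (p : ℂ) ≠ 0 := by exact_mod_cast hp.ne_zero
  have : NeZero p := ⟨hp.ne_zero⟩
  have hD0 := hD.pos
  have hs := sqrt_ne_zero hD0
  have hDc : (D : ℂ) ≠ 0 := by exact_mod_cast hD0.ne'
  have hτ0 : τ ≠ 0 := by rintro rfl; simp at hτ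
  set j : ℂ := D * c' * τ + p with hj
  have hdetc : (a : ℂ) * p - b * (D * c') = 1 := by exact_mod_cast congrArg (Int.cast : ℤ → ℂ) hdet
  have hjim : j.im = D * c' * τ.im := by
    rw [hj]; simp [Complex.add_im, Complex.mul_im]
  have hj0 : j ≠ 0 := by
    intro h0
    have h1 : (D * c' : ℝ) * τ.im = 0 := by rw [← hjim, h0]; simp
    rcases mul_eq_zero.mp h1 with h | h
    · have h' : ((D * c' : ℝ) : ℂ) = 0 := by rw [h]; simp
      push_cast at h'
      rw [hj, h', zero_mul, zero_add] at h0
      exact hp0 h0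
    · exact hτ.ne' h
  have hnj : 0 < Complex.normSq j := Complex.normSq_pos.mpr hj0
  set s : ℂ := p * τ / j with hsdef
  have hsim : 0 < s.im := by
    have h1 : s = (p * τ * (starRingEnd ℂ) j) / Complex.normSq j := by
      rw [hsdef, ← Complex.mul_conj]
      have : (starRingEnd ℂ) j ≠ 0 := by simpa using hj0
      field_simp
    have h2 : (p * τ * (starRingEnd ℂ) j) = (D * c' * p * Complex.normSq τ : ℝ) + p * p * τ := by
      rw [hj]
      push_cast
      rw [← Complex.mul_conj]
      simp only [map_add, map_mul, map_natCast, map_intCast]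
      ring
    rw [h1, Complex.div_ofReal_im, h2, Complex.add_im, Complex.ofReal_im, zero_add]
    have : ((p : ℂ) * p * τ).im = p * p * τ.im := by
      rw [show (p : ℂ) * p = ((p * p : ℝ) : ℂ) by push_cast; ring, Complex.im_ofReal_mul]
    rw [this]
    have hpr : (0 : ℝ) < p := by exact_mod_cast hp.pos
    positivity
  have hs0 : s ≠ 0 := by rintro h; rw [h] at hsim; simp at hsim
  have hγ : (a * τ + b) / j = b / p + s / (p * p) := by
    rw [div_eq_iff hj0, hsdef]
    field_simp
    rw [hj]
    linear_combination τ * hdetc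
  have hγim : 0 < ((a * τ + b) / j).im := by
    rw [hγ]
    have h1 : ((b : ℂ) / p + s / (p * p)).im = s.im / (p * p) := by
      have e1 : (b : ℂ) / p = ((b / p : ℝ) : ℂ) := by push_cast; rfl
      have e2 : s / ((p : ℂ) * p) = s / ((p * p : ℝ) : ℂ) := by push_cast; rfl
      rw [e1, e2, Complex.add_im, Complex.ofReal_im, zero_add, Complex.div_ofReal_im]
    rw [h1]
    have hpr : (0 : ℝ) < p := by exact_mod_cast hp.pos
    positivity
  set Z : ℂ := p * z / j with hZ
  set W : ℂ := p * w / j with hW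
  let ρ : Fin p × Fin p → ℂ := fun r => latO D ((r.1 : ℕ), (r.2 : ℕ)) / p
  -- The contribution of the class of `r` modulo `p`, whose points are `p(ρ r + l)` with `l ∈ 𝔬`.
  let S : Fin p × Fin p → ℂ := fun r => ef ((b : ℂ) * normForm D (r.1 : ℕ) (r.2 : ℕ) / p) *
    (thTerm (ρ r) s Z W * thO D s (Z + ρ r * s) (W + (starRingEnd ℂ) (ρ r) * s))
  let e : (Fin p × Fin p) × (ℤ × ℤ) ≃ ℤ × ℤ :=
    (Equiv.prodProdProdComm _ _ _ _).trans (Equiv.prodCongr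
      ((Equiv.prodComm _ _).trans (Int.divModEquiv p).symm)
      ((Equiv.prodComm _ _).trans (Int.divModEquiv p).symm))
  have he : ∀ r q, latO D (e (r, q)) = p * (ρ r + latO D q) := by
    intro r q
    have : e (r, q) = (q.1 * p + (r.1 : ℕ), q.2 * p + (r.2 : ℕ)) := by
      simp [e, Int.divModEquiv]
    rw [this]
    simp only [latO, ρ]
    push_cast
    field_simp
    ring
  have hsum : HasSum (fun x : (Fin p × Fin p) × (ℤ × ℤ) =>
      thTerm (latO D (e x)) ((a * τ + b) / j) (z / j) (w / j))
      (thO D ((a * τ + b) / j) (z / j) (w / j)) :=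
    (e.hasSum_iff (f := fun q => thTerm (latO D q) ((a * τ + b) / j) (z / j) (w / j))).mpr
      (hasSum_thO' hD0 hγim _ _)
  have hfib : ∀ r, HasSum (fun q => thTerm (latO D (e (r, q))) ((a * τ + b) / j) (z / j) (w / j))
      (S r) := by
    intro r
    refine (((hasSum_thO' hD0 hsim (Z + ρ r * s) (W + (starRingEnd ℂ) (ρ r) * s)).mul_left
      (thTerm (ρ r) s Z W)).mul_left _).congr_fun fun q => ?_
    rw [← thTerm_add]
    have hN : ((Complex.normSq (latO D (e (r, q))) : ℝ) : ℂ) =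
        p * p * Complex.normSq (ρ r + latO D q) := by
      rw [he, Complex.normSq_mul, Complex.normSq_natCast]; push_cast; ring
    have hN1 : ef ((Complex.normSq (latO D (e (r, q))) : ℂ) * (b / p)) =
        ef ((b : ℂ) * normForm D (r.1 : ℕ) (r.2 : ℕ) / p) := by
      rw [normSq_latO_eq_normForm hD]
      have h3 : (e (r, q)) = (q.1 * p + (r.1 : ℕ), q.2 * p + (r.2 : ℕ)) := by
        simp [e, Int.divModEquiv]
      rw [h3]
      have := ef_int_div_congr hp.ne_zero (a := b * normForm D (q.1 * p + (r.1 : ℕ)) (q.2 * p + (r.2 : ℕ)))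
        (b := b * normForm D (r.1 : ℕ) (r.2 : ℕ)) (by
          refine Int.ModEq.mul_left _ ?_
          have h1 : q.1 * p + (r.1 : ℕ) ≡ (r.1 : ℕ) [ZMOD p] := by
            exact Int.modEq_iff_dvd.mpr ⟨-q.1, by ring⟩
          have h2 : q.2 * p + (r.2 : ℕ) ≡ (r.2 : ℕ) [ZMOD p] := by
            exact Int.modEq_iff_dvd.mpr ⟨-q.2, by ring⟩
          exact ((h1.pow 2).add ((h1.mul_left _).mul h2)).add ((h2.pow 2).mul_left _))
      push_cast at this ⊢
      rw [← this]
      congr 1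
      ring
    rw [← hN1, thTerm, thTerm, ← ef_add, hγ, hN, he, map_mul, map_natCast]
    congr 1
    rw [hZ, hW]
    field_simp
    ring
  have hthO : thO D ((a * τ + b) / j) (z / j) (w / j) = ∑ r, S r :=
    (hsum.prod_fiberwise hfib).unique (hasSum_fintype S)
  have hdual : ∀ r, HasSum (fun v => ef ((b : ℂ) * normForm D (r.1 : ℕ) (r.2 : ℕ) / p) *
      thTerm (latD D v) (-1 / s) (Z / s + ρ r) (W / s + (starRingEnd ℂ) (ρ r)))
      (-Complex.I * s * (Real.sqrt D : ℝ) * ef (Z * W / s) * S r) := by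
    intro r
    have h := (hasSum_thD hD0 hsim (Z + ρ r * s) (W + (starRingEnd ℂ) (ρ r) * s)).mul_left
      (ef ((b : ℂ) * normForm D (r.1 : ℕ) (r.2 : ℕ) / p))
    have e1 : (Z + ρ r * s) / s = Z / s + ρ r := by field_simp
    have e2 : (W + (starRingEnd ℂ) (ρ r) * s) / s = W / s + (starRingEnd ℂ) (ρ r) := by field_simp
    rw [e1, e2] at h
    have e3 : ef ((Z + ρ r * s) * (W + (starRingEnd ℂ) (ρ r) * s) / s) =
        ef (Z * W / s) * thTerm (ρ r) s Z W := by
      rw [thTerm, ← ef_add]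
      congr 1
      rw [← Complex.mul_conj]
      field_simp
      ring
    rw [e3] at h
    have hv : -Complex.I * s * (Real.sqrt D : ℝ) * ef (Z * W / s) * S r =
        ef ((b : ℂ) * normForm D (r.1 : ℕ) (r.2 : ℕ) / p) *
        (-Complex.I * s * (Real.sqrt D : ℝ) * (ef (Z * W / s) * thTerm (ρ r) s Z W) *
          thO D s (Z + ρ r * s) (W + (starRingEnd ℂ) (ρ r) * s)) := by
      simp only [S]; ring
    rw [hv]
    exact h
  have htot := hasSum_sum (s := Finset.univ) fun r _ => hdual r
  rw [← Finset.mul_sum, ← hthO] at htot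
  have hτsum := (hasSum_thD hD0 hτ z w).mul_left ((chi D p : ℂ) * p)
  have hterm : ∀ v, ∑ r : Fin p × Fin p, ef ((b : ℂ) * normForm D (r.1 : ℕ) (r.2 : ℕ) / p) *
      thTerm (latD D v) (-1 / s) (Z / s + ρ r) (W / s + (starRingEnd ℂ) (ρ r)) =
      (chi D p : ℂ) * p * thTerm (latD D v) (-1 / τ) (z / τ) (w / τ) := by
    intro v
    have hZs : Z / s = z / τ := by rw [hZ, hsdef]; field_simp
    have hWs : W / s = w / τ := by rw [hW, hsdef]; field_simp
    have hss : -1 / s = -1 / τ - D * c' / p := by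
      rw [hsdef]; field_simp; rw [hj]; ring
    have h1 : ∀ r : Fin p × Fin p, ef ((b : ℂ) * normForm D (r.1 : ℕ) (r.2 : ℕ) / p) *
        thTerm (latD D v) (-1 / s) (Z / s + ρ r) (W / s + (starRingEnd ℂ) (ρ r)) =
        ef (((b * normForm D (r.1 : ℕ) (r.2 : ℕ) + (v.1 * (r.2 : ℕ) -
        v.2 * (r.1 : ℕ)) : ℤ) : ℂ) / p) * thTerm (latD D v) (-1 / s) (z / τ) (w / τ) := by
      intro r
      have ht := trace_latD_latO hD0 v ((r.1 : ℕ), (r.2 : ℕ))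
      rw [thTerm, thTerm, ← ef_add, ← ef_add, hZs, hWs]
      congr 1
      have ht' : (starRingEnd ℂ) (latD D v) * ρ r + latD D v * (starRingEnd ℂ) (ρ r) =
          ((v.1 * (r.2 : ℕ) - v.2 * (r.1 : ℕ) : ℤ) : ℂ) / p := by
        rw [← ht]
        simp only [ρ, map_div₀, map_natCast]
        ring
      push_cast at ht' ⊢
      linear_combination ht'
    -- The phase `c'·normForm(v)/p` of the Gauss sum cancels against `-|v|²Dc'/p`, which comes from
    -- the shift of `-1/s` relative to `-1/τ`.
    rw [Finset.sum_congr rfl fun r _ => h1 r, ← Finset.sum_mul,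
      gaussSum_normForm_linear hD h2 hpD ⟨a, by linarith⟩ v, mul_assoc ((chi D p : ℂ) * p)]
    congr 1
    rw [thTerm, thTerm, ← ef_add, hss, normSq_latD, Complex.ofReal_div, normSq_latO_eq_normForm hD]
    congr 1
    push_cast
    field_simp
    ring
  have huniq := htot.unique (hτsum.congr_fun hterm)
  have hI := Complex.I_ne_zero
  have hef : ef (z * w / τ) = ef (Z * W / s) * ef (D * c' * z * w / j) := by
    rw [← ef_add]
    congr 1
    rw [hZ, hW, hsdef]
    field_simp
    rw [hj]
    ring
  rw [hef] at huniq
  have hcancel : (-Complex.I * s * (Real.sqrt D : ℝ) * ef (Z * W / s)) ≠ 0 :=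
    mul_ne_zero (mul_ne_zero (mul_ne_zero (neg_ne_zero.mpr hI) hs0) hs) (ef_ne_zero _)
  refine mul_left_cancel₀ hcancel (huniq.trans ?_)
  rw [hsdef]
  field_simp

end

section


/-! ### Uniqueness of absolutely convergent Fourier expansions -/

theorem integral_ef_int (n : ℤ) :
    ∫ x in (0 : ℝ)..1, ef ((n : ℂ) * x) = if n = 0 then 1 else 0 := by
  split_ifs with h
  · simp [h, ef_zero]
  · have hc : 2 * (Real.pi : ℂ) * Complex.I * n ≠ 0 :=
      mul_ne_zero Complex.two_pi_I_ne_zero (by exact_mod_cast h)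
    have := integral_exp_mul_complex (a := 0) (b := 1) hc
    have h2 : ∀ x : ℝ, ef ((n : ℂ) * x) = Complex.exp (2 * (Real.pi : ℂ) * Complex.I * n * x) := by
      intro x; rw [ef]; congr 1; ring
    simp only [h2]
    rw [this]
    have h3 := ef_intCast n
    rw [ef] at h3
    simp [h3]

/-- After multiplication by `𝖾[-k(i₀)x]`, absolute summability allows termwise integration over a
period, which isolates one coefficient. -/
theorem fourier_unique {I : Type*} [Countable I] {k : I → ℤ} (hk : Function.Injective k)
    {c : I → ℂ} (hc : Summable c) (h : ∀ x : ℝ, HasSum (fun i => c i * ef ((k i : ℂ) * x)) 0)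
    (i₀ : I) : c i₀ = 0 := by
  classical
  set μ := MeasureTheory.volume.restrict (Set.Ioc (0 : ℝ) 1) with hμ
  let F : I → ℝ → ℂ := fun i x => c i * ef (((k i - k i₀ : ℤ) : ℂ) * x)
  have hcont : ∀ n : ℤ, Continuous fun x : ℝ => ef ((n : ℂ) * x) := by
    intro n; unfold ef; fun_prop
  have hnorm : ∀ i x, ‖F i x‖ = ‖c i‖ := by
    intro i x
    have : ((k i - k i₀ : ℤ) : ℂ) * x = (((k i - k i₀ : ℤ) * x : ℝ) : ℂ) := by push_cast; ring
    simp only [F, norm_mul, this, norm_ef_real, mul_one]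
  have hint : ∀ i, MeasureTheory.Integrable (F i) μ := by
    intro i
    have : Continuous (F i) := continuous_const.mul (hcont _)
    exact (this.integrableOn_Icc (a := 0) (b := 1)).mono_set Set.Ioc_subset_Icc_self
  have hs := MeasureTheory.hasSum_integral_of_summable_integral_norm hint (by
    simp only [hnorm]
    simpa [hμ] using hc.norm)
  have hzero : ∀ x : ℝ, ∑' i, F i x = 0 := by
    intro x
    have h1 := (h x).mul_right (ef (((- k i₀ : ℤ) : ℂ) * x))
    rw [zero_mul] at h1
    refine HasSum.tsum_eq (h1.congr_fun fun i => ?_)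
    simp only [F]
    rw [mul_assoc, ← ef_add]
    congr 2
    push_cast; ring
  simp only [hzero, MeasureTheory.integral_zero] at hs
  have hval : ∀ i, ∫ x, F i x ∂μ = if i = i₀ then c i₀ else 0 := by
    intro i
    have h1 : ∫ x, F i x ∂μ = c i * ∫ x in (0 : ℝ)..1, ef (((k i - k i₀ : ℤ) : ℂ) * x) := by
      rw [intervalIntegral.integral_of_le zero_le_one, ← MeasureTheory.integral_const_mul]
    rw [h1, integral_ef_int]
    by_cases hi : i = i₀
    · simp [hi]
    · have : k i - k i₀ ≠ 0 := fun h => hi (hk (by linarith))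
      simp [hi, this]
  simp only [hval] at hs
  exact (hasSum_ite_eq i₀ (c i₀)).unique hs

theorem fourier_unique_prod {c : ℤ × ℤ → ℂ}
    (h : ∀ x y : ℝ, HasSum (fun q => c q * ef ((q.1 : ℂ) * x + (q.2 : ℂ) * y)) 0) (q : ℤ × ℤ) :
    c q = 0 := by
  obtain ⟨m, n⟩ := q
  have hnorm : ∀ (q : ℤ × ℤ) (x y : ℝ), ‖c q * ef ((q.1 : ℂ) * x + (q.2 : ℂ) * y)‖ = ‖c q‖ := by
    intro q x y
    have : (q.1 : ℂ) * x + (q.2 : ℂ) * y = ((q.1 * x + q.2 * y : ℝ) : ℂ) := by push_cast; ring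
    rw [norm_mul, this, norm_ef_real, mul_one]
  have hrow : ∀ (m : ℤ) (y : ℝ), Summable fun n : ℤ => c (m, n) * ef ((n : ℂ) * y) := by
    intro m y
    have := (h 0 y).summable.comp_injective (i := fun n : ℤ => ((m, n) : ℤ × ℤ))
      (fun a b hab => by simpa using hab)
    simpa [Function.comp_def] using this
  have hinner : ∀ (y : ℝ) (m : ℤ), ∑' n : ℤ, c (m, n) * ef ((n : ℂ) * y) = 0 := by
    intro y
    refine fourier_unique (k := id) Function.injective_id ?_ ?_
    · have h0 : Summable fun q : ℤ × ℤ => c q * ef ((q.2 : ℂ) * y) := by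
        simpa using (h 0 y).summable
      exact h0.prod
    · intro x
      have h1 := (h x y).prod_fiberwise (g := fun m => (∑' n : ℤ, c (m, n) * ef ((n : ℂ) * y)) *
        ef ((m : ℂ) * x)) (fun m => by
          refine ((hrow m y).hasSum.mul_right (ef ((m : ℂ) * x))).congr_fun fun n => ?_
          rw [mul_assoc, ← ef_add]; simp only; rw [add_comm])
      exact h1
  refine fourier_unique (k := id) (c := fun n => c (m, n)) Function.injective_id ?_ ?_ n
  · simpa [ef_zero] using hrow m 0
  · intro y
    have := (hrow m y).hasSum
    rw [hinner y m] at this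
    exact this

/-! ### Coordinates on `𝔡` -/

variable {K : Type*} [Field K] [NumberField K]

/-- `K` is imaginary quadratic: its ring of integers is `ℤ + ℤω`. -/
structure IsImaginaryQuadratic (ι : K →+* ℂ) : Prop where
  fund : IsFundamental (absDisc K)
  mem_iff : ∀ x, x ∈ intLattice ι ↔ ∃ a b : ℤ, x = a + b * omega (absDisc K)

variable {ι : K →+* ℂ}

theorem latO_injective {D : ℕ} (hD : 0 < D) : Function.Injective (latO D) := by
  rintro ⟨a, b⟩ ⟨a', b'⟩ h
  have hr : (0 : ℝ) < Real.sqrt D := Real.sqrt_pos.mpr (by exact_mod_cast hD)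
  have him : ∀ a b : ℤ, (latO D (a, b)).im = b * Real.sqrt D / 2 := by
    intro a b
    rw [latO_eq]
    have : ((2 * a + D * b : ℤ) : ℂ) / 2 = (((2 * a + D * b : ℤ) / 2 : ℝ) : ℂ) := by push_cast; rfl
    rw [this]
    have : Complex.I * (b * (Real.sqrt D : ℝ) / 2) = ((b * Real.sqrt D / 2 : ℝ) : ℂ) * Complex.I := by
      push_cast; ring
    rw [this]
    simp
  have h1 := congrArg Complex.im h
  rw [him, him] at h1
  have hb : (b : ℝ) = b' := by
    have : (b : ℝ) * Real.sqrt D = b' * Real.sqrt D := by linarith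
    exact mul_right_cancel₀ hr.ne' this
  obtain rfl : b = b' := by exact_mod_cast hb
  simp only [latO, add_left_inj] at h
  exact Prod.ext (by exact_mod_cast h) rfl

theorem latD_injective {D : ℕ} (hD : 0 < D) : Function.Injective (latD D) := by
  intro p q h
  refine latO_injective hD ?_
  rw [latD, latD] at h
  exact mul_left_cancel₀ (div_ne_zero Complex.I_ne_zero (sqrt_ne_zero hD)) h

theorem latO_eq_latD {D : ℕ} (hD : IsFundamental D) (a b : ℤ) :
    ∃ q, latO D (a, b) = latD D q := by
  have hs := sqrt_ne_zero hD.pos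
  have hκ : (4 : ℤ) * ((D * (D + 1) / 4 : ℕ) : ℤ) = D * (D + 1) := by
    have h := four_mul_normForm hD 0 1
    rw [normForm] at h
    linarith
  refine ⟨(D * a + 2 * ((D * (D + 1) / 4 : ℕ) : ℤ) * b, -(2 * a + D * b)), ?_⟩
  rw [latO_eq, latD_eq hD.pos]
  have hκ' := congrArg (Int.cast : ℤ → ℂ) hκ
  push_cast at hκ' ⊢
  have hsq := sqrt_sq D
  generalize ((Real.sqrt D : ℝ) : ℂ) = r at hs hsq ⊢
  field_simp
  linear_combination Complex.I * b * hsq - Complex.I * b * hκ'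

namespace IsImaginaryQuadratic

theorem latO_mem (hK : IsImaginaryQuadratic ι) (p : ℤ × ℤ) :
    latO (absDisc K) p ∈ intLattice ι := (hK.mem_iff _).mpr ⟨p.1, p.2, rfl⟩

theorem latD_mem (hK : IsImaginaryQuadratic ι) (p : ℤ × ℤ) :
    latD (absDisc K) p ∈ invDiff ι := ⟨latO (absDisc K) p, hK.latO_mem p, rfl⟩

theorem intLattice_le (hK : IsImaginaryQuadratic ι) : intLattice ι ≤ invDiff ι := by
  intro x hx
  obtain ⟨a, b, rfl⟩ := (hK.mem_iff x).mp hx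
  obtain ⟨q, hq⟩ := latO_eq_latD hK.fund a b
  have : (a : ℂ) + b * omega (absDisc K) = latO (absDisc K) (a, b) := rfl
  rw [this, hq]
  exact hK.latD_mem q

/-- Coordinates on `𝔬`. -/
def equivO (hK : IsImaginaryQuadratic ι) : ℤ × ℤ ≃ intLattice ι :=
  Equiv.ofBijective (fun p => ⟨latO (absDisc K) p, hK.latO_mem p⟩)
    ⟨fun p q h => latO_injective hK.fund.pos (congrArg Subtype.val h), fun x => by
      obtain ⟨a, b, h⟩ := (hK.mem_iff x).mp x.2
      exact ⟨(a, b), Subtype.ext h.symm⟩⟩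

/-- Coordinates on `𝔡`. -/
def equivD (hK : IsImaginaryQuadratic ι) : ℤ × ℤ ≃ invDiff ι :=
  Equiv.ofBijective (fun p => ⟨latD (absDisc K) p, hK.latD_mem p⟩)
    ⟨fun p q h => latD_injective hK.fund.pos (congrArg Subtype.val h), fun x => by
      obtain ⟨y, hy, h⟩ := x.2
      obtain ⟨a, b, rfl⟩ := (hK.mem_iff y).mp hy
      exact ⟨(a, b), Subtype.ext h⟩⟩

@[simp] theorem equivD_apply (hK : IsImaginaryQuadratic ι) (p : ℤ × ℤ) :
    ((hK.equivD p : invDiff ι) : ℂ) = latD (absDisc K) p := rfl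

/-- Uniqueness of the Fourier coefficients in `(z, w)`. -/
theorem fourier_unique_invDiff (hK : IsImaginaryQuadratic ι) {c : invDiff ι → ℂ}
    (h : ∀ z w : ℂ, HasSum (fun t : invDiff ι =>
      c t * ef ((starRingEnd ℂ) (t : ℂ) * z + (t : ℂ) * w)) 0) (t : invDiff ι) : c t = 0 := by
  have hD0 := hK.fund.pos
  obtain ⟨q, rfl⟩ := hK.equivD.surjective t
  refine fourier_unique_prod (c := fun q => c (hK.equivD q)) ?_ q
  · intro x y
    -- On `z = xω - y`, `w = z̄` with real `x, y`, the exponent attached to the point of `𝔡` with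
    -- coordinates `q` is the trace pairing `q₁x + q₂y`.
    have h1 := hK.equivD.hasSum_iff.mpr (h (x * omega (absDisc K) - y)
      ((starRingEnd ℂ) (x * omega (absDisc K) - y)))
    refine h1.congr_fun fun q => ?_
    simp only [Function.comp, equivD_apply]
    congr 2
    have e1 := trace_latD_latO hD0 q (0, 1)
    have e2 := trace_latD_latO hD0 q (1, 0)
    simp only [latO, Int.cast_zero, Int.cast_one, zero_add, one_mul, mul_zero, zero_mul,
      mul_one, add_zero, map_one, sub_zero, zero_sub] at e1 e2
    rw [map_sub, map_mul, Complex.conj_ofReal, Complex.conj_ofReal]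
    push_cast at e1 e2
    linear_combination -(x : ℂ) * e1 + (y : ℂ) * e2

/-- Summing an expansion over `ℓ` first. -/
theorem hasSum_fiber {ν : ℕ} {c : ℕ → invDiff ι → ℂ} {φ : ℍ → ℂ → ℂ → ℂ} {m : ℕ}
    (h : HasFourierExpansion ι m ν c φ) (τ : ℍ) :
    (∀ t, Summable fun ℓ : ℕ => c ℓ t * ef ((ℓ : ℂ) / ν * τ)) ∧
    ∀ z w, HasSum (fun t : invDiff ι => (∑' ℓ : ℕ, c ℓ t * ef ((ℓ : ℂ) / ν * τ)) *
      ef ((starRingEnd ℂ) (t : ℂ) * z + (t : ℂ) * w)) (φ τ z w) := by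
  have hs : ∀ t, Summable fun ℓ : ℕ => c ℓ t * ef ((ℓ : ℂ) / ν * τ) := by
    intro t
    have := (h.2 τ 0 0).summable.comp_injective (i := fun ℓ : ℕ => ((ℓ, t) : ℕ × invDiff ι))
      (fun a b hab => by simpa using hab)
    simpa [Function.comp_def] using this
  refine ⟨hs, fun z w => ?_⟩
  have h1 := ((Equiv.prodComm (invDiff ι) ℕ).hasSum_iff.mpr (h.2 τ z w))
  refine h1.prod_fiberwise fun t => ?_
  refine ((hs t).hasSum.mul_right _).congr_fun fun ℓ => ?_
  simp only [Function.comp, Equiv.prodComm_apply, Prod.swap]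
  rw [mul_assoc, ← ef_add, add_assoc]

theorem qSeries_unique {ν : ℕ} (hν : 0 < ν) {c : ℕ → ℂ}
    (h : ∀ τ : ℍ, HasSum (fun ℓ : ℕ => c ℓ * ef ((ℓ : ℂ) / ν * τ)) 0) (ℓ : ℕ) : c ℓ = 0 := by
  have hν' : (ν : ℂ) ≠ 0 := by exact_mod_cast hν.ne'
  have key := fourier_unique (k := fun n : ℕ => (n : ℤ)) Nat.cast_injective
    (c := fun ℓ => c ℓ * ef ((ℓ : ℂ) / ν * Complex.I)) ?_ ?_ ℓ
  · exact (mul_eq_zero.mp key).resolve_right (ef_ne_zero _)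
  · exact (h UpperHalfPlane.I).summable
  · intro x
    have h1 := h ⟨Complex.I + ν * x, by simp⟩
    refine h1.congr_fun fun n => ?_
    rw [mul_assoc, ← ef_add]
    congr 2
    show _ = (n : ℂ) / ν * (Complex.I + ν * x)
    push_cast
    field_simp

/-- Summing over `ℓ` first gives uniqueness in `(z, w)`, then the remaining `q`-series is unique in
`τ`. This frees `jacobiCoeff` from its choice of an expansion. -/
theorem expansion_unique (hK : IsImaginaryQuadratic ι) {m ν : ℕ} (hν : 0 < ν)
    {c c' : ℕ → invDiff ι → ℂ} {φ : ℍ → ℂ → ℂ → ℂ}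
    (h : HasFourierExpansion ι m ν c φ) (h' : HasFourierExpansion ι m ν c' φ) : c = c' := by
  funext ℓ t
  rw [← sub_eq_zero]
  refine qSeries_unique (c := fun ℓ => c ℓ t - c' ℓ t) hν (fun τ => ?_) ℓ
  obtain ⟨s, e⟩ := hasSum_fiber h τ
  obtain ⟨s', e'⟩ := hasSum_fiber h' τ
  have h0 := hK.fourier_unique_invDiff (c := fun t => (∑' ℓ : ℕ, c ℓ t * ef ((ℓ : ℂ) / ν * τ)) -
    ∑' ℓ : ℕ, c' ℓ t * ef ((ℓ : ℂ) / ν * τ)) (fun z w => by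
      have := (e z w).sub (e' z w)
      rw [sub_self] at this
      exact this.congr_fun fun t => by ring) t
  have h1 := (s t).hasSum.sub (s' t).hasSum
  rw [h0] at h1
  exact h1.congr_fun fun ℓ => by ring

end IsImaginaryQuadratic

end

section


/-! ### The finite quadratic module `[𝔡]` and the theta functions `ϑ_u` -/

variable {K : Type*} [Field K] [NumberField K] {ι : K →+* ℂ}

theorem discGroup_mk_eq_iff {a b : invDiff ι} :
    (QuotientAddGroup.mk a : DiscGroup ι) = QuotientAddGroup.mk b ↔
      (b : ℂ) - (a : ℂ) ∈ intLattice ι := by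
  rw [QuotientAddGroup.eq, AddSubgroup.mem_addSubgroupOf]
  push_cast
  rw [neg_add_eq_sub]

theorem nat_mul_latD {D : ℕ} (hD : IsFundamental D) (p : ℤ × ℤ) :
    ∃ q, (D : ℂ) * latD D p = latO D q := by
  have hs := sqrt_ne_zero hD.pos
  have hκ : (4 : ℤ) * ((D * (D + 1) / 4 : ℕ) : ℤ) = D * (D + 1) := by
    have h := four_mul_normForm hD 0 1
    rw [normForm] at h
    linarith
  refine ⟨(-D * p.1 - 2 * ((D * (D + 1) / 4 : ℕ) : ℤ) * p.2, 2 * p.1 + D * p.2), ?_⟩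
  rw [latO_eq, latD_eq hD.pos]
  have hκ' := congrArg (Int.cast : ℤ → ℂ) hκ
  push_cast at hκ' ⊢
  have hsq := sqrt_sq D
  generalize ((Real.sqrt D : ℝ) : ℂ) = r at hs hsq ⊢
  field_simp
  linear_combination -(2 * p.1 * Complex.I + D * p.2 * Complex.I) * hsq + p.2 * r * hκ'

namespace IsImaginaryQuadratic

theorem finite_discGroup (hK : IsImaginaryQuadratic ι) : Finite (DiscGroup ι) := by
  have hD := hK.fund.pos
  have hD' : (absDisc K : ℤ) ≠ 0 := by exact_mod_cast hD.ne'
  refine Finite.of_surjective (α := Set.Ico (0 : ℤ) (absDisc K) × Set.Ico (0 : ℤ) (absDisc K))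
    (fun p => QuotientAddGroup.mk (hK.equivD (p.1, p.2))) fun u => ?_
  obtain ⟨x, rfl⟩ := QuotientAddGroup.mk_surjective u
  obtain ⟨q, rfl⟩ := hK.equivD.surjective x
  have hmem : ∀ a : ℤ, a % (absDisc K : ℤ) ∈ Set.Ico (0 : ℤ) (absDisc K) := fun a =>
    ⟨Int.emod_nonneg _ hD', Int.emod_lt_of_pos _ (by exact_mod_cast hD)⟩
  refine ⟨(⟨_, hmem q.1⟩, ⟨_, hmem q.2⟩), ?_⟩
  rw [discGroup_mk_eq_iff]
  obtain ⟨r, hr⟩ := nat_mul_latD hK.fund (q.1 / absDisc K, q.2 / absDisc K)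
  have : latD (absDisc K) q - latD (absDisc K) (q.1 % absDisc K, q.2 % absDisc K) =
      latO (absDisc K) r := by
    rw [← hr, latD_eq hD, latD_eq hD, latD_eq hD]
    have h1 := congrArg (Int.cast : ℤ → ℂ) (Int.emod_add_mul_ediv q.1 (absDisc K))
    have h2 := congrArg (Int.cast : ℤ → ℂ) (Int.emod_add_mul_ediv q.2 (absDisc K))
    push_cast at h1 h2 ⊢
    generalize ((q.1 % (absDisc K : ℤ) : ℤ) : ℂ) = a at *
    generalize ((q.2 % (absDisc K : ℤ) : ℤ) : ℂ) = b at *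
    rw [← h1, ← h2]
    ring
  simp only [equivD_apply]
  rw [this]
  exact hK.latO_mem r

theorem trace_mem (hK : IsImaginaryQuadratic ι) {x l : ℂ} (hx : x ∈ invDiff ι)
    (hl : l ∈ intLattice ι) :
    ∃ n : ℤ, (starRingEnd ℂ) x * l + x * (starRingEnd ℂ) l = n := by
  obtain ⟨q, hq⟩ := hK.equivD.surjective ⟨x, hx⟩
  obtain ⟨r, hr⟩ := hK.equivO.surjective ⟨l, hl⟩
  obtain rfl : latD (absDisc K) q = x := congrArg Subtype.val hq
  obtain rfl : latO (absDisc K) r = l := congrArg Subtype.val hr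
  exact ⟨_, trace_latD_latO hK.fund.pos q r⟩

theorem normSq_intLattice (hK : IsImaginaryQuadratic ι) {l : ℂ} (hl : l ∈ intLattice ι) :
    ∃ n : ℤ, (Complex.normSq l : ℂ) = n := by
  obtain ⟨r, hr⟩ := hK.equivO.surjective ⟨l, hl⟩
  obtain rfl : latO (absDisc K) r = l := congrArg Subtype.val hr
  exact ⟨_, by exact_mod_cast normSq_latO_eq_normForm hK.fund r⟩

theorem normSq_add_intLattice (hK : IsImaginaryQuadratic ι) {x l : ℂ} (hx : x ∈ invDiff ι)
    (hl : l ∈ intLattice ι) : ∃ n : ℤ, (Complex.normSq (x + l) : ℂ) = Complex.normSq x + n := by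
  obtain ⟨m, hm⟩ := hK.trace_mem hx hl
  obtain ⟨n, hn⟩ := hK.normSq_intLattice hl
  refine ⟨m + n, ?_⟩
  push_cast
  rw [← hm, ← hn, Complex.normSq_eq_conj_mul_self, Complex.normSq_eq_conj_mul_self,
    Complex.normSq_eq_conj_mul_self, map_add]
  ring

theorem mul_normSq_invDiff (hK : IsImaginaryQuadratic ι) {x : ℂ} (hx : x ∈ invDiff ι) :
    ∃ a b : ℤ, (absDisc K : ℝ) * Complex.normSq x = normForm (absDisc K) a b := by
  obtain ⟨q, hq⟩ := hK.equivD.surjective ⟨x, hx⟩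
  obtain rfl : latD (absDisc K) q = x := congrArg Subtype.val hq
  refine ⟨q.1, q.2, ?_⟩
  have hD : (absDisc K : ℝ) ≠ 0 := by exact_mod_cast hK.fund.pos.ne'
  have h : Complex.normSq (latO (absDisc K) q) = normForm (absDisc K) q.1 q.2 := by
    exact_mod_cast normSq_latO_eq_normForm hK.fund q
  rw [normSq_latD, h]
  field_simp

/-- The floor defining `normD` is exact, because `D|x|²` is a value of `normForm` at the chosen
representative; changing `x` by an element of `𝔬` changes `|x|²` by an integer. -/
theorem normD_mk (hK : IsImaginaryQuadratic ι) (x : invDiff ι) :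
    ∃ m : ℤ, (absDisc K : ℝ) * Complex.normSq (x : ℂ) =
      normD ι (QuotientAddGroup.mk x) + absDisc K * m := by
  set y : invDiff ι := (QuotientAddGroup.mk x : DiscGroup ι).out with hy
  have hxy : (x : ℂ) - y ∈ intLattice ι := by
    rw [← discGroup_mk_eq_iff, hy]
    exact QuotientAddGroup.out_eq' _
  obtain ⟨m, hm⟩ := hK.normSq_add_intLattice y.2 hxy
  obtain ⟨a, b, hab⟩ := hK.mul_normSq_invDiff y.2
  refine ⟨m, ?_⟩
  have h1 : normD ι (QuotientAddGroup.mk x) = normForm (absDisc K) a b := by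
    rw [normD, ← hy, hab, Int.floor_intCast]
  rw [h1, ← hab]
  rw [add_sub_cancel] at hm
  have : Complex.normSq (x : ℂ) = Complex.normSq (y : ℂ) + m := by exact_mod_cast hm
  rw [this]; ring

/-- `D|u|²` is the norm of an element of `𝔬`. This is the arithmetic source of the plus condition.
-/
theorem chiP_normD_ne (hK : IsImaginaryQuadratic ι) {p : ℕ} (hp : p.Prime) (hpD : p ∣ absDisc K)
    (u : DiscGroup ι) : chiP (absDisc K) p (normD ι u) ≠ -1 := by
  obtain ⟨a, b, hab⟩ := hK.mul_normSq_invDiff u.out.2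
  have : normD ι u = normForm (absDisc K) a b := by
    rw [normD, hab, Int.floor_intCast]
  rw [this]
  exact hK.fund.chiP_norm_ne hp hpD _ a b (four_mul_normForm hK.fund a b)

theorem ef_normSq (hK : IsImaginaryQuadratic ι) (x : invDiff ι) :
    ef (Complex.normSq (x : ℂ)) =
      ef ((normD ι (QuotientAddGroup.mk x) : ℂ) / absDisc K) := by
  obtain ⟨m, hm⟩ := hK.normD_mk x
  refine ef_congr ⟨m, ?_⟩
  have hD : (absDisc K : ℂ) ≠ 0 := by exact_mod_cast hK.fund.pos.ne'
  have := congrArg (Complex.ofReal) hm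
  push_cast at this
  field_simp
  linear_combination this

theorem normD_mk_modEq_of_normSq_eq (hK : IsImaginaryQuadratic ι) {x y : invDiff ι}
    (h : Complex.normSq (x : ℂ) = Complex.normSq (y : ℂ)) :
    normD ι (QuotientAddGroup.mk x) ≡ normD ι (QuotientAddGroup.mk y) [ZMOD absDisc K] := by
  obtain ⟨m, hm⟩ := hK.normD_mk x
  obtain ⟨n, hn⟩ := hK.normD_mk y
  rw [h, hn] at hm
  refine (Int.modEq_iff_dvd.mpr ⟨m - n, ?_⟩)
  have : normD ι (QuotientAddGroup.mk y) + absDisc K * n =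
    normD ι (QuotientAddGroup.mk x) + absDisc K * m := by exact_mod_cast hm
  linarith

theorem normD_zero (hK : IsImaginaryQuadratic ι) : normD ι 0 ≡ 0 [ZMOD absDisc K] := by
  obtain ⟨m, hm⟩ := hK.normD_mk (0 : invDiff ι)
  have h0 : (QuotientAddGroup.mk (0 : invDiff ι) : DiscGroup ι) = 0 := rfl
  rw [h0] at hm
  simp only [AddSubgroup.coe_zero, map_zero, mul_zero] at hm
  refine Int.modEq_iff_dvd.mpr ⟨m, ?_⟩
  have : 0 = normD ι 0 + absDisc K * m := by exact_mod_cast hm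
  linarith

/-- The coset of `x` in `𝔡`, in coordinates. -/
def equivCoset (hK : IsImaginaryQuadratic ι) (x : invDiff ι) :
    ℤ × ℤ ≃ {a : invDiff ι // (QuotientAddGroup.mk a : DiscGroup ι) = QuotientAddGroup.mk x} :=
  Equiv.ofBijective (fun q => ⟨x + ⟨latO (absDisc K) q, hK.intLattice_le (hK.latO_mem q)⟩, by
      rw [eq_comm, discGroup_mk_eq_iff]
      simpa using hK.latO_mem q⟩)
    ⟨fun p q h => latO_injective hK.fund.pos (by
        have := congrArg (fun a => ((a.1 : invDiff ι) : ℂ)) h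
        simpa using this), fun a => by
      have := a.2
      rw [eq_comm, discGroup_mk_eq_iff] at this
      obtain ⟨q, hq⟩ := hK.equivO.surjective ⟨_, this⟩
      have hq' : latO (absDisc K) q = a.1 - x := congrArg Subtype.val hq
      exact ⟨q, Subtype.ext (Subtype.ext (by simp [hq']))⟩⟩

theorem equivCoset_apply (hK : IsImaginaryQuadratic ι) (x : invDiff ι) (q : ℤ × ℤ) :
    (((hK.equivCoset x q).1 : invDiff ι) : ℂ) = x + latO (absDisc K) q := rfl

theorem hasSum_theta_coset (hK : IsImaginaryQuadratic ι) (x : invDiff ι) (τ : ℍ) (z w : ℂ) :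
    HasSum (fun a : {a : invDiff ι // (QuotientAddGroup.mk a : DiscGroup ι) =
      QuotientAddGroup.mk x} => thTerm (a.1 : ℂ) τ z w)
      (thTerm x τ z w * thO (absDisc K) τ (z + x * τ) (w + (starRingEnd ℂ) (x : ℂ) * τ)) := by
  rw [← (hK.equivCoset x).hasSum_iff]
  refine ((hasSum_thO' hK.fund.pos τ.im_pos _ _).mul_left _).congr_fun fun q => ?_
  simp only [Function.comp, equivCoset_apply]
  exact thTerm_add _ _ _ _ _

theorem theta_mk (hK : IsImaginaryQuadratic ι) (x : invDiff ι) (τ : ℍ) (z w : ℂ) :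
    theta ι (QuotientAddGroup.mk x) τ z w =
      thTerm x τ z w * thO (absDisc K) τ (z + x * τ) (w + (starRingEnd ℂ) (x : ℂ) * τ) :=
  (hK.hasSum_theta_coset x τ z w).tsum_eq

theorem theta_zero (hK : IsImaginaryQuadratic ι) (τ : ℍ) (z w : ℂ) :
    theta ι 0 τ z w = thO (absDisc K) τ z w := by
  have := hK.theta_mk 0 τ z w
  simp only [AddSubgroup.coe_zero, map_zero, zero_mul, add_zero, thTerm, ofReal_zero, ef_zero,
    one_mul] at this
  exact this

theorem hasSum_theta (hK : IsImaginaryQuadratic ι) (u : DiscGroup ι) (τ : ℍ) (z w : ℂ) :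
    HasSum (fun a : {a : invDiff ι // (QuotientAddGroup.mk a : DiscGroup ι) = u} =>
      thTerm (a.1 : ℂ) τ z w) (theta ι u τ z w) := by
  obtain ⟨x, rfl⟩ := QuotientAddGroup.mk_surjective u
  exact (hK.hasSum_theta_coset x τ z w).summable.hasSum

theorem hasSum_mul_theta [Fintype (DiscGroup ι)] (hK : IsImaginaryQuadratic ι)
    (c : DiscGroup ι → ℂ) (τ : ℍ) (z w : ℂ) :
    HasSum (fun a : invDiff ι => c (QuotientAddGroup.mk a) * thTerm (a : ℂ) τ z w)
      (∑ u, c u * theta ι u τ z w) := by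
  classical
  have h1 : ∀ u : DiscGroup ι, HasSum (fun a : invDiff ι =>
      c u * if (QuotientAddGroup.mk a : DiscGroup ι) = u then thTerm (a : ℂ) τ z w else 0)
      (c u * theta ι u τ z w) := by
    intro u
    refine HasSum.mul_left _ ?_
    have h2 := hasSum_subtype_iff_indicator (s := {a : invDiff ι |
      (QuotientAddGroup.mk a : DiscGroup ι) = u}) (f := fun a : invDiff ι => thTerm (a : ℂ) τ z w)
      (a := theta ι u τ z w)
    exact (h2.mp (hK.hasSum_theta u τ z w)).congr_fun fun a => by simp [Set.indicator_apply]
  have := hasSum_sum (s := Finset.univ) fun u _ => h1 u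
  exact this.congr_fun fun a => by simp

/-- The `ϑ_u(τ,·,·)` are linearly independent. -/
theorem theta_linearIndependent [Fintype (DiscGroup ι)] (hK : IsImaginaryQuadratic ι)
    {c : DiscGroup ι → ℂ} {τ : ℍ} (h : ∀ z w, ∑ u, c u * theta ι u τ z w = 0)
    (u : DiscGroup ι) : c u = 0 := by
  obtain ⟨x, rfl⟩ := QuotientAddGroup.mk_surjective u
  have := hK.fourier_unique_invDiff (c := fun a : invDiff ι => c (QuotientAddGroup.mk a) *
    ef (Complex.normSq (a : ℂ) * τ)) (fun z w => by
      have h1 := hK.hasSum_mul_theta c τ z w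
      rw [h z w] at h1
      refine h1.congr_fun fun a => ?_
      rw [thTerm, mul_assoc, ← ef_add, add_assoc]) x
  exact (mul_eq_zero.mp this).resolve_right (ef_ne_zero _)

theorem differentiableAt_theta (hK : IsImaginaryQuadratic ι) (u : DiscGroup ι) {x : ℂ × ℂ × ℂ}
    (hx : 0 < x.1.im) :
    DifferentiableAt ℂ (fun p : ℂ × ℂ × ℂ => theta ι u (ofComplex p.1) p.2.1 p.2.2) x := by
  obtain ⟨y, rfl⟩ := QuotientAddGroup.mk_surjective u
  have h1 : DifferentiableAt ℂ (fun p : ℂ × ℂ × ℂ => thTerm y p.1 p.2.1 p.2.2 *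
      thO (absDisc K) p.1 (p.2.1 + y * p.1) (p.2.2 + (starRingEnd ℂ) (y : ℂ) * p.1)) x := by
    refine DifferentiableAt.mul ?_ ?_
    · unfold thTerm ef
      fun_prop
    · exact (differentiableAt_thO hK.fund.pos
        (x := (x.1, x.2.1 + y * x.1, x.2.2 + (starRingEnd ℂ) (y : ℂ) * x.1)) hx).comp x
        (f := fun p : ℂ × ℂ × ℂ =>
          (p.1, p.2.1 + (y : ℂ) * p.1, p.2.2 + (starRingEnd ℂ) (y : ℂ) * p.1)) (by fun_prop)
  refine h1.congr_of_eventuallyEq ?_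
  have : ∀ᶠ p : ℂ × ℂ × ℂ in nhds x, 0 < p.1.im :=
    (Complex.continuous_im.comp continuous_fst).continuousAt.eventually (lt_mem_nhds hx)
  filter_upwards [this] with p hp
  rw [hK.theta_mk, ofComplex_apply_of_im_pos hp]

theorem theta_T (hK : IsImaginaryQuadratic ι) (u : DiscGroup ι) (τ : ℍ) (n : ℤ) (τ' : ℍ)
    (h : (τ' : ℂ) = τ + n) (z w : ℂ) :
    theta ι u τ' z w = ef (n * normD ι u / absDisc K) * theta ι u τ z w := by
  refine HasSum.unique (hK.hasSum_theta u τ' z w) (((hK.hasSum_theta u τ z w).mul_left _).congr_fun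
    fun a => ?_)
  obtain ⟨a, rfl⟩ := a
  rw [mul_div_assoc, ef_int_mul, ← hK.ef_normSq, ← ef_int_mul, thTerm, thTerm, ← ef_add, h]
  congr 1
  ring

theorem theta_neg (hK : IsImaginaryQuadratic ι) (u : DiscGroup ι) (τ : ℍ) (z w : ℂ) :
    theta ι u τ (-z) (-w) = theta ι (-u) τ z w := by
  obtain ⟨x, rfl⟩ := QuotientAddGroup.mk_surjective u
  have h1 := hK.hasSum_theta (-(QuotientAddGroup.mk x)) τ z w
  let e : {a : invDiff ι // (QuotientAddGroup.mk a : DiscGroup ι) = QuotientAddGroup.mk x} ≃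
      {a : invDiff ι // (QuotientAddGroup.mk a : DiscGroup ι) = -QuotientAddGroup.mk x} :=
    (Equiv.neg _).subtypeEquiv fun a => by
      simp only [Equiv.neg_apply, QuotientAddGroup.mk_neg, neg_inj]
  refine HasSum.unique (hK.hasSum_theta _ τ _ _) ((e.hasSum_iff.mpr h1).congr_fun fun a => ?_)
  simp only [Function.comp, thTerm]
  have : ((e a).1 : ℂ) = -(a.1 : ℂ) := rfl
  rw [this, Complex.normSq_neg, map_neg (starRingEnd ℂ)]
  congr 1
  ring

/-- The pairing `𝖾[-(v̄u + vū)]` on `[𝔡]`. -/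
def _root_.HermitianMaass.pairing (u v : DiscGroup ι) : ℂ :=
  ef (-((starRingEnd ℂ) (v.out : ℂ) * (u.out : ℂ) + (v.out : ℂ) * (starRingEnd ℂ) (u.out : ℂ)))

theorem pairing_mk (hK : IsImaginaryQuadratic ι) (x y : invDiff ι) :
    pairing (QuotientAddGroup.mk x : DiscGroup ι) (QuotientAddGroup.mk y) =
      ef (-((starRingEnd ℂ) (y : ℂ) * (x : ℂ) + (y : ℂ) * (starRingEnd ℂ) (x : ℂ))) := by
  have hx : (x : ℂ) - (QuotientAddGroup.mk x : DiscGroup ι).out ∈ intLattice ι := by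
    rw [← discGroup_mk_eq_iff]; exact QuotientAddGroup.out_eq' _
  have hy : (y : ℂ) - (QuotientAddGroup.mk y : DiscGroup ι).out ∈ intLattice ι := by
    rw [← discGroup_mk_eq_iff]; exact QuotientAddGroup.out_eq' _
  obtain ⟨m, hm⟩ := hK.trace_mem (QuotientAddGroup.mk y : DiscGroup ι).out.2 hx
  obtain ⟨n, hn⟩ := hK.trace_mem x.2 hy
  refine ef_congr ⟨m + n, ?_⟩
  push_cast
  rw [← hm, ← hn, map_sub, map_sub]
  ring

end IsImaginaryQuadratic

end

section


/-! ### The cocycle property of the Jacobi slash action -/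

theorem coe_SL_smul (A : SL(2, ℤ)) (τ : ℍ) :
    ((A • τ : ℍ) : ℂ) = ((A 0 0 : ℂ) * τ + A 0 1) / ((A 1 0 : ℂ) * τ + A 1 1) := by
  rw [coe_specialLinearGroup_apply]
  simp

theorem SL_denom_ne_zero (A : SL(2, ℤ)) (τ : ℍ) : (A 1 0 : ℂ) * τ + A 1 1 ≠ 0 := by
  have := UpperHalfPlane.denom_ne_zero (A : GL (Fin 2) ℝ) τ
  rwa [ModularGroup.denom_apply] at this

theorem SL_det (A : SL(2, ℤ)) : A 0 0 * A 1 1 - A 0 1 * A 1 0 = 1 := by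
  rw [← Matrix.det_fin_two]; exact A.det_coe

theorem SL_ext {A B : SL(2, ℤ)} (h00 : A 0 0 = B 0 0) (h01 : A 0 1 = B 0 1) (h10 : A 1 0 = B 1 0)
    (h11 : A 1 1 = B 1 1) : A = B := by
  ext i j
  fin_cases i <;> fin_cases j <;> assumption

theorem SL_mul_apply (A B : SL(2, ℤ)) (i j : Fin 2) :
    (A * B) i j = A i 0 * B 0 j + A i 1 * B 1 j := by
  simp [Matrix.mul_apply, Fin.sum_univ_two]

theorem S_mul_S : ModularGroup.S * ModularGroup.S = (-1 : SL(2, ℤ)) := by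
  apply SL_ext <;> rw [SL_mul_apply] <;> simp [ModularGroup.S]

theorem SL_denom_mul (A B : SL(2, ℤ)) (τ : ℍ) :
    ((A * B) 1 0 : ℂ) * τ + ((A * B) 1 1 : ℤ) =
      ((A 1 0 : ℂ) * (B • τ : ℍ) + A 1 1) * ((B 1 0 : ℂ) * τ + B 1 1) := by
  have := SL_denom_ne_zero B τ
  rw [coe_SL_smul, SL_mul_apply, SL_mul_apply]
  push_cast
  field_simp
  ring

theorem slashJ_mul (k : ℤ) (m : ℕ) (A B : SL(2, ℤ)) (φ : ℍ → ℂ → ℂ → ℂ) :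
    slashJ k m 1 (A * B) φ = slashJ k m 1 B (slashJ k m 1 A φ) := by
  funext τ z w
  have hB := SL_denom_ne_zero B τ
  have hA := SL_denom_ne_zero A (B • τ)
  have hAB := SL_denom_mul A B τ
  simp only [slashJ, map_one, one_mul]
  rw [mul_smul, hAB]
  have hc : ((A * B) 1 0 : ℂ) = A 1 0 * B 0 0 + A 1 1 * B 1 0 := by
    rw [SL_mul_apply]; push_cast; ring
  have hdet : (B 0 0 : ℂ) * B 1 1 - B 0 1 * B 1 0 = 1 := by exact_mod_cast SL_det B
  have hkey : ((A * B) 1 0 : ℂ) * ((B 1 0 : ℂ) * τ + B 1 1) =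
      B 1 0 * (((A 1 0 : ℂ) * (B • τ : ℍ) + A 1 1) * ((B 1 0 : ℂ) * τ + B 1 1)) + A 1 0 := by
    rw [← hAB, SL_mul_apply, SL_mul_apply]
    push_cast
    linear_combination (A 1 0 : ℂ) * hdet
  generalize ((A * B) 1 0 : ℂ) = c at *
  generalize (A 1 0 : ℂ) * (B • τ : ℍ) + A 1 1 = jA at *
  generalize (B 1 0 : ℂ) * τ + B 1 1 = jB at *
  have e1 : ef (-((m : ℂ) * (c * z * w / (jA * jB)))) =
      ef (-((m : ℂ) * ((B 1 0 : ℂ) * z * w / jB))) *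
        ef (-((m : ℂ) * ((A 1 0 : ℂ) * (z / jB) * (w / jB) / jA))) := by
    rw [← ef_add]
    congr 1
    field_simp
    linear_combination -(m : ℂ) * z * w * hkey
  rw [e1, mul_zpow, div_div, div_div, mul_comm jB jA]
  ring

theorem slashJ_one (k : ℤ) (m : ℕ) (φ : ℍ → ℂ → ℂ → ℂ) : slashJ k m 1 1 φ = φ := by
  funext τ z w
  simp [slashJ, ef_zero]

theorem slashJ_sum {α : Type*} (s : Finset α) (k : ℤ) (m : ℕ) (ε : ℂ) (A : SL(2, ℤ)) (c : α → ℂ)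
    (φ : α → ℍ → ℂ → ℂ → ℂ) (τ : ℍ) (z w : ℂ) :
    slashJ k m ε A (fun τ z w => ∑ i ∈ s, c i * φ i τ z w) τ z w =
      ∑ i ∈ s, c i * slashJ k m ε A (φ i) τ z w := by
  simp only [slashJ, Finset.mul_sum]
  exact Finset.sum_congr rfl fun i _ => by ring

/-! ### The Weil representation -/

variable {K : Type*} [Field K] [NumberField K] {ι : K →+* ℂ}

section Matrices

variable [Fintype (DiscGroup ι)]

/-- The matrix `R` describes the action of `γ` on the `ϑ_u`. -/
def IsWeil (γ : SL(2, ℤ)) (R : Matrix (DiscGroup ι) (DiscGroup ι) ℂ) : Prop :=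
  ∀ u τ z w, slashJ 1 1 1 γ (theta ι u) τ z w = ∑ v, R u v * theta ι v τ z w

theorem IsWeil.mul {γ δ : SL(2, ℤ)} {R R' : Matrix (DiscGroup ι) (DiscGroup ι) ℂ}
    (h : IsWeil γ R) (h' : IsWeil δ R') : IsWeil (γ * δ) (R * R') := by
  intro u τ z w
  have h1 : slashJ 1 1 1 γ (theta ι u) = fun τ z w => ∑ v, R u v * theta ι v τ z w := by
    funext τ z w; exact h u τ z w
  rw [slashJ_mul, h1, slashJ_sum]
  simp only [h' _ τ z w, Matrix.mul_apply, Finset.sum_mul, Finset.mul_sum]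
  rw [Finset.sum_comm]
  exact Finset.sum_congr rfl fun i _ => Finset.sum_congr rfl fun j _ => by ring

variable [DecidableEq (DiscGroup ι)]

theorem isWeil_one : IsWeil (1 : SL(2, ℤ)) (1 : Matrix (DiscGroup ι) (DiscGroup ι) ℂ) := by
  intro u τ z w
  rw [slashJ_one]
  simp [Matrix.one_apply]

theorem IsWeil.inv {γ : SL(2, ℤ)} {R R' : Matrix (DiscGroup ι) (DiscGroup ι) ℂ}
    (h : IsWeil γ R) (hR : R' * R = 1) : IsWeil γ⁻¹ R' := by
  intro u τ z w
  have h1 : theta ι u = fun τ z w => ∑ v, R' u v * slashJ 1 1 1 γ (theta ι v) τ z w := by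
    funext τ z w
    simp only [h _ τ z w, Finset.mul_sum]
    rw [Finset.sum_comm]
    have : ∀ x, ∑ v, R' u v * (R v x * theta ι x τ z w) = (R' * R) u x * theta ι x τ z w := by
      intro x; simp only [Matrix.mul_apply, Finset.sum_mul, mul_assoc]
    simp only [this, hR]
    simp [Matrix.one_apply]
  conv_lhs => rw [h1]
  rw [slashJ_sum]
  simp only [← slashJ_mul, mul_inv_cancel, slashJ_one]

end Matrices

namespace IsImaginaryQuadratic

theorem slashJ_neg_one (hK : IsImaginaryQuadratic ι) (u : DiscGroup ι) (τ : ℍ) (z w : ℂ) :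
    slashJ 1 1 1 (-1) (theta ι u) τ z w = -theta ι (-u) τ z w := by
  have h : ((-1 : SL(2, ℤ)) • τ) = τ := by
    rw [ModularGroup.SL_neg_smul, one_smul]
  simp only [slashJ, h]
  simp [ef_zero, hK.theta_neg, div_neg]

theorem theta_sub (hK : IsImaginaryQuadratic ι) (u : DiscGroup ι) (y : invDiff ι) (τ : ℍ)
    (z w : ℂ) :
    theta ι u τ (z - y) (w - (starRingEnd ℂ) (y : ℂ)) =
      pairing (QuotientAddGroup.mk y) u * theta ι u τ z w := by
  refine HasSum.unique (hK.hasSum_theta u τ _ _) (((hK.hasSum_theta u τ z w).mul_left _).congr_fun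
    fun a => ?_)
  obtain ⟨a, rfl⟩ := a
  rw [hK.pairing_mk, thTerm, thTerm, ← ef_add]
  congr 1
  ring

theorem pairing_add (hK : IsImaginaryQuadratic ι) (u v w : DiscGroup ι) :
    pairing (u + v) w = pairing u w * pairing v w := by
  obtain ⟨x, rfl⟩ := QuotientAddGroup.mk_surjective u
  obtain ⟨y, rfl⟩ := QuotientAddGroup.mk_surjective v
  obtain ⟨t, rfl⟩ := QuotientAddGroup.mk_surjective w
  rw [← QuotientAddGroup.mk_add, hK.pairing_mk, hK.pairing_mk, hK.pairing_mk, ← ef_add]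
  congr 1
  push_cast
  rw [map_add]
  ring

theorem pairing_comm (u v : DiscGroup ι) : pairing u v = pairing v u := by
  rw [pairing, pairing]; congr 1; ring

theorem conj_pairing (u v : DiscGroup ι) : (starRingEnd ℂ) (pairing u v) = (pairing u v)⁻¹ := by
  rw [pairing, conj_ef, ← ef_neg]
  congr 1
  simp only [map_neg, map_add, map_mul, Complex.conj_conj]
  ring

theorem pairing_zero_left (hK : IsImaginaryQuadratic ι) (u : DiscGroup ι) :
    pairing 0 u = 1 := by
  have := hK.pairing_add 0 0 u
  rw [add_zero] at this
  have h0 : pairing 0 u ≠ 0 := ef_ne_zero _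
  exact mul_right_cancel₀ h0 (by rw [one_mul, ← this])

theorem pairing_neg (hK : IsImaginaryQuadratic ι) (u v : DiscGroup ι) :
    pairing (-u) v = (pairing u v)⁻¹ := by
  have := hK.pairing_add (-u) u v
  rw [neg_add_cancel, hK.pairing_zero_left] at this
  exact eq_inv_of_mul_eq_one_left this.symm

variable [Fintype (DiscGroup ι)]

theorem isWeil_unique (hK : IsImaginaryQuadratic ι) {γ : SL(2, ℤ)}
    {R R' : Matrix (DiscGroup ι) (DiscGroup ι) ℂ} (h : IsWeil γ R) (h' : IsWeil γ R') :
    R = R' := by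
  ext u v
  rw [← sub_eq_zero]
  refine hK.theta_linearIndependent (c := fun v => R u v - R' u v) (τ := UpperHalfPlane.I)
    (fun z w => ?_) v
  simp only [sub_mul, Finset.sum_sub_distrib]
  rw [← h, ← h', sub_self]

/-- The cosets `u + 𝔬` fill `𝔡`, so the left side is the dual theta series of the inversion formula.
-/
theorem sum_theta_S (hK : IsImaginaryQuadratic ι) (τ : ℍ) (z w : ℂ) :
    ∑ u, slashJ 1 1 1 ModularGroup.S (theta ι u) τ z w =
      -Complex.I * (Real.sqrt (absDisc K) : ℂ) * theta ι 0 τ z w := by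
  have hτ : (τ : ℂ) ≠ 0 := τ.ne_zero
  have h1 := hK.hasSum_mul_theta (fun _ => 1) (ModularGroup.S • τ) (z / τ) (w / τ)
  have h2 := hasSum_thD hK.fund.pos τ.im_pos z w
  have hS : ((ModularGroup.S • τ : ℍ) : ℂ) = -1 / τ := by
    rw [coe_SL_smul]; simp [ModularGroup.S]
  rw [← hK.equivD.hasSum_iff] at h1
  have h3 := h1.unique (h2.congr_fun fun p => by
    simp only [Function.comp, equivD_apply, one_mul, hS])
  simp only [one_mul] at h3
  have h4 : ∀ u, slashJ 1 1 1 ModularGroup.S (theta ι u) τ z w =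
      (τ : ℂ)⁻¹ * ef (-(z * w / τ)) * theta ι u (ModularGroup.S • τ) (z / τ) (w / τ) := by
    intro u
    simp [slashJ, ModularGroup.S]
  simp only [h4]
  rw [← Finset.mul_sum, h3, hK.theta_zero, ef_neg]
  have := ef_ne_zero (z * w / τ)
  field_simp

/-- Slashing `sum_theta_S` once more by `S`: on the left `S² = -1` acts by `ϑ_u ↦ -ϑ_{-u}`, and on
the right `ϑ_0|S` appears. -/
theorem slashJ_S_theta_zero (hK : IsImaginaryQuadratic ι) (τ : ℍ) (z w : ℂ) :
    slashJ 1 1 1 ModularGroup.S (theta ι 0) τ z w =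
      -Complex.I / (Real.sqrt (absDisc K) : ℂ) * ∑ u, theta ι u τ z w := by
  have hs := sqrt_ne_zero hK.fund.pos
  have h1 : (fun τ z w => ∑ u, 1 * slashJ 1 1 1 ModularGroup.S (theta ι u) τ z w) =
      fun τ z w => ∑ _i ∈ {()}, (-Complex.I * (Real.sqrt (absDisc K) : ℂ)) * theta ι 0 τ z w := by
    funext τ z w
    simp only [one_mul, Finset.sum_singleton]
    exact hK.sum_theta_S τ z w
  have h2 := congrArg (fun φ => slashJ 1 1 1 ModularGroup.S φ τ z w) h1
  rw [slashJ_sum, slashJ_sum] at h2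
  simp only [← slashJ_mul, S_mul_S, hK.slashJ_neg_one, one_mul, Finset.sum_singleton] at h2
  have hneg : ∑ u, theta ι (-u) τ z w = ∑ u, theta ι u τ z w :=
    Equiv.sum_comp (Equiv.neg (DiscGroup ι)) (fun u => theta ι u τ z w)
  rw [Finset.sum_neg_distrib, hneg] at h2
  have hI := Complex.I_mul_I
  generalize slashJ 1 1 1 ModularGroup.S (theta ι 0) τ z w = x at *
  generalize ∑ u, theta ι u τ z w = y at *
  generalize ((Real.sqrt (absDisc K) : ℝ) : ℂ) = r at *
  field_simp
  linear_combination -Complex.I * h2 + r * x * hI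

/-- Up to an exponential factor `ϑ_u` is `ϑ_0` shifted by `(uτ, ūτ)`. Inversion turns this into the
constant shift `(-u, -ū)`, which multiplies each `ϑ_v` by the pairing of `u` and `v`. -/
theorem isWeil_S (hK : IsImaginaryQuadratic ι) :
    IsWeil ModularGroup.S (Matrix.of fun u v : DiscGroup ι =>
      -Complex.I / (Real.sqrt (absDisc K) : ℂ) * pairing u v) := by
  intro u τ z w
  obtain ⟨y, rfl⟩ := QuotientAddGroup.mk_surjective u
  have hτ : (τ : ℂ) ≠ 0 := τ.ne_zero
  have hS : ((ModularGroup.S • τ : ℍ) : ℂ) = -1 / τ := by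
    rw [coe_SL_smul]; simp [ModularGroup.S]
  have h1 := hK.slashJ_S_theta_zero τ (z - y) (w - (starRingEnd ℂ) (y : ℂ))
  simp only [hK.theta_sub, Finset.mul_sum] at h1
  simp only [Matrix.of_apply, mul_assoc]
  rw [← h1]
  have h4 : ∀ u z w, slashJ 1 1 1 ModularGroup.S (theta ι u) τ z w =
      (τ : ℂ)⁻¹ * ef (-(z * w / τ)) * theta ι u (ModularGroup.S • τ) (z / τ) (w / τ) := by
    intro u z w
    simp [slashJ, ModularGroup.S]
  rw [h4, h4, hK.theta_mk, hK.theta_zero, hS, thTerm, mul_assoc, mul_assoc]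
  congr 1
  rw [← mul_assoc, ← ef_add]
  have e1 : z / (τ : ℂ) + y * (-1 / τ) = (z - y) / τ := by ring
  have e2 : w / (τ : ℂ) + (starRingEnd ℂ) (y : ℂ) * (-1 / τ) =
    (w - (starRingEnd ℂ) (y : ℂ)) / τ := by ring
  rw [e1, e2]
  congr 2
  rw [Complex.normSq_eq_conj_mul_self]
  field_simp
  ring

theorem isWeil_T [DecidableEq (DiscGroup ι)] (hK : IsImaginaryQuadratic ι) (n : ℤ) :
    IsWeil (ModularGroup.T ^ n) (Matrix.diagonal fun u : DiscGroup ι =>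
      ef (n * normD ι u / absDisc K)) := by
  intro u τ z w
  have hT : ((ModularGroup.T ^ n • τ : ℍ) : ℂ) = τ + n := by
    rw [coe_SL_smul]; simp [ModularGroup.coe_T_zpow]
  have h1 := hK.theta_T u τ n _ hT z w
  simp only [Matrix.diagonal_apply, ite_mul, zero_mul, Finset.sum_ite_eq, Finset.mem_univ, if_true]
  rw [← h1]
  simp [slashJ, ModularGroup.coe_T_zpow, ef_zero]

/-- Orthogonality is read off the zeroth column of `ρ(S)² = ρ(-1)`; at `u = 0` it yields the order
of `[𝔡]`. -/
theorem sum_pairing [DecidableEq (DiscGroup ι)] (hK : IsImaginaryQuadratic ι)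
    (u : DiscGroup ι) : ∑ v, pairing u v = if u = 0 then (absDisc K : ℂ) else 0 := by
  have hs := sqrt_ne_zero hK.fund.pos
  have h1 := hK.isWeil_S.mul hK.isWeil_S
  rw [S_mul_S] at h1
  have h2 : IsWeil (-1 : SL(2, ℤ)) (Matrix.of fun u v : DiscGroup ι => if v = -u then -1 else 0) := by
    intro u τ z w
    rw [hK.slashJ_neg_one]
    simp
  have h3 := congrFun (congrFun (hK.isWeil_unique h1 h2) u) 0
  simp only [Matrix.mul_apply, Matrix.of_apply] at h3
  have h4 : ∀ v : DiscGroup ι, pairing v 0 = 1 := fun v => by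
    rw [pairing_comm, hK.pairing_zero_left]
  simp only [h4, mul_one, ← Finset.sum_mul, ← Finset.mul_sum] at h3
  have hsq := sqrt_sq (absDisc K)
  have hI := Complex.I_mul_I
  have h5 : (∑ v, pairing u v) = -(absDisc K) * if 0 = -u then -1 else 0 := by
    rw [← h3, ← hsq]
    generalize ∑ v, pairing u v = y
    field_simp
    linear_combination y * hI
  rw [h5]
  by_cases hu : u = 0
  · simp [hu]
  · have : ¬ (0 = -u) := fun h => hu (by rwa [eq_comm, neg_eq_zero] at h)
    simp [hu, this]

open Matrix in
-- It suffices to treat the generators `S` and `T`. Unitarity is carried along so that inverses, and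
-- the dual representation, are given by conjugation.
theorem exists_isWeil [DecidableEq (DiscGroup ι)] (hK : IsImaginaryQuadratic ι) (γ : SL(2, ℤ)) :
    ∃ R : Matrix (DiscGroup ι) (DiscGroup ι) ℂ, IsWeil γ R ∧ R * Rᴴ = 1 := by
  have hγ : γ ∈ Subgroup.closure ({ModularGroup.S, ModularGroup.T} : Set SL(2, ℤ)) := by
    rw [SpecialLinearGroup.SL2Z_generators]; trivial
  induction hγ using Subgroup.closure_induction with
  | one => exact ⟨1, isWeil_one, by simp⟩
  | mem g hg =>
    rcases hg with rfl | rfl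
    · refine ⟨_, hK.isWeil_S, ?_⟩
      ext u v
      have hs := sqrt_ne_zero hK.fund.pos
      have hsq := sqrt_sq (absDisc K)
      have hI := Complex.I_mul_I
      have hD : (absDisc K : ℂ) ≠ 0 := by exact_mod_cast hK.fund.pos.ne'
      have h1 : ∀ w : DiscGroup ι,
          (-Complex.I / (Real.sqrt (absDisc K) : ℂ) * pairing u w) *
          (starRingEnd ℂ) (-Complex.I / (Real.sqrt (absDisc K) : ℂ) * pairing v w) =
          (absDisc K : ℂ)⁻¹ * pairing (u - v) w := by
        intro w
        rw [map_mul, conj_pairing, sub_eq_add_neg, hK.pairing_add, hK.pairing_neg, map_div₀,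
          map_neg, Complex.conj_I, Complex.conj_ofReal, ← hsq]
        have : pairing v w ≠ 0 := ef_ne_zero _
        field_simp
        linear_combination -pairing u w * hI
      rw [Matrix.mul_apply]
      simp only [Matrix.conjTranspose_apply, Matrix.of_apply]
      have h2 : ∀ x : ℂ, star x = (starRingEnd ℂ) x := fun _ => rfl
      simp only [h2, h1, ← Finset.mul_sum, hK.sum_pairing, Matrix.one_apply, sub_eq_zero]
      split_ifs <;> simp [hD]
    · refine ⟨_, by simpa only [zpow_one] using hK.isWeil_T 1, ?_⟩
      rw [Matrix.diagonal_conjTranspose, Matrix.diagonal_mul_diagonal, ← Matrix.diagonal_one]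
      congr 1
      funext u
      have h2 : ∀ x : ℂ, star x = (starRingEnd ℂ) x := fun _ => rfl
      rw [Pi.star_apply, h2]
      have : ((1 : ℤ) : ℂ) * normD ι u / absDisc K = ((normD ι u / absDisc K : ℝ) : ℂ) := by
        push_cast; ring
      rw [this, conj_ef_real, ← ef_add, add_neg_cancel, ef_zero]
  | mul g h _ _ hg hh =>
    obtain ⟨R, hR, hR'⟩ := hg
    obtain ⟨Q, hQ, hQ'⟩ := hh
    refine ⟨R * Q, hR.mul hQ, ?_⟩
    rw [Matrix.conjTranspose_mul, Matrix.mul_assoc, ← Matrix.mul_assoc Q, hQ', Matrix.one_mul, hR']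
  | inv g _ hg =>
    obtain ⟨R, hR, hR'⟩ := hg
    have h : Rᴴ * R = 1 := mul_eq_one_comm.mp hR'
    exact ⟨Rᴴ, hR.inv h, by rw [Matrix.conjTranspose_conjTranspose, h]⟩

end IsImaginaryQuadratic

end

/-! ### The Weil representation on `Γ₀(D)` and `Γ⁰(D)` -/

section


variable {K : Type*} [Field K] [NumberField K] {ι : K →+* ℂ}

/-- The matrix `(1 0; n 1)`. -/
def lowerT (n : ℤ) : SL(2, ℤ) := ⟨!![1, 0; n, 1], by simp⟩

@[simp] theorem lowerT_00 (n : ℤ) : lowerT n 0 0 = 1 := rfl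
@[simp] theorem lowerT_01 (n : ℤ) : lowerT n 0 1 = 0 := rfl
@[simp] theorem lowerT_10 (n : ℤ) : lowerT n 1 0 = n := rfl
@[simp] theorem lowerT_11 (n : ℤ) : lowerT n 1 1 = 1 := rfl

@[simp] theorem T_zpow_00 (n : ℤ) : (ModularGroup.T ^ n) 0 0 = 1 := by
  rw [ModularGroup.coe_T_zpow]; rfl
@[simp] theorem T_zpow_01 (n : ℤ) : (ModularGroup.T ^ n) 0 1 = n := by
  rw [ModularGroup.coe_T_zpow]; rfl
@[simp] theorem T_zpow_10 (n : ℤ) : (ModularGroup.T ^ n) 1 0 = 0 := by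
  rw [ModularGroup.coe_T_zpow]; rfl
@[simp] theorem T_zpow_11 (n : ℤ) : (ModularGroup.T ^ n) 1 1 = 1 := by
  rw [ModularGroup.coe_T_zpow]; rfl

theorem S_10 : ModularGroup.S 1 0 = 1 := rfl
theorem S_11 : ModularGroup.S 1 1 = 0 := rfl
theorem S_inv_00 : ModularGroup.S⁻¹ 0 0 = 0 := rfl
theorem S_inv_01 : ModularGroup.S⁻¹ 0 1 = 1 := rfl
theorem S_inv_10 : ModularGroup.S⁻¹ 1 0 = -1 := rfl
theorem S_inv_11 : ModularGroup.S⁻¹ 1 1 = 0 := rfl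

theorem lowerT_add (m n : ℤ) : lowerT (m + n) = lowerT m * lowerT n := by
  apply SL_ext <;> rw [SL_mul_apply] <;> simp

theorem lowerT_zero : lowerT 0 = 1 := by
  apply SL_ext <;> simp

theorem slashJ_const_mul (k : ℤ) (m : ℕ) (ε : ℂ) (A : SL(2, ℤ)) (c : ℂ) (φ : ℍ → ℂ → ℂ → ℂ)
    (τ : ℍ) (z w : ℂ) :
    slashJ k m ε A (fun τ z w => c * φ τ z w) τ z w = c * slashJ k m ε A φ τ z w := by
  simp only [slashJ]; ring

theorem ef_int_mul_div_eq_one {q : ℕ} {n : ℤ} (x : ℤ) (hq : q ≠ 0) (h : n ≡ 0 [ZMOD q]) :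
    ef ((x : ℂ) * n / q) = 1 := by
  have := ef_int_div_congr hq (h.mul_left x)
  push_cast at this
  rw [this]; simp [ef_zero]

namespace IsImaginaryQuadratic

theorem theta_zero_T (hK : IsImaginaryQuadratic ι) (m : ℤ) (τ : ℍ) (z w : ℂ) :
    slashJ 1 1 1 (ModularGroup.T ^ m) (theta ι 0) τ z w = theta ι 0 τ z w := by
  have hT : ((ModularGroup.T ^ m • τ : ℍ) : ℂ) = τ + m := by
    rw [coe_SL_smul]; simp
  have h1 := hK.theta_T 0 τ m _ hT z w
  have h2 : ef ((m : ℂ) * normD ι 0 / absDisc K) = 1 := by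
    exact ef_int_mul_div_eq_one m hK.fund.pos.ne' hK.normD_zero
  rw [h2, one_mul] at h1
  simp only [slashJ, T_zpow_10, T_zpow_11, map_one, one_mul, Int.cast_zero, Int.cast_one, zero_mul,
    zero_add, div_one, mul_zero, neg_zero, ef_zero, one_zpow, h1]

theorem theta_zero_prime (hK : IsImaginaryQuadratic ι) {γ : SL(2, ℤ)}
    (hγ : (absDisc K : ℤ) ∣ γ 1 0) {p : ℕ} (hp : p.Prime) (hpD : absDisc K < p)
    (h11 : γ 1 1 = p) (τ : ℍ) (z w : ℂ) :
    slashJ 1 1 1 γ (theta ι 0) τ z w = chi (absDisc K) p * theta ι 0 τ z w := by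
  have := Fact.mk hp
  obtain ⟨c', hc'⟩ := hγ
  have hD := hK.fund.pos
  have h2 : p ≠ 2 := by have := hK.fund.two_lt; omega
  have hdet := SL_det γ
  rw [h11, hc'] at hdet
  have h1 := thO_Gamma0 hK.fund h2 (fun h => absurd (Nat.le_of_dvd hD h) (by omega)) hdet
    τ.im_pos z w
  have hj := SL_denom_ne_zero γ τ
  rw [h11, hc'] at hj
  push_cast at hj
  simp only [slashJ, map_one, one_mul, hK.theta_zero, coe_SL_smul, h11, hc', Nat.cast_one]
  push_cast
  rw [h1, zpow_neg_one, ef_neg]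
  have := ef_ne_zero (absDisc K * c' * z * w / (absDisc K * c' * τ + p))
  field_simp

/-- Right multiplication by `T^m` fixes `ϑ_0` and moves the lower right entry `d` through the
progression `d + cℤ`, which contains a prime larger than `D` by Dirichlet's theorem. As `D ∣ c`, the
value `χ(d)` does not change. -/
theorem theta_zero_Gamma0_aux (hK : IsImaginaryQuadratic ι) {γ : SL(2, ℤ)}
    (hγ : (absDisc K : ℤ) ∣ γ 1 0) (hc : γ 1 0 ≠ 0) (τ : ℍ) (z w : ℂ) :
    slashJ 1 1 1 γ (theta ι 0) τ z w = chi (absDisc K) (γ 1 1) * theta ι 0 τ z w := by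
  have hcop : IsCoprime (γ 1 1) ((γ 1 0).natAbs : ℤ) := by
    have h1 : IsCoprime (γ 1 1) (γ 1 0) := ⟨γ 0 0, -γ 0 1, by linarith [SL_det γ]⟩
    rcases Int.natAbs_eq (γ 1 0) with h | h
    · rwa [h] at h1
    · rw [h] at h1; exact (IsCoprime.neg_right_iff _ _).mp h1
  obtain ⟨p, hpD, hp, hpd⟩ := Nat.forall_exists_prime_gt_and_zmodEq (absDisc K)
    (Int.natAbs_ne_zero.mpr hc) hcop
  have hdvd : γ 1 0 ∣ p - γ 1 1 := by
    have := Int.modEq_iff_dvd.mp hpd.symm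
    exact (Int.natAbs_dvd.mp this)
  obtain ⟨m, hm⟩ := hdvd
  have h10 : (γ * ModularGroup.T ^ m) 1 0 = γ 1 0 := by rw [SL_mul_apply]; simp
  have h11 : (γ * ModularGroup.T ^ m) 1 1 = p := by
    rw [SL_mul_apply]; simp; linarith
  have h1 : slashJ 1 1 1 (γ * ModularGroup.T ^ m) (theta ι 0) =
      fun τ z w => (chi (absDisc K) p : ℂ) * theta ι 0 τ z w := by
    funext τ z w
    exact hK.theta_zero_prime (by rwa [h10]) hp hpD h11 τ z w
  have h2 : γ = (γ * ModularGroup.T ^ m) * ModularGroup.T ^ (-m) := by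
    rw [mul_assoc, ← zpow_add, add_neg_cancel, zpow_zero, mul_one]
  have h3 : chi (absDisc K) (γ 1 1) = chi (absDisc K) p := by
    refine hK.fund.chi_congr (Int.modEq_iff_dvd.mpr (hγ.trans ⟨m, hm⟩))
  conv_lhs => rw [h2]
  rw [slashJ_mul, h1, slashJ_const_mul, hK.theta_zero_T, h3]

theorem theta_zero_Gamma0 (hK : IsImaginaryQuadratic ι) {γ : SL(2, ℤ)}
    (hγ : (absDisc K : ℤ) ∣ γ 1 0) (τ : ℍ) (z w : ℂ) :
    slashJ 1 1 1 γ (theta ι 0) τ z w = chi (absDisc K) (γ 1 1) * theta ι 0 τ z w := by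
  by_cases hc : γ 1 0 = 0
  -- When `c = 0`, multiplying by `(1 0; D 1)` makes the lower left entry `dD ≠ 0` and keeps `d`;
  -- the inverse factor acts trivially.
  · have hD : (absDisc K : ℤ) ≠ 0 := by exact_mod_cast hK.fund.pos.ne'
    have h11 : (γ * lowerT (absDisc K)) 1 1 = γ 1 1 := by rw [SL_mul_apply]; simp
    have h10 : (γ * lowerT (absDisc K)) 1 0 = γ 1 1 * absDisc K := by
      rw [SL_mul_apply]; simp [hc]
    have hd : γ 1 1 ≠ 0 := by
      intro h
      have := SL_det γ
      rw [h, hc] at this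
      simp at this
    have h1 : slashJ 1 1 1 (γ * lowerT (absDisc K)) (theta ι 0) =
        fun τ z w => (chi (absDisc K) (γ 1 1) : ℂ) * theta ι 0 τ z w := by
      funext τ z w
      have := hK.theta_zero_Gamma0_aux (γ := γ * lowerT (absDisc K)) (by rw [h10]; simp)
        (by rw [h10]; exact mul_ne_zero hd hD) τ z w
      rwa [h11] at this
    have h2 : γ = (γ * lowerT (absDisc K)) * lowerT (-absDisc K) := by
      rw [mul_assoc, ← lowerT_add, add_neg_cancel, lowerT_zero, mul_one]
    have h3 := hK.theta_zero_Gamma0_aux (γ := lowerT (-absDisc K)) (by simp) (by simpa using hD)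
      τ z w
    rw [lowerT_11, chi_one, Int.cast_one, one_mul] at h3
    conv_lhs => rw [h2]
    rw [slashJ_mul, h1, slashJ_const_mul, h3]
  · exact hK.theta_zero_Gamma0_aux hγ hc τ z w

variable [Fintype (DiscGroup ι)] [DecidableEq (DiscGroup ι)]

/-- The Weil representation: `ϑ_u|γ = ∑_v ρ(γ)_{uv} ϑ_v`. -/
def weil (hK : IsImaginaryQuadratic ι) (γ : SL(2, ℤ)) : Matrix (DiscGroup ι) (DiscGroup ι) ℂ :=
  (hK.exists_isWeil γ).choose

theorem isWeil_weil (hK : IsImaginaryQuadratic ι) (γ : SL(2, ℤ)) : IsWeil γ (hK.weil γ) :=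
  (hK.exists_isWeil γ).choose_spec.1

open Matrix in
theorem weil_mul_conjTranspose (hK : IsImaginaryQuadratic ι) (γ : SL(2, ℤ)) :
    hK.weil γ * (hK.weil γ)ᴴ = 1 := (hK.exists_isWeil γ).choose_spec.2

open Matrix in
theorem conjTranspose_mul_weil (hK : IsImaginaryQuadratic ι) (γ : SL(2, ℤ)) :
    (hK.weil γ)ᴴ * hK.weil γ = 1 := mul_eq_one_comm.mp (hK.weil_mul_conjTranspose γ)

theorem weil_eq (hK : IsImaginaryQuadratic ι) {γ : SL(2, ℤ)}
    {R : Matrix (DiscGroup ι) (DiscGroup ι) ℂ} (h : IsWeil γ R) : hK.weil γ = R :=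
  hK.isWeil_unique (hK.isWeil_weil γ) h

theorem weil_mul (hK : IsImaginaryQuadratic ι) (γ δ : SL(2, ℤ)) :
    hK.weil (γ * δ) = hK.weil γ * hK.weil δ :=
  hK.weil_eq ((hK.isWeil_weil γ).mul (hK.isWeil_weil δ))

open Matrix in
theorem weil_inv (hK : IsImaginaryQuadratic ι) (γ : SL(2, ℤ)) : hK.weil γ⁻¹ = (hK.weil γ)ᴴ :=
  hK.weil_eq ((hK.isWeil_weil γ).inv (hK.conjTranspose_mul_weil γ))

theorem weil_T (hK : IsImaginaryQuadratic ι) (n : ℤ) : hK.weil (ModularGroup.T ^ n) =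
    Matrix.diagonal fun u : DiscGroup ι => ef (n * normD ι u / absDisc K) :=
  hK.weil_eq (hK.isWeil_T n)

theorem weil_S (hK : IsImaginaryQuadratic ι) (u v : DiscGroup ι) : hK.weil ModularGroup.S u v =
    -Complex.I / (Real.sqrt (absDisc K) : ℂ) * pairing u v := by
  rw [hK.weil_eq hK.isWeil_S, Matrix.of_apply]

theorem weil_Gamma0 (hK : IsImaginaryQuadratic ι) {γ : SL(2, ℤ)}
    (hγ : (absDisc K : ℤ) ∣ γ 1 0) (v : DiscGroup ι) :
    hK.weil γ 0 v = if v = 0 then (chi (absDisc K) (γ 1 1) : ℂ) else 0 := by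
  rw [← sub_eq_zero]
  refine hK.theta_linearIndependent (c := fun v => hK.weil γ 0 v -
    if v = 0 then (chi (absDisc K) (γ 1 1) : ℂ) else 0) (τ := UpperHalfPlane.I) (fun z w => ?_) v
  simp only [sub_mul, Finset.sum_sub_distrib]
  rw [← hK.isWeil_weil γ, hK.theta_zero_Gamma0 hγ]
  simp

/-- The entry `ρ(-1)_{00}` is `χ(-1)` because `-1 ∈ Γ₀(D)`, and it is `-1` because the weight is
odd. -/
theorem chi_neg_one (hK : IsImaginaryQuadratic ι) : chi (absDisc K) (-1) = -1 := by
  have h1 := hK.weil_Gamma0 (γ := -1) (by simp) 0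
  have h2 : IsWeil (-1 : SL(2, ℤ)) (Matrix.of fun u v : DiscGroup ι => if v = -u then -1 else 0) := by
    intro u τ z w
    rw [hK.slashJ_neg_one]
    simp
  rw [hK.weil_eq h2] at h1
  simp only [Matrix.of_apply, neg_zero, if_true] at h1
  have h3 : ((-1 : SL(2, ℤ)) 1 1 : ℤ) = -1 := by simp
  rw [h3] at h1
  exact_mod_cast h1.symm

/-- Row zero of `ρ(S)` is constant, so a column sum of `ρ(γ)` is, up to a scalar, an entry of row
zero of `ρ(Sγ) = ρ(δ)ρ(S)` with `δ = SγS⁻¹ ∈ Γ₀(D)`. Thus the constant function `1` is an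
eigenvector of `Γ⁰(D)` in the dual representation. -/
theorem sum_weil_col (hK : IsImaginaryQuadratic ι) {γ : SL(2, ℤ)}
    (hγ : (absDisc K : ℤ) ∣ γ 0 1) (v : DiscGroup ι) :
    ∑ u, hK.weil γ u v = chi (absDisc K) (γ 1 1) := by
  have hs := sqrt_ne_zero hK.fund.pos
  obtain ⟨δ, hδ⟩ : ∃ δ, δ = ModularGroup.S * γ * ModularGroup.S⁻¹ := ⟨_, rfl⟩
  have h10 : δ 1 0 = -γ 0 1 := by
    rw [hδ, SL_mul_apply, SL_mul_apply, SL_mul_apply]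
    simp [S_10, S_11, S_inv_00, S_inv_10]
  have h11 : δ 1 1 = γ 0 0 := by
    rw [hδ, SL_mul_apply, SL_mul_apply, SL_mul_apply]
    simp [S_10, S_11, S_inv_01, S_inv_11]
  have h1 : δ * ModularGroup.S = ModularGroup.S * γ := by
    rw [hδ, mul_assoc, inv_mul_cancel, mul_one]
  have h2 := congrFun (congrFun (congrArg hK.weil h1) 0) v
  rw [hK.weil_mul, hK.weil_mul, Matrix.mul_apply, Matrix.mul_apply] at h2
  simp only [hK.weil_Gamma0 (γ := δ) (by rw [h10]; simpa using hγ), ite_mul, zero_mul,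
    Finset.sum_ite_eq', Finset.mem_univ, if_true, hK.weil_S, hK.pairing_zero_left, mul_one] at h2
  rw [← Finset.mul_sum, h11] at h2
  have h3 : chi (absDisc K) (γ 0 0) = chi (absDisc K) (γ 1 1) := by
    refine hK.fund.chi_eq_of_mul_modEq_one (Int.modEq_iff_dvd.mpr ?_)
    have := SL_det γ
    have h : 1 - γ 0 0 * γ 1 1 = γ 0 1 * (-γ 1 0) := by linarith
    rw [h]
    exact Dvd.dvd.mul_right hγ _
  rw [← h3]
  have hI := Complex.I_ne_zero
  field_simp at h2
  exact (neg_injective h2).symm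

/-- For `N y ≡ -1 mod D`, the zeroth row of `ρ((1 0; N 1) T^y)` is constant. -/
theorem weil_lowerT_mul_T (hK : IsImaginaryQuadratic ι) {N y : ℤ}
    (hy : N * y ≡ -1 [ZMOD absDisc K]) (v : DiscGroup ι) :
    hK.weil (lowerT N * ModularGroup.T ^ y) 0 v =
      -Complex.I / (Real.sqrt (absDisc K) : ℂ) * chi (absDisc K) N := by
  -- The lower row of `A` is `(Ny + 1, -N)`, so the choice of `y` puts `A` in `Γ₀(D)`. The sign in
  -- `χ(-N) = -χ(N)` turns the entry `i/√D` of `ρ(S⁻¹)` into `-i/√D`.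
  obtain ⟨A, hA⟩ : ∃ A, A = lowerT N * ModularGroup.T ^ y * ModularGroup.S := ⟨_, rfl⟩
  have h10 : A 1 0 = N * y + 1 := by
    rw [hA, SL_mul_apply, SL_mul_apply, SL_mul_apply]
    simp [ModularGroup.S]
  have h11 : A 1 1 = -N := by
    rw [hA, SL_mul_apply, SL_mul_apply, SL_mul_apply]
    simp [ModularGroup.S]
  have h1 : lowerT N * ModularGroup.T ^ y = A * ModularGroup.S⁻¹ := by
    rw [hA, mul_assoc _ ModularGroup.S, mul_inv_cancel, mul_one]
  have hdvd : (absDisc K : ℤ) ∣ A 1 0 := by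
    rw [h10]
    have := Int.modEq_iff_dvd.mp hy.symm
    simpa using this
  rw [h1, hK.weil_mul, Matrix.mul_apply]
  simp only [hK.weil_Gamma0 hdvd, ite_mul, zero_mul, Finset.sum_ite_eq', Finset.mem_univ, if_true]
  rw [hK.weil_inv, Matrix.conjTranspose_apply, hK.weil_S, pairing_comm, hK.pairing_zero_left, h11,
    neg_eq_neg_one_mul N, chi_mul, hK.chi_neg_one]
  have h2 : ∀ x : ℂ, star x = (starRingEnd ℂ) x := fun _ => rfl
  rw [h2, mul_one, map_div₀, map_neg, Complex.conj_I, Complex.conj_ofReal]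
  push_cast
  ring

end IsImaginaryQuadratic

end

section


/-! ### Vectors in `SL₂(ℤ)`-modules that behave like plus forms -/

section PlusVector

open ModularGroup

variable {X : Type*} [AddCommGroup X] [Module ℂ X]

/-- A vector `G` of a right `SL₂(ℤ)`-module which transforms under `Γ₀(N) ∩ Γ⁰(D)` by the character
`χ` and whose translates by `T` satisfy the plus condition at every prime `p ∣ D`. -/
structure IsPlusVector (D N : ℕ) (act : SL(2, ℤ) → X →ₗ[ℂ] X) (G : X) : Prop where
  act_mul : ∀ A B x, act (A * B) x = act B (act A x)
  chi_eq : ∀ δ : SL(2, ℤ), (N : ℤ) ∣ δ 1 0 → (D : ℤ) ∣ δ 0 1 → act δ G = (chi D (δ 1 1) : ℂ) • G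
  plus : ∀ p : ℕ, p.Prime → p ∣ D → ∀ D' : ℕ, D = pPart D p * D' → ∀ r : ℤ, chiP D p (-r) = -1 →
    ∑ j ∈ Finset.range (pPart D p),
      ef (-((r : ℂ) * j) / (pPart D p : ℕ)) • act (T ^ ((j : ℤ) * D')) G = 0

namespace IsPlusVector

variable {D N : ℕ} {act : SL(2, ℤ) → X →ₗ[ℂ] X} {G : X}

/-- The span of the translates `G|T^x`. -/
def translates (act : SL(2, ℤ) → X →ₗ[ℂ] X) (G : X) : Submodule ℂ X :=
  Submodule.span ℂ (Set.range fun x : ℤ => act (T ^ x) G)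

theorem act_T_mem (act : SL(2, ℤ) → X →ₗ[ℂ] X) (G : X) (x : ℤ) :
    act (T ^ x) G ∈ translates act G := Submodule.subset_span ⟨x, rfl⟩

theorem map_mem {V : SL(2, ℤ)} (h : ∀ x : ℤ, act V (act (T ^ x) G) ∈ translates act G) {m : X}
    (hm : m ∈ translates act G) : act V m ∈ translates act G := by
  induction hm using Submodule.span_induction with
  | mem m hm => obtain ⟨x, rfl⟩ := hm; exact h x
  | zero => simp
  | add a b _ _ ha hb => rw [map_add]; exact add_mem ha hb
  | smul c a _ ha => rw [map_smul]; exact Submodule.smul_mem _ _ ha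

theorem T_map_mem (hG : IsPlusVector D N act G) (y : ℤ) {m : X} (hm : m ∈ translates act G) :
    act (T ^ y) m ∈ translates act G := by
  refine map_mem (fun x => ?_) hm
  rw [← hG.act_mul, ← zpow_add]
  exact act_T_mem act G _

/-- The matrix `AB⁻¹` lies in `Γ₀(N) ∩ Γ⁰(D)` and has upper left entry `≡ β`. So up to a scalar
`G|A` depends only on the top row of `A` modulo `D`, as a projective point. -/
theorem act_eq (hG : IsPlusVector D N act G) (hD : IsFundamental D) {A B : SL(2, ℤ)} (β : ℤ)
    (hA : (N : ℤ) ∣ A 1 0) (hB : (N : ℤ) ∣ B 1 0) (h0 : A 0 0 ≡ β * B 0 0 [ZMOD D])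
    (h1 : A 0 1 ≡ β * B 0 1 [ZMOD D]) : act A G = (chi D β : ℂ) • act B G := by
  have hinv : ∀ i j, (B⁻¹) i j = !![B 1 1, -B 0 1; -B 1 0, B 0 0] i j := by
    intro i j
    rw [Matrix.SpecialLinearGroup.coe_inv, Matrix.adjugate_fin_two]
  obtain ⟨δ, hδ⟩ : ∃ δ, δ = A * B⁻¹ := ⟨_, rfl⟩
  have h01 : δ 0 1 = A 0 1 * B 0 0 - A 0 0 * B 0 1 := by
    rw [hδ, SL_mul_apply, hinv, hinv]; simp; ring
  have h10 : δ 1 0 = A 1 0 * B 1 1 - A 1 1 * B 1 0 := by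
    rw [hδ, SL_mul_apply, hinv, hinv]; simp; ring
  have h00 : δ 0 0 = A 0 0 * B 1 1 - A 0 1 * B 1 0 := by
    rw [hδ, SL_mul_apply, hinv, hinv]; simp; ring
  have hdet := SL_det B
  have hdvd : (D : ℤ) ∣ δ 0 1 := by
    rw [h01]
    have := ((h1.mul_right (B 0 0)).sub (h0.mul_right (B 0 1)))
    have e : β * B 0 1 * B 0 0 - β * B 0 0 * B 0 1 = 0 := by ring
    rw [e] at this
    exact Int.modEq_zero_iff_dvd.mp this
  have hβ : δ 0 0 ≡ β [ZMOD D] := by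
    rw [h00]
    have := ((h0.mul_right (B 1 1)).sub (h1.mul_right (B 1 0)))
    have e : β * B 0 0 * B 1 1 - β * B 0 1 * B 1 0 = β := by linear_combination β * hdet
    rwa [e] at this
  have hχ : chi D (δ 1 1) = chi D β := by
    rw [← hD.chi_congr hβ]
    refine (hD.chi_eq_of_mul_modEq_one (Int.modEq_iff_dvd.mpr ?_)).symm
    have e : 1 - δ 0 0 * δ 1 1 = δ 0 1 * (-δ 1 0) := by linarith [SL_det δ]
    rw [e]
    exact hdvd.mul_right _
  have hAB : A = δ * B := by rw [hδ, inv_mul_cancel_right]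
  rw [hAB, hG.act_mul, hG.chi_eq δ (by
    rw [h10]; exact dvd_sub (hA.mul_right _) (hB.mul_left _)) hdvd, map_smul, hχ]

section Local

variable {p D' : ℕ} {c : ℤ}

theorem T_lowerT_00 (x c : ℤ) : (T ^ x * lowerT c) 0 0 = 1 + x * c := by
  rw [SL_mul_apply]; simp
theorem T_lowerT_01 (x c : ℤ) : (T ^ x * lowerT c) 0 1 = x := by
  rw [SL_mul_apply]; simp
theorem T_lowerT_10 (x c : ℤ) : (T ^ x * lowerT c) 1 0 = c := by
  rw [SL_mul_apply]; simp
theorem mul_T_00 (A : SL(2, ℤ)) (y : ℤ) : (A * T ^ y) 0 0 = A 0 0 := by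
  rw [SL_mul_apply]; simp
theorem mul_T_01 (A : SL(2, ℤ)) (y : ℤ) : (A * T ^ y) 0 1 = A 0 0 * y + A 0 1 := by
  rw [SL_mul_apply]; simp
theorem mul_T_10 (A : SL(2, ℤ)) (y : ℤ) : (A * T ^ y) 1 0 = A 1 0 := by
  rw [SL_mul_apply]; simp

/-- The top row `(1 + jD'c, jD')` is proportional modulo `D` to `(1, juD')`, where `u` inverts `1 +
j` modulo the `p`-part: modulo the `p`-part `D'c ≡ 1`, and modulo `D'` both second entries vanish.
-/
theorem local_mem (hG : IsPlusVector D N act G) (hD : IsFundamental D)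
    (hD' : D = pPart D p * D') (hcN : (N : ℤ) ∣ c)
    (hE : D' * c ≡ 1 [ZMOD pPart D p]) {j : ℤ} (hj : IsCoprime (1 + j) (pPart D p : ℤ)) :
    act (T ^ (j * D') * lowerT c) G ∈ translates act G := by
  obtain ⟨u, v, huv⟩ := hj
  obtain ⟨e, he⟩ := Int.modEq_iff_dvd.mp hE
  rw [hG.act_eq hD (B := T ^ (j * u * D')) (1 + j * (D' * c)) (by rwa [T_lowerT_10]) (by simp)
    (by rw [T_lowerT_00]; simp [mul_assoc]) ?_]
  · exact Submodule.smul_mem _ _ (act_T_mem act G _)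
  · rw [T_lowerT_01, T_zpow_01]
    have hDZ : (D : ℤ) = pPart D p * D' := by exact_mod_cast hD'
    rw [hDZ]
    refine Int.modEq_iff_dvd.mpr ⟨-(j * v + j * j * u * e), ?_⟩
    linear_combination (-j * j * u * D') * he + j * D' * huv

/-- Modulo the `p`-part the new top row is `(1 + j, (2j + 1)D') ≡ -j·(1 + i, iD')`. The factor of
proportionality is taken `≡ 1` modulo `D'`, so that only `χ_p` sees it. -/
theorem local_T (hG : IsPlusVector D N act G) (hD : IsFundamental D) (hp : p.Prime) (hpD : p ∣ D)
    (hD' : D = pPart D p * D') (hcop : Nat.Coprime (pPart D p) D') (hcN : (N : ℤ) ∣ c)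
    (hcD : (D' : ℤ) ∣ c) (hE : D' * c ≡ 1 [ZMOD pPart D p]) (i j : ℤ)
    (hij : -j * i ≡ 2 * j + 1 [ZMOD pPart D p]) :
    act (T ^ (D' : ℤ)) (act (T ^ (j * D') * lowerT c) G) =
      (chiP D p (-j) : ℂ) • act (T ^ (i * D') * lowerT c) G := by
  have hDZ : (D : ℤ) = pPart D p * D' := by exact_mod_cast hD'
  obtain ⟨e, he⟩ := Int.modEq_iff_dvd.mp hE
  obtain ⟨f, hf⟩ := Int.modEq_iff_dvd.mp hij
  obtain ⟨s, rfl⟩ := hcD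
  rw [← hG.act_mul, hG.act_eq hD (B := T ^ (i * D') * lowerT (D' * s))
    (1 - (j + 1) * (D' * (D' * s))) (by rwa [mul_T_10, T_lowerT_10]) (by rwa [T_lowerT_10]) ?_ ?_]
  · congr 2
    rw [hD.chi_eq_chiP hp hpD hD' (Int.modEq_iff_dvd.mpr ⟨(j + 1) * (D' * s), by ring⟩)]
    refine chiP_congr (Int.modEq_iff_dvd.mpr ⟨-(j + 1) * e, ?_⟩)
    linear_combination (-(j + 1)) * he
  · rw [mul_T_00, T_lowerT_00, T_lowerT_00, hDZ]
    rw [← Int.modEq_and_modEq_iff_modEq_mul (by simpa using hcop)]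
    constructor
    · refine Int.modEq_iff_dvd.mpr
        ⟨-f + e * (j * i + (j + 1) * (1 + i * (D' * (D' * s))) + j), ?_⟩
      linear_combination (j * i + (j + 1) * (1 + i * (D' * (D' * s))) + j) * he - hf
    · refine Int.modEq_iff_dvd.mpr ⟨
        (-(j + 1) * (D' * s) + i * (D' * s) * (1 - (j + 1) * (D' * (D' * s))) - j * (D' * s)), ?_⟩
      ring
  · rw [mul_T_01, T_lowerT_00, T_lowerT_01, T_lowerT_01, hDZ]
    refine Int.modEq_iff_dvd.mpr ⟨-f + i * (j + 1) * e + j * e, ?_⟩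
    linear_combination D' * (i * (j + 1) + j) * he - D' * hf

theorem ef_half : ef (1 / 2) = -1 := by
  rw [ef, ← Complex.exp_pi_mul_I]; congr 1; ring

/-- All the vectors `G|T^(jD')V_c` are combinations of the `G|T^x`. -/
theorem local_mem_of_lt (hG : IsPlusVector D N act G) (hD : IsFundamental D) (hp : p.Prime)
    (hpD : p ∣ D) (hD' : D = pPart D p * D') (hcop : Nat.Coprime (pPart D p) D')
    (hcN : (N : ℤ) ∣ c) (hcD : (D' : ℤ) ∣ c) (hE : D' * c ≡ 1 [ZMOD pPart D p]) (j : ℕ)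
    (hj : j < pPart D p) : act (T ^ ((j : ℤ) * D') * lowerT c) G ∈ translates act G := by
  have hT := fun i j => hG.local_T hD hp hpD hD' hcop hcN hcD hE i j
  have hunit : ∀ j : ℤ, IsCoprime (1 + j) (pPart D p : ℤ) →
      act (T ^ (j * D') * lowerT c) G ∈ translates act G := fun j hj =>
    hG.local_mem hD hD' hcN hE hj
  have hTM : ∀ m ∈ translates act G, act (T ^ (D' : ℤ)) m ∈ translates act G := fun m hm =>
    hG.T_map_mem _ hm
  -- The plus relations at `p`, transported by the lower triangular matrix.
  have hrel : ∀ r : ℤ, chiP D p (-r) = -1 → ∑ j ∈ Finset.range (pPart D p),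
      ef (-((r : ℂ) * j) / (pPart D p : ℕ)) • act (T ^ ((j : ℤ) * D') * lowerT c) G = 0 := by
    intro r hr
    have h := congrArg (act (lowerT c)) (hG.plus p hp hpD D' hD' r hr)
    simpa only [map_sum, map_smul, map_zero, ← hG.act_mul] using h
  by_cases h2 : p = 2
  · subst h2
    obtain ⟨x, hx⟩ : ∃ x, x = fun j : ℤ => act (T ^ (j * D') * lowerT c) G := ⟨_, rfl⟩
    have hx' : ∀ j : ℤ, act (T ^ (j * D') * lowerT c) G = x j := fun j => by rw [hx]
    simp only [hx'] at hT hunit hrel ⊢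
    rcases hD.two_adic hpD with ⟨h8, -⟩ | ⟨h8, -⟩
    · have hq : pPart D 2 = 4 := by simp [pPart, h8]
      have hχ : ∀ n : ℤ, chiP D 2 n = ZMod.χ₄ (n : ZMod 4) := fun n => by simp [chiP, h8]
      rw [hq] at hT hunit hrel hj
      simp only [hχ] at hT hrel
      -- For `p`-part 4 only `x 1` and `x 3` are missing, as `1 + j` is even there. The relation
      -- gives `x 1 - x 3`; since `T^{D'}` acts by `-1` on `x 1` and by `1` on `x 3`, its image
      -- gives `x 1 + x 3`.
      have hR := hrel 1 (by decide)
      simp only [Finset.sum_range_succ, Finset.sum_range_zero, zero_add] at hR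
      have h0 := hunit 0 (by decide)
      have h2' := hunit 2 (by decide)
      have e1 := hT 1 1 (by decide)
      have e3 := hT 3 3 (by decide)
      have c1 : ZMod.χ₄ ((-1 : ℤ) : ZMod 4) = -1 := by decide
      have c3 : ZMod.χ₄ ((-3 : ℤ) : ZMod 4) = 1 := by decide
      rw [c1] at e1
      rw [c3] at e3
      have z : ∀ k : ℕ, ef (-(((1 : ℤ) : ℂ) * (k : ℕ)) / (4 : ℕ)) = ef (-1 / 4) ^ k := by
        intro k
        rw [← ef_nat_mul]; congr 1; push_cast; ring
      have z2 : ef (-1 / 4) ^ 2 = -1 := by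
        have : ef (-1 / 4) ^ 2 = ef (1 / 2) := by
          rw [← ef_nat_mul]
          exact ef_congr ⟨-1, by push_cast; ring⟩
        rw [this, ef_half]
      have hz := ef_ne_zero (-1 / 4)
      simp only [z] at hR
      generalize ef (-1 / 4) = ζ at *
      push_cast at hR e1 e3
      have m1 : x 1 - x 3 ∈ translates act G := by
        have : x 1 - x 3 = -ζ⁻¹ • x 0 + ζ⁻¹ • x 2 := by
          have h3 : ζ ^ 3 = -ζ := by rw [pow_succ, z2]; ring
          rw [z2, h3] at hR
          have h4 : ζ • (x 1 - x 3) = -x 0 + x 2 := by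
            rw [← sub_eq_zero, ← hR]; module
          rw [← inv_smul_smul₀ hz (x 1 - x 3), h4]; module
        rw [this]
        exact add_mem (Submodule.smul_mem _ _ h0) (Submodule.smul_mem _ _ h2')
      have m2 := hTM _ m1
      rw [map_sub, e1, e3] at m2
      interval_cases j
      · exact h0
      · have : x 1 = (1 / 2 : ℂ) • (x 1 - x 3) - (1 / 2 : ℂ) • ((-1 : ℂ) • x 1 - (1 : ℂ) • x 3) := by
          module
        show x 1 ∈ _
        rw [this]
        exact sub_mem (Submodule.smul_mem _ _ m1) (Submodule.smul_mem _ _ m2)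
      · exact h2'
      · have : x 3 = (-1 / 2 : ℂ) • (x 1 - x 3) - (1 / 2 : ℂ) • ((-1 : ℂ) • x 1 - (1 : ℂ) • x 3) := by
          module
        show x 3 ∈ _
        rw [this]
        exact sub_mem (Submodule.smul_mem _ _ m1) (Submodule.smul_mem _ _ m2)
    · have hq : pPart D 2 = 8 := by simp [pPart, h8]
      -- The two possible characters modulo 8 agree at `-3` and `-7` and differ by the sign `ε =
      -- χ_2(-1)`.
      obtain ⟨ε, hε, c5, c3, c1, c7⟩ : ∃ ε : ℤ, ε * ε = 1 ∧ chiP D 2 (-5) = -ε ∧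
          chiP D 2 (-3) = -1 ∧ chiP D 2 (-1) = ε ∧ chiP D 2 (-7) = 1 := by
        by_cases h4 : (D / 8) % 4 = 1
        · refine ⟨-1, by decide, ?_, ?_, ?_, ?_⟩ <;> simp only [chiP, h8, h4, if_true, not_true,
            if_false] <;> decide
        · refine ⟨1, by decide, ?_, ?_, ?_, ?_⟩ <;> simp only [chiP, h8, h4, if_true, not_true,
            if_false] <;> decide
      rw [hq] at hT hunit hrel hj
      -- For `p`-part 8 the odd `x j` are missing. `T^{D'}` sends `x 1 ↦ ε x 5`, `x 5 ↦ -ε x 1`, `x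
      -- 3 ↦ -x 3`, `x 7 ↦ x 7`. Its square is `-1` on the first two and `1` on the others, so it
      -- separates the relation into `x 1 - x 5` and `x 3 - x 7`; one more application of `T^{D'}`
      -- splits each pair.
      have hR := hrel 3 c3
      simp only [Finset.sum_range_succ, Finset.sum_range_zero, zero_add] at hR
      have h0 := hunit 0 (by decide)
      have h2' := hunit 2 (by decide)
      have h4' := hunit 4 (by decide)
      have h6' := hunit 6 (by decide)
      have e1 := hT 5 1 (by decide)
      have e3 := hT 3 3 (by decide)
      have e5 := hT 1 5 (by decide)
      have e7 := hT 7 7 (by decide)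
      rw [c1] at e1
      rw [c3] at e3
      rw [c5] at e5
      rw [c7] at e7
      have z : ∀ k : ℕ, ef (-(((3 : ℤ) : ℂ) * (k : ℕ)) / (8 : ℕ)) = ef (-3 / 8) ^ k := by
        intro k
        rw [← ef_nat_mul]; congr 1; push_cast; ring
      have z4 : ef (-3 / 8) ^ 4 = -1 := by
        rw [← ef_nat_mul, ← ef_half]
        exact ef_congr ⟨-2, by push_cast; ring⟩
      have hz := ef_ne_zero (-3 / 8)
      simp only [z] at hR
      generalize ef (-3 / 8) = ζ at *
      push_cast at hR e1 e3 e5 e7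
      have hεc : (ε : ℂ) * ε = 1 := by exact_mod_cast hε
      generalize (ε : ℂ) = η' at *
      have m0 : ζ • (x 1 - x 5) + ζ ^ 3 • (x 3 - x 7) ∈ translates act G := by
        have : ζ • (x 1 - x 5) + ζ ^ 3 • (x 3 - x 7) =
            -x 0 - ζ ^ 2 • x 2 + x 4 + ζ ^ 2 • x 6 := by
          have h5 : ζ ^ 5 = -ζ := by rw [pow_succ, z4]; ring
          have h6 : ζ ^ 6 = -ζ ^ 2 := by
            have : ζ ^ 6 = ζ ^ 4 * ζ ^ 2 := by ring
            rw [this, z4]; ring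
          have h7 : ζ ^ 7 = -ζ ^ 3 := by
            have : ζ ^ 7 = ζ ^ 4 * ζ ^ 3 := by ring
            rw [this, z4]; ring
          rw [z4, h5, h6, h7] at hR
          rw [← sub_eq_zero, ← hR]; module
        rw [this]
        exact add_mem (add_mem (sub_mem (neg_mem h0) (Submodule.smul_mem _ _ h2')) h4')
          (Submodule.smul_mem _ _ h6')
      have m1 := hTM _ m0
      have m2 := hTM _ m1
      simp only [map_add, map_sub, map_smul, e1, e3, e5, e7] at m1 m2
      have k1 : x 1 - x 5 ∈ translates act G := by
        have : x 1 - x 5 = (ζ⁻¹ / 2) • (ζ • (x 1 - x 5) + ζ ^ 3 • (x 3 - x 7)) - (ζ⁻¹ / 2) •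
            (ζ • (η' • -η' • x 1 - -η' • η' • x 5) +
              ζ ^ 3 • ((-1 : ℂ) • (-1 : ℂ) • x 3 - (1 : ℂ) • (1 : ℂ) • x 7)) := by
          match_scalars <;> field_simp <;>
            first | linear_combination hεc | linear_combination -hεc | ring
        rw [this]
        exact sub_mem (Submodule.smul_mem _ _ m0) (Submodule.smul_mem _ _ m2)
      have k3 : x 3 - x 7 ∈ translates act G := by
        have : x 3 - x 7 = (ζ ^ 3)⁻¹ • (ζ • (x 1 - x 5) + ζ ^ 3 • (x 3 - x 7)) -
            (ζ ^ 3)⁻¹ • ζ • (x 1 - x 5) := by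
          match_scalars <;> field_simp <;> ring
        rw [this]
        exact sub_mem (Submodule.smul_mem _ _ m0)
          (Submodule.smul_mem _ _ (Submodule.smul_mem _ _ k1))
      have l1 := hTM _ k1
      have l3 := hTM _ k3
      simp only [map_sub, e1, e3, e5, e7] at l1 l3
      interval_cases j
      · exact h0
      · have : x 1 = (1 / 2 : ℂ) • (x 1 - x 5) + (η' / 2) • (η' • x 5 - -η' • x 1) := by
          match_scalars <;> linear_combination (-1 / 2 : ℂ) * hεc
        show x 1 ∈ _
        rw [this]
        exact add_mem (Submodule.smul_mem _ _ k1) (Submodule.smul_mem _ _ l1)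
      · exact h2'
      · have : x 3 = (1 / 2 : ℂ) • (x 3 - x 7) - (1 / 2 : ℂ) • ((-1 : ℂ) • x 3 - (1 : ℂ) • x 7) := by
          module
        show x 3 ∈ _
        rw [this]
        exact sub_mem (Submodule.smul_mem _ _ k3) (Submodule.smul_mem _ _ l3)
      · exact h4'
      · have : x 5 = (-1 / 2 : ℂ) • (x 1 - x 5) + (η' / 2) • (η' • x 5 - -η' • x 1) := by
          match_scalars <;> linear_combination (-1 / 2 : ℂ) * hεc
        show x 5 ∈ _
        rw [this]
        exact add_mem (Submodule.smul_mem _ _ k1) (Submodule.smul_mem _ _ l1)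
      · exact h6'
      · have : x 7 = (-1 / 2 : ℂ) • (x 3 - x 7) - (1 / 2 : ℂ) • ((-1 : ℂ) • x 3 - (1 : ℂ) • x 7) := by
          module
        show x 7 ∈ _
        rw [this]
        exact sub_mem (Submodule.smul_mem _ _ k3) (Submodule.smul_mem _ _ l3)
  · have hq : pPart D p = p := by simp [pPart, h2]
    rw [hq] at hunit hrel hj
    have hunit' : ∀ j ∈ Finset.range p, j ≠ p - 1 →
        act (T ^ ((j : ℤ) * D') * lowerT c) G ∈ translates act G := by
      intro j hj hne
      rw [Finset.mem_range] at hj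
      refine hunit j ?_
      have : Nat.Coprime (1 + j) p :=
        Nat.Coprime.symm ((Nat.Prime.coprime_iff_not_dvd hp).mpr
          (Nat.not_dvd_of_pos_of_lt (by omega) (by omega)))
      exact_mod_cast Nat.isCoprime_iff_coprime.mpr this
    -- For odd `p` only `1 + j = p` fails to be a unit, and one plus relation, for one nonresidue,
    -- expresses this last vector by the others.
    by_cases hjp : j = p - 1
    · obtain ⟨r, hr⟩ := IsFundamental.exists_chiP_eq_neg_one (D := D) hp h2
      have h := hrel (-r) (by rwa [neg_neg])
      have hpm : p - 1 ∈ Finset.range p := Finset.mem_range.mpr (by have := hp.pos; omega)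
      rw [← Finset.add_sum_erase _ _ hpm] at h
      have h3 := eq_neg_of_add_eq_zero_left h
      have h4 : ef (-(((-r : ℤ) : ℂ) * ((p - 1 : ℕ) : ℂ)) / (p : ℕ)) •
          act (T ^ (((p - 1 : ℕ) : ℤ) * D') * lowerT c) G ∈ translates act G := by
        rw [h3]
        refine neg_mem (sum_mem fun i hi => ?_)
        rw [Finset.mem_erase] at hi
        exact Submodule.smul_mem _ _ (hunit' i hi.2 hi.1)
      rw [hjp]
      exact (Submodule.smul_mem_iff _ (ef_ne_zero _)).mp h4
    · exact hunit' j (Finset.mem_range.mpr hj) hjp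

end Local

end IsPlusVector

end PlusVector

end

/-! ### Stability of the span of the `T`-translates under `Γ₀(N)` -/

section


namespace IsPlusVector

open ModularGroup

variable {X : Type*} [AddCommGroup X] [Module ℂ X]

variable {D N : ℕ} {act : SL(2, ℤ) → X →ₗ[ℂ] X} {G : X}

/-- Writing `x = jD' + qy` with `q` the `p`-part and `0 ≤ j < q`, the matrices `T^x V` and `T^{jD'}
V T^{qy}` have the same top row modulo `D` because `D' ∣ c`. So finitely many `j` suffice, and
`local_mem_of_lt` treats those. -/
theorem local_stable (hG : IsPlusVector D N act G) (hD : IsFundamental D) {p D' : ℕ} {c : ℤ}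
    (hp : p.Prime) (hpD : p ∣ D) (hD' : D = pPart D p * D') (hcop : Nat.Coprime (pPart D p) D')
    (hcN : (N : ℤ) ∣ c) (hcD : (D' : ℤ) ∣ c) (hE : D' * c ≡ 1 [ZMOD pPart D p]) {m : X}
    (hm : m ∈ translates act G) : act (lowerT c) m ∈ translates act G := by
  have hDZ : (D : ℤ) = pPart D p * D' := by exact_mod_cast hD'
  have hq : 0 < pPart D p := pPart_pos hp
  refine map_mem (fun x => ?_) hm
  obtain ⟨u, v, huv⟩ := Nat.isCoprime_iff_coprime.mpr hcop
  obtain ⟨s, rfl⟩ := hcD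
  set j : ℤ := (x * v) % pPart D p with hj
  have hj0 : 0 ≤ j := Int.emod_nonneg _ (by exact_mod_cast hq.ne')
  have hjq : j < pPart D p := Int.emod_lt_of_pos _ (by exact_mod_cast hq)
  have hjt : (pPart D p : ℤ) * (x * v / pPart D p) + j = x * v := Int.mul_ediv_add_emod _ _
  have hx : x = j * D' + pPart D p * (x * u + x * v / pPart D p * D') := by
    linear_combination (-x) * huv - D' * hjt
  generalize x * u + x * v / pPart D p * D' = y at hx
  clear_value j
  lift j to ℕ using hj0
  have h1 := hG.T_map_mem (pPart D p * y) (hG.local_mem_of_lt hD hp hpD hD' hcop hcN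
    (Dvd.intro _ rfl) hE j (by exact_mod_cast hjq))
  rw [← hG.act_mul] at h1 ⊢
  rw [hG.act_eq hD (B := T ^ ((j : ℤ) * D') * lowerT (D' * s) * T ^ ((pPart D p : ℤ) * y)) 1
    (by rwa [T_lowerT_10]) (by rwa [mul_T_10, T_lowerT_10]) ?_ ?_]
  · exact Submodule.smul_mem _ _ h1
  · rw [mul_T_00, T_lowerT_00, T_lowerT_00, hDZ, hx]
    refine Int.modEq_iff_dvd.mpr ⟨-y * s, ?_⟩
    ring
  · rw [mul_T_01, T_lowerT_00, T_lowerT_01, T_lowerT_01, hDZ, hx]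
    refine Int.modEq_iff_dvd.mpr ⟨j * (D' * s) * y, ?_⟩
    ring

/-- A lower left entry divisible by `D` does not change the top row of `T^x` modulo `D`. -/
theorem lowerT_mul_map_mem (hG : IsPlusVector D N act G) (hD : IsFundamental D) (s : ℤ) {m : X}
    (hm : m ∈ translates act G) : act (lowerT (N * (D * s))) m ∈ translates act G := by
  refine map_mem (fun x => ?_) hm
  rw [← hG.act_mul, hG.act_eq hD (B := T ^ x) 1 (by rw [T_lowerT_10]; exact dvd_mul_right _ _)
    (by simp) ?_ ?_]
  · exact Submodule.smul_mem _ _ (act_T_mem act G _)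
  · rw [T_lowerT_00, T_zpow_00]
    exact Int.modEq_iff_dvd.mpr ⟨-(x * N * s), by ring⟩
  · rw [T_lowerT_01, T_zpow_01, one_mul]

/-- The admissible `h` form a subgroup of `ℤ` containing `D`; closure under negation follows from
`-a = (D - 1)a + D(-a)`. If it were proper, all its elements would be divisible by some prime `p ∣
D`, but `local_stable` produces one that is prime to `p`. -/
theorem lowerT_map_mem (hG : IsPlusVector D N act G) (hD : IsFundamental D)
    (hN : Nat.Coprime D N) (h : ℤ) {m : X} (hm : m ∈ translates act G) :
    act (lowerT (N * h)) m ∈ translates act G := by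
  let H₀ : AddSubmonoid ℤ :=
    { carrier := {h | ∀ m ∈ translates act G, act (lowerT (N * h)) m ∈ translates act G}
      zero_mem' := fun m hm => by simpa using hG.lowerT_mul_map_mem hD 0 hm
      add_mem' := fun {a b} ha hb m hm => by
        rw [mul_add, lowerT_add, hG.act_mul]
        exact hb _ (ha _ hm) }
  have hD0 : ∀ s : ℤ, D * s ∈ H₀ := fun s m hm => hG.lowerT_mul_map_mem hD s hm
  let H : AddSubgroup ℤ :=
    { H₀ with
      neg_mem' := fun {a} ha => by
        have h1 : -a = (D - 1) • a + D * (-a) := by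
          rw [nsmul_eq_mul, Nat.cast_sub hD.pos]; push_cast; ring
        rw [h1]
        exact H₀.add_mem (H₀.nsmul_mem ha _) (hD0 _) }
  obtain ⟨g, hg⟩ := Int.subgroup_cyclic H
  have hgm : ∀ {a : ℤ}, a ∈ H ↔ g ∣ a := by
    intro a
    rw [hg, AddSubgroup.mem_closure_singleton]
    simp only [smul_eq_mul, dvd_iff_exists_eq_mul_left, eq_comm]
  suffices hu : IsUnit g by
    exact (hgm.mpr hu.dvd : h ∈ H) m hm
  by_contra hu
  obtain ⟨p, hp, hpg⟩ := Int.exists_prime_and_dvd (n := g) (fun h => hu (Int.isUnit_iff_natAbs_eq.mpr h))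
  have hgD : g ∣ D := by simpa using hgm.mp (hD0 1 : (D : ℤ) * 1 ∈ H)
  have hpp : p.natAbs.Prime := Int.prime_iff_natAbs_prime.mp hp
  have hpD : p.natAbs ∣ D := by
    have := hpg.trans hgD
    exact Int.natCast_dvd_natCast.mp (Int.natAbs_dvd.mpr this)
  obtain ⟨D', hD', hcop⟩ := hD.exists_eq_pPart_mul hpp hpD
  have hqN : IsCoprime (pPart D p.natAbs : ℤ) N :=
    Nat.isCoprime_iff_coprime.mpr (hN.coprime_dvd_left (hD.pPart_dvd hpp hpD))
  have hqD : IsCoprime (pPart D p.natAbs : ℤ) D' := Nat.isCoprime_iff_coprime.mpr hcop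
  -- The element `D'v` of the subgroup corresponds to `c = ND'v`, which is divisible by `N` and `D'`
  -- and satisfies `D'c ≡ 1` modulo the `p`-part.
  obtain ⟨u, v, huv⟩ := (hqD.mul_right (hqN.mul_right hqD))
  have hmem : D' * v ∈ H := by
    intro m hm
    refine hG.local_stable hD hpp hpD hD' hcop (dvd_mul_right _ _) ⟨N * v, by ring⟩
      (Int.modEq_iff_dvd.mpr ⟨u, ?_⟩) hm
    linear_combination -huv
  have hpv : p ∣ D' * v := hpg.trans (hgm.mp hmem)
  have hpq : p ∣ (pPart D p.natAbs : ℤ) := by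
    rw [← Int.natAbs_dvd]
    have : p.natAbs ∣ pPart D p.natAbs := by
      unfold pPart
      split_ifs with h2 h8
      · rw [h2]; norm_num
      · rw [h2]; norm_num
      · rfl
    exact_mod_cast this
  refine hp.not_isUnit (isUnit_of_dvd_one ?_)
  rw [← huv]
  exact dvd_add (hpq.mul_left _) (by
    have : v * (D' * (N * D')) = D' * v * (N * D') := by ring
    rw [this]; exact hpv.mul_right _)

/-- The span of the translates of `G` contains all `G|γ`, `γ ∈ Γ₀(N)`. -/
theorem act_mem (hG : IsPlusVector D N act G) (hD : IsFundamental D) (hN : Nat.Coprime D N)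
    {γ : SL(2, ℤ)} (hγ : (N : ℤ) ∣ γ 1 0) : act γ G ∈ translates act G := by
  -- A lower triangular factor makes the upper left entry prime to `D`: when `γ₀₁N ≠ 0`, Dirichlet's
  -- theorem gives a prime larger than `D` in the progression.
  obtain ⟨s, hs⟩ : ∃ s : ℤ, IsCoprime (γ 0 0 + s * (γ 0 1 * N)) D := by
    by_cases hb : γ 0 1 * N = 0
    · refine ⟨0, ?_⟩
      have hdet := SL_det γ
      have hb' : γ 0 1 * γ 1 0 = 0 := by
        obtain ⟨t, ht⟩ := hγ
        rw [ht, ← mul_assoc, hb, zero_mul]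
      rw [zero_mul, add_zero]
      exact ⟨γ 1 1, 0, by linarith⟩
    · have hcop : IsCoprime (γ 0 0) ((γ 0 1 * N).natAbs : ℤ) := by
        have h1 : IsCoprime (γ 0 0) (γ 0 1 * N) := by
          obtain ⟨t, ht⟩ := hγ
          have hdet := SL_det γ
          rw [ht] at hdet
          exact ⟨γ 1 1, -t, by linarith⟩
        rcases Int.natAbs_eq (γ 0 1 * N) with h | h
        · rwa [h] at h1
        · rw [h] at h1; exact (IsCoprime.neg_right_iff _ _).mp h1
      obtain ⟨p, hpD, hp, hpd⟩ := Nat.forall_exists_prime_gt_and_zmodEq D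
        (Int.natAbs_ne_zero.mpr hb) hcop
      obtain ⟨s, hs⟩ := Int.natAbs_dvd.mp (Int.modEq_iff_dvd.mp hpd.symm)
      refine ⟨s, ?_⟩
      have : γ 0 0 + s * (γ 0 1 * N) = p := by linarith
      rw [this]
      refine Nat.isCoprime_iff_coprime.mpr ((Nat.Prime.coprime_iff_not_dvd hp).mpr fun h => ?_)
      exact absurd (Nat.le_of_dvd hD.pos h) (by omega)
  obtain ⟨u, v, huv⟩ := hs
  -- The upper right entry of `δ` is `γ₀₁(1 - u(γ₀₀ + sγ₀₁N)) = γ₀₁vD`, so `δ` acts on `G` by a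
  -- scalar.
  set δ : SL(2, ℤ) := γ * lowerT (N * s) * T ^ (-(u * γ 0 1)) with hδ
  have hγδ : γ = δ * (T ^ (u * γ 0 1) * lowerT (N * -s)) := by
    have h1 : T ^ (-(u * γ 0 1)) * T ^ (u * γ 0 1) = 1 := by rw [← zpow_add]; simp
    have h2 : lowerT (N * s) * lowerT (N * -s) = 1 := by
      rw [← lowerT_add, ← lowerT_zero]; congr 1; ring
    calc γ = γ * (lowerT (N * s) * (T ^ (-(u * γ 0 1)) * T ^ (u * γ 0 1)) * lowerT (N * -s)) := by
          rw [h1, mul_one, h2, mul_one]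
      _ = _ := by rw [hδ]; simp only [mul_assoc]
  have h10 : (N : ℤ) ∣ δ 1 0 := by
    rw [hδ, mul_T_10, SL_mul_apply]
    simp only [lowerT_00, lowerT_10, mul_one]
    exact dvd_add hγ ((dvd_mul_right _ _).mul_left _)
  have h01 : (D : ℤ) ∣ δ 0 1 := by
    rw [hδ, mul_T_01, SL_mul_apply, SL_mul_apply]
    simp only [lowerT_00, lowerT_10, lowerT_01, lowerT_11, mul_one, mul_zero, zero_add]
    exact ⟨v * γ 0 1, by linear_combination (-γ 0 1) * huv⟩
  rw [hγδ, hG.act_mul, hG.act_mul, hG.chi_eq δ h10 h01, map_smul, map_smul]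
  exact Submodule.smul_mem _ _ (hG.lowerT_map_mem hD hN _ (act_T_mem act G _))

end IsPlusVector

end

section


variable {K : Type*} [Field K] [NumberField K] {ι : K →+* ℂ}

/-! ### The dual Weil representation and functions of `|u|²` -/

namespace IsImaginaryQuadratic

open ModularGroup Matrix

/-- The functions on `[𝔡]` which only depend on `D|u|² mod D`. -/
def classFunctions (ι : K →+* ℂ) : Submodule ℂ (DiscGroup ι → ℂ) where
  carrier := {x | ∀ u v, normD ι u ≡ normD ι v [ZMOD absDisc K] → x u = x v}
  zero_mem' _ _ _ := rfl
  add_mem' hx hy u v h := by simp [hx u v h, hy u v h]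
  smul_mem' c x hx u v h := by simp [hx u v h]

open Classical in
/-- The indicator function of the `u` with `D|u|² ≡ D|v|² mod D`. -/
def classIndicator (v : DiscGroup ι) : DiscGroup ι → ℂ :=
  fun u => if normD ι u ≡ normD ι v [ZMOD absDisc K] then 1 else 0

theorem aD_congr {ℓ ℓ' : ℤ} (h : ℓ ≡ ℓ' [ZMOD absDisc K]) : aD ι ℓ = aD ι ℓ' := by
  unfold aD
  refine Nat.card_congr (Equiv.subtypeEquivRight fun u => ?_)
  exact ⟨fun hu => hu.trans h.neg, fun hu => hu.trans h.neg.symm⟩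

variable [Fintype (DiscGroup ι)]

theorem sum_classIndicator (v : DiscGroup ι) {ℓ : ℤ} (h : ℓ ≡ -normD ι v [ZMOD absDisc K]) :
    ∑ u, classIndicator v u = (aD ι ℓ : ℂ) := by
  classical
  simp only [classIndicator]
  rw [Finset.sum_boole, aD, Nat.card_eq_fintype_card, Fintype.card_subtype]
  congr 2
  ext u
  simp only [Finset.mem_filter, Finset.mem_univ, true_and]
  have h' : -ℓ ≡ normD ι v [ZMOD absDisc K] := by simpa using h.neg
  exact ⟨fun hu => hu.trans h'.symm, fun hu => hu.trans h'⟩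

theorem aD_ne_zero (v : DiscGroup ι) {ℓ : ℤ} (h : ℓ ≡ -normD ι v [ZMOD absDisc K]) :
    aD ι ℓ ≠ 0 := by
  unfold aD
  have h' : -ℓ ≡ normD ι v [ZMOD absDisc K] := by simpa using h.neg
  have : Nonempty {u : DiscGroup ι // normD ι u ≡ -ℓ [ZMOD absDisc K]} := ⟨⟨v, h'.symm⟩⟩
  exact Nat.card_ne_zero.mpr ⟨this, inferInstance⟩

variable [DecidableEq (DiscGroup ι)]

/-- The right action of `SL₂(ℤ)` on functions on `[𝔡]` dual to the Weil representation. -/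
def weilAct (hK : IsImaginaryQuadratic ι) (γ : SL(2, ℤ)) :
    (DiscGroup ι → ℂ) →ₗ[ℂ] (DiscGroup ι → ℂ) := (hK.weil γ)ᴴ.mulVecLin

theorem weilAct_apply (hK : IsImaginaryQuadratic ι) (γ : SL(2, ℤ)) (x : DiscGroup ι → ℂ)
    (v : DiscGroup ι) : hK.weilAct γ x v = ∑ u, (starRingEnd ℂ) (hK.weil γ u v) * x u := rfl

theorem weilAct_mul (hK : IsImaginaryQuadratic ι) (A B : SL(2, ℤ)) (x : DiscGroup ι → ℂ) :
    hK.weilAct (A * B) x = hK.weilAct B (hK.weilAct A x) := by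
  rw [weilAct, weilAct, weilAct, hK.weil_mul, Matrix.conjTranspose_mul, Matrix.mulVecLin_mul]
  rfl

theorem weilAct_T_one (hK : IsImaginaryQuadratic ι) (n : ℤ) (v : DiscGroup ι) :
    hK.weilAct (T ^ n) 1 v = ef (-(n * normD ι v) / absDisc K) := by
  rw [weilAct_apply, hK.weil_T]
  have : (n : ℂ) * normD ι v / absDisc K = ((n * normD ι v / absDisc K : ℝ) : ℂ) := by
    push_cast; ring
  simp only [Matrix.diagonal_apply, apply_ite (starRingEnd ℂ), map_zero, Pi.one_apply, mul_one,
    Finset.sum_ite_eq', Finset.mem_univ, if_true, this, conj_ef_real]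
  congr 1
  push_cast
  ring

/-- The character comes from the column sums of `ρ`. In the plus relation, the sum over `j` at `v`
is nonzero only if `D|v|² ≡ -r` modulo the `p`-part, which `χ_p(-r) = -1` forbids for a norm. -/
theorem isPlusVector_weilAct (hK : IsImaginaryQuadratic ι) (N : ℕ) :
    IsPlusVector (absDisc K) N hK.weilAct 1 where
  act_mul A B x := hK.weilAct_mul A B x
  chi_eq δ _ hδ := by
    funext v
    simp only [weilAct_apply, Pi.one_apply, mul_one, Pi.smul_apply, smul_eq_mul]
    rw [← map_sum, hK.sum_weil_col hδ, map_intCast]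
  plus p hp hpD D' hD' r hr := by
    funext v
    have hq : 0 < pPart (absDisc K) p := pPart_pos hp
    have hqc : ((pPart (absDisc K) p : ℕ) : ℂ) ≠ 0 := by exact_mod_cast hq.ne'
    have hDc : (absDisc K : ℂ) = (pPart (absDisc K) p : ℕ) * D' := by exact_mod_cast hD'
    have hD'c : (D' : ℂ) ≠ 0 := by
      intro h
      rw [h, mul_zero] at hDc
      exact hK.fund.pos.ne' (by exact_mod_cast hDc)
    rw [Finset.sum_apply]
    have h1 : ∀ j : ℕ, (ef (-((r : ℂ) * j) / (pPart (absDisc K) p : ℕ)) •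
        hK.weilAct (T ^ ((j : ℤ) * D')) 1) v =
        ef ((j : ℂ) * (-(r + normD ι v) : ℤ) / (pPart (absDisc K) p : ℕ)) := by
      intro j
      rw [Pi.smul_apply, smul_eq_mul, hK.weilAct_T_one, ← ef_add, hDc]
      congr 1
      push_cast
      field_simp
      ring
    simp only [h1, sum_ef_div hq]
    rw [if_neg, Pi.zero_apply]
    intro hdvd
    refine hK.chiP_normD_ne hp hpD v ?_
    rw [← hr]
    refine chiP_congr (Int.modEq_iff_dvd.mpr ?_)
    have : -r - normD ι v = -(r + normD ι v) := by ring
    rw [this]; exact hdvd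

theorem classIndicator_eq_sum (hK : IsImaginaryQuadratic ι) (v : DiscGroup ι) :
    classIndicator v = (absDisc K : ℂ)⁻¹ • ∑ j ∈ Finset.range (absDisc K),
      ef ((j : ℂ) * normD ι v / absDisc K) • hK.weilAct (T ^ (j : ℤ)) 1 := by
  funext u
  have hD := hK.fund.pos
  have hDc : (absDisc K : ℂ) ≠ 0 := by exact_mod_cast hD.ne'
  rw [Pi.smul_apply, Finset.sum_apply]
  have h1 : ∀ j : ℕ, (ef ((j : ℂ) * normD ι v / absDisc K) • hK.weilAct (T ^ (j : ℤ)) 1) u =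
      ef ((j : ℂ) * (normD ι v - normD ι u : ℤ) / absDisc K) := by
    intro j
    rw [Pi.smul_apply, smul_eq_mul, hK.weilAct_T_one, ← ef_add]
    congr 1
    push_cast
    ring
  simp only [h1, sum_ef_div hD, classIndicator, Int.modEq_iff_dvd]
  split_ifs <;> simp [hDc]

theorem classIndicator_mem (hK : IsImaginaryQuadratic ι) (v : DiscGroup ι) :
    classIndicator v ∈ IsPlusVector.translates hK.weilAct 1 := by
  rw [hK.classIndicator_eq_sum]
  exact Submodule.smul_mem _ _ (sum_mem fun j _ => Submodule.smul_mem _ _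
    (IsPlusVector.act_T_mem hK.weilAct 1 _))

/-- The translates `1|T^n` are the additive characters of `ℤ/D` evaluated at `D|u|²`. Fourier
inversion on `ℤ/D` yields the indicators of the classes, and these span. -/
theorem translates_eq (hK : IsImaginaryQuadratic ι) :
    IsPlusVector.translates hK.weilAct 1 = classFunctions ι := by
  apply le_antisymm
  · refine Submodule.span_le.mpr ?_
    rintro _ ⟨n, rfl⟩ u v huv
    dsimp only
    rw [hK.weilAct_T_one, hK.weilAct_T_one]
    have := ef_int_div_congr hK.fund.pos.ne' ((huv.mul_left n).neg)
    exact_mod_cast this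
  · intro x hx
    have : x = ∑ v, (x v / (aD ι (-normD ι v) : ℂ)) • classIndicator v := by
      funext u
      have hne : (aD ι (-normD ι u) : ℂ) ≠ 0 := by exact_mod_cast aD_ne_zero u rfl
      rw [Finset.sum_apply]
      have h1 : ∀ v, ((x v / (aD ι (-normD ι v) : ℂ)) • classIndicator v) u =
          x u / (aD ι (-normD ι u) : ℂ) * classIndicator u v := by
        intro v
        simp only [Pi.smul_apply, smul_eq_mul, classIndicator]
        by_cases h : normD ι u ≡ normD ι v [ZMOD absDisc K]
        · rw [if_pos h, if_pos h.symm, hx u v h, aD_congr h.neg]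
        · rw [if_neg h, if_neg (fun h' => h h'.symm), mul_zero, mul_zero]
      simp only [h1]
      rw [← Finset.mul_sum, sum_classIndicator u rfl]
      field_simp
    rw [this]
    exact sum_mem fun v _ => Submodule.smul_mem _ _ (hK.classIndicator_mem v)

/-- The functions of `D|u|² mod D` are stable under all of `SL₂(ℤ)`. -/
theorem weilAct_mem_classFunctions (hK : IsImaginaryQuadratic ι) (γ : SL(2, ℤ))
    {x : DiscGroup ι → ℂ} (hx : x ∈ classFunctions ι) : hK.weilAct γ x ∈ classFunctions ι := by
  rw [← hK.translates_eq] at hx ⊢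
  refine IsPlusVector.map_mem (fun n => ?_) hx
  rw [← hK.weilAct_mul]
  -- At level `1` the key lemma places no restriction on `γ`.
  exact (hK.isPlusVector_weilAct 1).act_mem hK.fund (Nat.coprime_one_right _) (by simp)

end IsImaginaryQuadratic

/-! ### Slashing with diagonal matrices -/

section Slash

/-- The slash action as a right module structure on functions. -/
def slashAct (κ : ℤ) (γ : SL(2, ℤ)) : (ℍ → ℂ) →ₗ[ℂ] (ℍ → ℂ) where
  toFun f := f ∣[κ] γ
  map_add' f g := SlashAction.add_slash κ γ f g
  map_smul' c f := ModularForm.SL_smul_slash κ γ f c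

@[simp] theorem slashAct_apply (κ : ℤ) (γ : SL(2, ℤ)) (f : ℍ → ℂ) : slashAct κ γ f = f ∣[κ] γ := rfl

theorem slash_eq (κ : ℤ) (γ : SL(2, ℤ)) (f : ℍ → ℂ) (τ : ℍ) :
    (f ∣[κ] γ) τ = ((γ 1 0 : ℂ) * τ + γ 1 1) ^ (-κ) * f (γ • τ) := by
  rw [ModularForm.SL_slash_apply, mul_comm, ModularGroup.denom_apply]

theorem slash_T (κ : ℤ) (n : ℤ) (f : ℍ → ℂ) (τ : ℍ) :
    (f ∣[κ] (ModularGroup.T ^ n)) τ = f (ModularGroup.T ^ n • τ) := by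
  rw [slash_eq]
  simp only [T_zpow_10, T_zpow_11, Int.cast_zero, Int.cast_one, zero_mul, zero_add, one_zpow,
    one_mul]

theorem coe_T_smul (n : ℤ) (τ : ℍ) : ((ModularGroup.T ^ n • τ : ℍ) : ℂ) = τ + n := by
  rw [coe_SL_smul]; simp

variable {D : ℕ}

/-- The matrix `(1 0; 0 D)`. -/
def lowerDiag (hD : 0 < D) : GL (Fin 2) ℝ :=
  Matrix.GeneralLinearGroup.mkOfDetNeZero !![1, 0; 0, (D : ℝ)] (by
    simpa using hD.ne')

/-- The matrix `(D 0; 0 1)`. -/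
def upperDiag (hD : 0 < D) : GL (Fin 2) ℝ :=
  Matrix.GeneralLinearGroup.mkOfDetNeZero !![(D : ℝ), 0; 0, 1] (by
    simpa using hD.ne')

theorem coe_ofComplex {z : ℂ} (hz : 0 < z.im) : ((ofComplex z : ℍ) : ℂ) = z := by
  rw [ofComplex_apply_of_im_pos hz]

theorem im_div_pos (hD : 0 < D) (τ : ℍ) : 0 < ((τ : ℂ) / D).im := by
  rw [Complex.div_natCast_im]
  exact div_pos τ.im_pos (by exact_mod_cast hD)

theorem im_mul_pos (hD : 0 < D) (τ : ℍ) : 0 < ((D : ℂ) * τ).im := by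
  have : ((D : ℂ) * τ).im = D * (τ : ℂ).im := by simp
  rw [this]
  exact mul_pos (by exact_mod_cast hD) τ.im_pos

theorem slash_lowerDiag (hD : 0 < D) (κ : ℤ) (f : ℍ → ℂ) (τ : ℍ) :
    (f ∣[κ] lowerDiag hD) τ = (D : ℂ)⁻¹ * f (ofComplex ((τ : ℂ) / D)) := by
  have hDc : (D : ℂ) ≠ 0 := by exact_mod_cast hD.ne'
  have hdet : (lowerDiag hD).det.val = D := by
    simp [lowerDiag, Matrix.GeneralLinearGroup.mkOfDetNeZero]
  have hpos : 0 < (lowerDiag hD).det.val := by rw [hdet]; exact_mod_cast hD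
  have hsm : lowerDiag hD • τ = ofComplex ((τ : ℂ) / D) := by
    ext1
    rw [coe_smul_of_det_pos hpos, coe_ofComplex (im_div_pos hD τ)]
    simp [num, denom, lowerDiag, Matrix.GeneralLinearGroup.mkOfDetNeZero]
  have hden : denom (lowerDiag hD) τ = D := by
    simp [denom, lowerDiag, Matrix.GeneralLinearGroup.mkOfDetNeZero]
  rw [ModularForm.slash_apply, hsm, hden, σ, if_pos hpos]
  have : |(lowerDiag hD).det.val| = D := by rw [hdet]; exact abs_of_nonneg (Nat.cast_nonneg _)
  rw [this]
  simp only [ContinuousAlgEquiv.refl_apply, ofReal_natCast]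
  rw [mul_assoc, ← zpow_add₀ hDc, mul_comm]
  congr 1
  rw [← zpow_neg_one]; congr 1; ring

theorem slash_upperDiag (hD : 0 < D) (κ : ℤ) (f : ℍ → ℂ) (τ : ℍ) :
    (f ∣[κ] upperDiag hD) τ = (D : ℂ) ^ (κ - 1) * f (ofComplex ((D : ℂ) * τ)) := by
  have hdet : (upperDiag hD).det.val = D := by
    simp [upperDiag, Matrix.GeneralLinearGroup.mkOfDetNeZero]
  have hpos : 0 < (upperDiag hD).det.val := by rw [hdet]; exact_mod_cast hD
  have hsm : upperDiag hD • τ = ofComplex ((D : ℂ) * τ) := by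
    ext1
    rw [coe_smul_of_det_pos hpos, coe_ofComplex (im_mul_pos hD τ)]
    simp [num, denom, upperDiag, Matrix.GeneralLinearGroup.mkOfDetNeZero]
  have hden : denom (upperDiag hD) τ = 1 := by
    simp [denom, upperDiag, Matrix.GeneralLinearGroup.mkOfDetNeZero]
  rw [ModularForm.slash_apply, hsm, hden, σ, if_pos hpos]
  have : |(upperDiag hD).det.val| = D := by rw [hdet]; exact abs_of_nonneg (Nat.cast_nonneg _)
  rw [this]
  simp only [ContinuousAlgEquiv.refl_apply, ofReal_natCast, one_zpow, mul_one]
  rw [mul_comm]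

/-- A matrix with integral first column maps `∞` to a cusp of `SL₂(ℤ)`. -/
theorem isCusp_smul_infty (M : GL (Fin 2) ℝ) {a c : ℤ} (ha : M 0 0 = a) (hc : M 1 0 = c) :
    IsCusp (M • (OnePoint.infty : OnePoint ℝ)) (𝒮ℒ) := by
  rw [isCusp_SL2Z_iff, OnePoint.smul_infty_eq_ite]
  split_ifs with h
  · exact ⟨OnePoint.infty, rfl⟩
  · refine ⟨((a / c : ℚ) : OnePoint ℚ), ?_⟩
    rw [OnePoint.map_some, ha, hc]
    push_cast
    rfl

end Slash

end

section


/-- Applied to a pair, the key lemma propagates linear relations between the `T`-translates of `G`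
and of `G'` to all their translates by `Γ₀(N)`. -/
theorem IsPlusVector.prodMap {X Y : Type*} [AddCommGroup X] [Module ℂ X] [AddCommGroup Y]
    [Module ℂ Y] {D N : ℕ} {act : SL(2, ℤ) → X →ₗ[ℂ] X} {act' : SL(2, ℤ) → Y →ₗ[ℂ] Y} {G : X}
    {G' : Y} (h : IsPlusVector D N act G) (h' : IsPlusVector D N act' G') :
    IsPlusVector D N (fun γ => (act γ).prodMap (act' γ)) (G, G') where
  act_mul A B x := Prod.ext (h.act_mul A B x.1) (h'.act_mul A B x.2)
  chi_eq δ h1 h2 := Prod.ext (h.chi_eq δ h1 h2) (h'.chi_eq δ h1 h2)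
  plus p hp hpD D' hD' r hr := by
    have e1 := h.plus p hp hpD D' hD' r hr
    have e2 := h'.plus p hp hpD D' hD' r hr
    refine Prod.ext ?_ ?_
    · rw [Prod.fst_sum]; exact e1
    · rw [Prod.snd_sum]; exact e2

/-! ### The components `g_u` of the lift -/

variable {K : Type*} [Field K] [NumberField K] {ι : K →+* ℂ}

theorem qParam_pow_eq (h : ℕ) (τ : ℂ) (m : ℕ) :
    Function.Periodic.qParam (h : ℝ) τ ^ m = ef ((m : ℂ) / h * τ) := by
  rw [Function.Periodic.qParam, ← Complex.exp_nat_mul, ef]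
  congr 1
  push_cast
  ring

theorem hasSum_coeff {M : ℕ} [NeZero M] {κ : ℤ} (g : MFGamma1 M κ) (τ : ℍ) :
    HasSum (fun ℓ : ℕ => coeff g ℓ * ef ((ℓ : ℂ) * τ)) (g τ) := by
  have := ModularForm.hasSum_qExpansion g one_pos (one_mem_strictPeriods M) τ
  refine this.congr_fun fun m => ?_
  have h1 := qParam_pow_eq 1 τ m
  rw [Nat.cast_one] at h1
  rw [h1, coeff, Nat.cast_one, div_one]

/-- The function `g(τ/D)`. -/
def rescaled (D : ℕ) (g : ℍ → ℂ) : ℍ → ℂ := fun τ => g (ofComplex ((τ : ℂ) / D))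

theorem rescaled_eq_slash {D : ℕ} (hD : 0 < D) (κ : ℤ) (g : ℍ → ℂ) :
    rescaled D g = (D : ℂ) • (g ∣[κ] lowerDiag hD) := by
  funext τ
  have hDc : (D : ℂ) ≠ 0 := by exact_mod_cast hD.ne'
  rw [Pi.smul_apply, slash_lowerDiag, smul_eq_mul, mul_inv_cancel_left₀ hDc, rescaled]

theorem hasSum_rescaled {M : ℕ} [NeZero M] {κ : ℤ} (g : MFGamma1 M κ) {D : ℕ} (hD : 0 < D)
    (τ : ℍ) : HasSum (fun ℓ : ℕ => coeff g ℓ * ef ((ℓ : ℂ) * τ / D)) (rescaled D g τ) := by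
  have := hasSum_coeff g (ofComplex ((τ : ℂ) / D))
  rw [coe_ofComplex (im_div_pos hD τ)] at this
  simp only [mul_div_assoc]
  exact this

namespace IsImaginaryQuadratic

open ModularGroup

theorem coeff_eq_zero_of_chiP (hK : IsImaginaryQuadratic ι) {N : ℕ} {κ : ℤ}
    {g : MFGamma1 (absDisc K * N) κ} (hg : g ∈ plusForms ι κ N) {p : ℕ} (hp : p.Prime)
    (hpD : p ∣ absDisc K) {ℓ : ℕ} (h : chiP (absDisc K) p (-ℓ) = -1) : coeff g ℓ = 0 := by
  refine hg.2 ℓ ?_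
  by_contra hne
  have := (Nat.card_ne_zero.mp hne).1
  obtain ⟨u, hu⟩ := this
  refine hK.chiP_normD_ne hp hpD u ?_
  rw [← h]
  exact chiP_congr (hu.of_dvd (by exact_mod_cast hK.fund.pPart_dvd hp hpD))

/-- Conjugation by `(1 0; 0 D)` carries `Γ₀(N) ∩ Γ⁰(D)` into `Γ₀(DN)`. The sum in the plus relation
keeps the exponents `ℓ ≡ r` modulo the `p`-part; there `χ_p(-ℓ) = -1`, so `-ℓ` is no value of
`D|u|²` and `a_ℓ(g) = 0`. -/
theorem isPlusVector_rescaled (hK : IsImaginaryQuadratic ι) {N : ℕ} [NeZero (absDisc K * N)]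
    {κ : ℤ} {g : MFGamma1 (absDisc K * N) κ} (hg : g ∈ plusForms ι κ N) :
    IsPlusVector (absDisc K) N (slashAct κ) (rescaled (absDisc K) g) where
  act_mul A B f := SlashAction.slash_mul κ A B f
  chi_eq δ hN hD := by
    obtain ⟨b, hb⟩ := hD
    obtain ⟨c, hc⟩ := hN
    have hDp := hK.fund.pos
    have hDc : (absDisc K : ℂ) ≠ 0 := by exact_mod_cast hDp.ne'
    have hdet := SL_det δ
    let ε : SL(2, ℤ) := ⟨!![δ 0 0, b; absDisc K * δ 1 0, δ 1 1], by
      rw [Matrix.det_fin_two_of]; rw [hb] at hdet; linarith⟩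
    have h1 := hg.1 ε (by
      rw [Gamma0_mem, ZMod.intCast_zmod_eq_zero_iff_dvd]
      refine ⟨c, ?_⟩
      show (absDisc K : ℤ) * δ 1 0 = _
      rw [hc]; push_cast; ring)
    funext τ
    have h2 := congrFun h1 (ofComplex ((τ : ℂ) / absDisc K))
    rw [slash_eq] at h2
    have e10 : ((ε 1 0 : ℤ) : ℂ) = absDisc K * δ 1 0 := by
      show (((absDisc K : ℤ) * δ 1 0 : ℤ) : ℂ) = _
      push_cast; rfl
    have e11 : ε 1 1 = δ 1 1 := rfl
    have e00 : ε 0 0 = δ 0 0 := rfl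
    have e01 : ε 0 1 = b := rfl
    have hj := SL_denom_ne_zero δ τ
    have e3 : ε • (ofComplex ((τ : ℂ) / absDisc K)) = ofComplex (((δ • τ : ℍ) : ℂ) / absDisc K) := by
      ext1
      rw [coe_ofComplex (im_div_pos hDp _), coe_SL_smul, coe_SL_smul,
        coe_ofComplex (im_div_pos hDp _), e10, e11, e00, e01, hb]
      have e4 : (absDisc K : ℂ) * δ 1 0 * (τ / absDisc K) = δ 1 0 * τ := by field_simp
      rw [e4]
      push_cast
      field_simp
    rw [e3, e10, e11, coe_ofComplex (im_div_pos hDp _)] at h2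
    have e4 : (absDisc K : ℂ) * δ 1 0 * (τ / absDisc K) = δ 1 0 * τ := by field_simp
    rw [e4] at h2
    rw [slashAct_apply, slash_eq]
    exact h2
  plus p hp hpD D' hD' r hr := by
    have hD := hK.fund.pos
    have hq : 0 < pPart (absDisc K) p := pPart_pos hp
    have hqc : ((pPart (absDisc K) p : ℕ) : ℂ) ≠ 0 := by exact_mod_cast hq.ne'
    have hDc : (absDisc K : ℂ) = (pPart (absDisc K) p : ℕ) * D' := by exact_mod_cast hD'
    have hD'c : (D' : ℂ) ≠ 0 := by
      intro h
      rw [h, mul_zero] at hDc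
      exact hD.ne' (by exact_mod_cast hDc)
    funext τ
    rw [Finset.sum_apply]
    have h1 : ∀ j : ℕ, HasSum (fun ℓ : ℕ => coeff g ℓ * ef ((ℓ : ℂ) * τ / absDisc K) *
        ef ((j : ℂ) * (ℓ - r : ℤ) / (pPart (absDisc K) p : ℕ)))
        ((ef (-((r : ℂ) * j) / (pPart (absDisc K) p : ℕ)) •
          slashAct κ (T ^ ((j : ℤ) * D')) (rescaled (absDisc K) g)) τ) := by
      intro j
      rw [Pi.smul_apply, slashAct_apply, slash_T, smul_eq_mul]
      refine ((hasSum_rescaled g hD _).mul_left _).congr_fun fun ℓ => ?_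
      rw [coe_T_smul, mul_left_comm, mul_assoc, ← ef_add, ← ef_add, hDc]
      congr 2
      push_cast
      field_simp
      ring
    have h2 := hasSum_sum (s := Finset.range (pPart (absDisc K) p)) fun j _ => h1 j
    rw [← h2.tsum_eq, Pi.zero_apply]
    refine (tsum_congr fun ℓ => ?_).trans tsum_zero
    rw [← Finset.mul_sum, sum_ef_div hq]
    split_ifs with hdvd
    · have : coeff g ℓ = 0 := by
        refine hK.coeff_eq_zero_of_chiP hg hp hpD ?_
        rw [← hr]
        refine chiP_congr (Int.modEq_iff_dvd.mpr ?_)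
        have e : -r - -(ℓ : ℤ) = ℓ - r := by ring
        rw [e]; exact hdvd
      rw [this]; ring
    · ring

section Components

variable {N : ℕ} {κ : ℤ} {g : MFGamma1 (absDisc K * N) κ}

theorem hasSum_liftComponent (hK : IsImaginaryQuadratic ι) [NeZero (absDisc K * N)]
    (u : DiscGroup ι) (τ : ℍ) :
    HasSum (fun ℓ : ℕ => if (ℓ : ℤ) ≡ -normD ι u [ZMOD absDisc K] then
      (chi (absDisc K) N : ℂ) * (-Complex.I * (Real.sqrt (absDisc K) : ℂ) / (aD ι ℓ : ℂ)) *
        coeff g ℓ * ef ((ℓ : ℂ) * τ / absDisc K) else 0) (liftComponent ι N g u τ) := by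
  classical
  have h1 : Summable fun ℓ : ℕ => if (ℓ : ℤ) ≡ -normD ι u [ZMOD (absDisc K : ℤ)] then
      coeff g ℓ * ef ((ℓ : ℂ) * τ / absDisc K) else 0 := by
    have := (hasSum_rescaled g hK.fund.pos τ).summable.indicator
      {ℓ : ℕ | (ℓ : ℤ) ≡ -normD ι u [ZMOD (absDisc K : ℤ)]}
    refine this.congr fun ℓ => ?_
    simp only [Set.indicator_apply, Set.mem_ofPred_eq]
  have h2 := h1.hasSum.mul_left ((chi (absDisc K) N : ℂ) *
    (-Complex.I * (Real.sqrt (absDisc K) : ℂ) / (aD ι (-normD ι u) : ℂ)))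
  rw [liftComponent]
  refine HasSum.congr_fun (f := fun ℓ : ℕ => (chi (absDisc K) N : ℂ) *
    (-Complex.I * (Real.sqrt (absDisc K) : ℂ) / (aD ι (-normD ι u) : ℂ)) *
    if (ℓ : ℤ) ≡ -normD ι u [ZMOD (absDisc K : ℤ)] then
      coeff g ℓ * ef ((ℓ : ℂ) * τ / absDisc K) else 0) ?_ fun ℓ => ?_
  · convert h2
  · split_ifs with h
    · rw [aD_congr h]; ring
    · rw [mul_zero]

theorem liftComponent_congr {u v : DiscGroup ι} (h : normD ι u ≡ normD ι v [ZMOD absDisc K])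
    (τ : ℍ) : liftComponent ι N g u τ = liftComponent ι N g v τ := by
  have h1 : ∀ ℓ : ℕ, (ℓ : ℤ) ≡ -normD ι u [ZMOD absDisc K] ↔
      (ℓ : ℤ) ≡ -normD ι v [ZMOD absDisc K] := fun ℓ =>
    ⟨fun h' => h'.trans h.neg, fun h' => h'.trans h.neg.symm⟩
  simp only [liftComponent, aD_congr h.neg, h1]

variable [Fintype (DiscGroup ι)]

/-- Each exponent `ℓ` occurs in exactly `a_D(ℓ)` components, which cancels the denominator; if
`a_D(ℓ) = 0`, the plus condition kills the coefficient on the right. -/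
theorem sum_liftComponent (hK : IsImaginaryQuadratic ι) [NeZero (absDisc K * N)]
    (hg : g ∈ plusForms ι κ N) (x : ℤ) (τ : ℍ) :
    ∑ u, ef (-(x * normD ι u) / absDisc K) * liftComponent ι N g u τ =
      (chi (absDisc K) N : ℂ) * (-Complex.I * (Real.sqrt (absDisc K) : ℂ)) *
        rescaled (absDisc K) g (T ^ x • τ) := by
  classical
  have hD := hK.fund.pos
  have h1 := hasSum_sum (s := Finset.univ) fun u _ =>
    (hK.hasSum_liftComponent (g := g) u τ).mul_left (ef (-(x * normD ι u) / absDisc K))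
  refine h1.unique (((hasSum_rescaled g hD (T ^ x • τ)).mul_left _).congr_fun fun ℓ => ?_)
  rw [coe_T_smul]
  have h2 : ∀ u : DiscGroup ι, (ef (-(x * normD ι u) / absDisc K) *
      if (ℓ : ℤ) ≡ -normD ι u [ZMOD absDisc K] then
        (chi (absDisc K) N : ℂ) * (-Complex.I * (Real.sqrt (absDisc K) : ℂ) / (aD ι ℓ : ℂ)) *
        coeff g ℓ * ef ((ℓ : ℂ) * τ / absDisc K) else 0) =
      if normD ι u ≡ -ℓ [ZMOD absDisc K] then ef ((x * ℓ) / absDisc K) *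
        ((chi (absDisc K) N : ℂ) * (-Complex.I * (Real.sqrt (absDisc K) : ℂ) / (aD ι ℓ : ℂ)) *
        coeff g ℓ * ef ((ℓ : ℂ) * τ / absDisc K)) else 0 := by
    intro u
    by_cases h : (ℓ : ℤ) ≡ -normD ι u [ZMOD absDisc K]
    · have h' : normD ι u ≡ -ℓ [ZMOD absDisc K] := by simpa using h.neg.symm
      rw [if_pos h, if_pos h']
      have := ef_int_div_congr hD.ne' (h.mul_left x)
      push_cast at this
      rw [this]
      congr 3
      ring
    · have h' : ¬ normD ι u ≡ -ℓ [ZMOD absDisc K] := fun h' => h (by simpa using h'.neg.symm)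
      rw [if_neg h, if_neg h', mul_zero]
  simp only [h2]
  rw [← Finset.sum_filter, Finset.sum_const, nsmul_eq_mul]
  have h3 : (aD ι ℓ : ℂ) = ((Finset.univ.filter fun u : DiscGroup ι =>
      normD ι u ≡ -ℓ [ZMOD absDisc K]).card : ℂ) := by
    rw [aD, Nat.card_eq_fintype_card, Fintype.card_subtype]
  rw [← h3]
  by_cases h0 : aD ι ℓ = 0
  · rw [hg.2 ℓ h0]; ring
  · have h0' : (aD ι ℓ : ℂ) ≠ 0 := by exact_mod_cast h0
    have e : ef ((ℓ : ℂ) * (τ + x) / absDisc K) =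
        ef ((x * ℓ) / absDisc K) * ef ((ℓ : ℂ) * τ / absDisc K) := by
      rw [← ef_add]; congr 1; ring
    rw [e]
    field_simp

variable [DecidableEq (DiscGroup ι)]

/-- The lift components transform under `Γ₀(N)` by the dual Weil representation. -/
theorem liftComponent_slash (hK : IsImaginaryQuadratic ι) [NeZero (absDisc K * N)]
    (hN : Nat.Coprime (absDisc K) N) (hg : g ∈ plusForms ι κ N) {γ : SL(2, ℤ)}
    (hγ : (N : ℤ) ∣ γ 1 0) (v : DiscGroup ι) (τ : ℍ) :
    ((liftComponent ι N g v) ∣[κ] γ) τ =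
      ∑ u, (starRingEnd ℂ) (hK.weil γ v u) * liftComponent ι N g u τ := by
  set C : ℂ := (chi (absDisc K) N : ℂ) * (-Complex.I * (Real.sqrt (absDisc K) : ℂ)) with hC
  set G := rescaled (absDisc K) g with hG
  let L : (DiscGroup ι → ℂ) →ₗ[ℂ] (ℍ → ℂ) := Fintype.linearCombination ℂ (liftComponent ι N g)
  have hL : ∀ x τ, L x τ = ∑ u, x u * liftComponent ι N g u τ := by
    intro x τ
    simp only [L, Fintype.linearCombination_apply, Finset.sum_apply, Pi.smul_apply, smul_eq_mul]
  have hpv := (hK.isPlusVector_rescaled hg).prodMap (hK.isPlusVector_weilAct N)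
  have hLT : ∀ n : ℤ, L (hK.weilAct (T ^ n) 1) = C • (G ∣[κ] (T ^ n)) := by
    intro n
    funext τ
    rw [hL, Pi.smul_apply, slash_T, smul_eq_mul, hC, hG, ← hK.sum_liftComponent hg]
    exact Finset.sum_congr rfl fun u _ => by rw [hK.weilAct_T_one]
  -- The pairs `(f, x)` with `C f = L x` form a subspace containing all `T`-translates of `(G, 1)`,
  -- hence, by the key lemma, all their translates under `Γ₀(N)`.
  have hgraph : IsPlusVector.translates (fun γ => (slashAct κ γ).prodMap (hK.weilAct γ))
      (G, (1 : DiscGroup ι → ℂ)) ≤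
      LinearMap.ker ((C • LinearMap.fst ℂ (ℍ → ℂ) (DiscGroup ι → ℂ)) -
        L ∘ₗ LinearMap.snd ℂ (ℍ → ℂ) (DiscGroup ι → ℂ)) := by
    refine Submodule.span_le.mpr ?_
    rintro _ ⟨n, rfl⟩
    simp only [SetLike.mem_coe, LinearMap.mem_ker, LinearMap.sub_apply, LinearMap.smul_apply,
      LinearMap.comp_apply, LinearMap.fst_apply, LinearMap.snd_apply, LinearMap.prodMap_apply]
    rw [hLT, slashAct_apply, sub_self]
  have hLγ : ∀ δ : SL(2, ℤ), (N : ℤ) ∣ δ 1 0 → L (hK.weilAct δ 1) = C • (G ∣[κ] δ) := by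
    intro δ hδ
    have := hgraph (hpv.act_mem hK.fund hN hδ)
    simp only [LinearMap.mem_ker, LinearMap.sub_apply, LinearMap.smul_apply,
      LinearMap.comp_apply, LinearMap.fst_apply, LinearMap.snd_apply, LinearMap.prodMap_apply,
      slashAct_apply] at this
    exact (sub_eq_zero.mp this).symm
  -- `L` intertwines the actions of `γ` on the span of the `1|T^n`, which contains the indicator of
  -- the class of `v`.
  have hequiv : ∀ x ∈ IsPlusVector.translates hK.weilAct 1,
      L (hK.weilAct γ x) = (L x) ∣[κ] γ := by
    intro x hx
    induction hx using Submodule.span_induction with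
    | mem x hx =>
      obtain ⟨n, rfl⟩ := hx
      dsimp only
      rw [← hK.weilAct_mul, hLγ _ (by rw [SL_mul_apply]; simpa using hγ), hLT,
        SlashAction.slash_mul, ModularForm.SL_smul_slash]
    | zero => simp [SlashAction.zero_slash]
    | add x y _ _ hx hy => rw [map_add, map_add, hx, hy, map_add, SlashAction.add_slash]
    | smul c x _ hx => rw [map_smul, map_smul, hx, map_smul, ModularForm.SL_smul_slash]
  have hne : (aD ι (-normD ι v) : ℂ) ≠ 0 := by exact_mod_cast aD_ne_zero v rfl
  have h1 := hequiv _ (hK.classIndicator_mem v)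
  have h2 : L (classIndicator v) = (aD ι (-normD ι v) : ℂ) • liftComponent ι N g v := by
    funext τ
    rw [hL, Pi.smul_apply, smul_eq_mul, ← sum_classIndicator v rfl, Finset.sum_mul]
    refine Finset.sum_congr rfl fun u _ => ?_
    simp only [classIndicator]
    split_ifs with h
    · rw [liftComponent_congr h]
    · rw [zero_mul, zero_mul]
  rw [h2, ModularForm.SL_smul_slash] at h1
  have h3 := congrFun h1 τ
  rw [hL, Pi.smul_apply, smul_eq_mul] at h3
  -- `hequiv` only controls the sum over a class. The desired right-hand side is itself a class
  -- function of `v`, by stability of class functions under `γ⁻¹` applied to the conjugated values,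
  -- so the sum is `a_D` times a single term.
  have hcl : (fun w => ∑ u, (starRingEnd ℂ) (hK.weil γ w u) * liftComponent ι N g u τ) ∈
      classFunctions ι := by
    have h4 := hK.weilAct_mem_classFunctions γ⁻¹
      (x := fun u => (starRingEnd ℂ) (liftComponent ι N g u τ))
      (fun u v huv => congrArg (starRingEnd ℂ) (liftComponent_congr huv τ))
    intro w w' hw
    have h5 := congrArg (starRingEnd ℂ) (h4 w w' hw)
    simp only [weilAct_apply, hK.weil_inv, Matrix.conjTranspose_apply, map_sum, map_mul,
      Complex.conj_conj] at h5
    exact h5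
  have h6 : ∑ u, hK.weilAct γ (classIndicator v) u * liftComponent ι N g u τ =
      (aD ι (-normD ι v) : ℂ) *
        ∑ u, (starRingEnd ℂ) (hK.weil γ v u) * liftComponent ι N g u τ := by
    simp only [weilAct_apply, Finset.sum_mul]
    rw [Finset.sum_comm, ← sum_classIndicator v rfl, Finset.sum_mul]
    refine Finset.sum_congr rfl fun w _ => ?_
    simp only [classIndicator]
    split_ifs with h
    · have := hcl w v h
      simp only [mul_one, one_mul] at this ⊢
      exact this
    · simp
  rw [h6] at h3
  exact (mul_left_cancel₀ hne h3).symm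

end Components

end IsImaginaryQuadratic

end

/-! ### Theta expansions and the theta decomposition -/

section


variable {K : Type*} [Field K] [NumberField K] {ι : K →+* ℂ}

theorem _root_.HasSum.mul_complex {α β : Type*} {f : α → ℂ} {g : β → ℂ} {a b : ℂ} (hf : HasSum f a)
    (hg : HasSum g b) : HasSum (fun p : α × β => f p.1 * g p.2) (a * b) :=
  hf.mul hg (summable_mul_of_summable_norm hf.summable.norm hg.summable.norm)

theorem slashJ_mul_theta (k : ℤ) (A : SL(2, ℤ)) (f : ℍ → ℂ) (θ : ℍ → ℂ → ℂ → ℂ) (τ : ℍ) (z w : ℂ) :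
    slashJ k 1 1 A (fun τ z w => f τ * θ τ z w) τ z w =
      (f ∣[k - 1] A) τ * slashJ 1 1 1 A θ τ z w := by
  rw [slash_eq]
  simp only [slashJ]
  have h : ((A 1 0 : ℂ) * τ + A 1 1) ^ (-k) = ((A 1 0 : ℂ) * τ + A 1 1) ^ (-(k - 1)) *
      ((A 1 0 : ℂ) * τ + A 1 1) ^ (-1 : ℤ) := by
    rw [← zpow_add₀ (SL_denom_ne_zero A τ)]
    congr 1; ring
  rw [h]
  ring

namespace IsImaginaryQuadratic

section Expansion

/-- Theta expansions of functions `∑_u H_u ϑ_u` where the `H_u` have `q`-expansions. -/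
theorem exists_hasFourierExpansion [Fintype (DiscGroup ι)] (hK : IsImaginaryQuadratic ι) {h ν : ℕ}
    (hh : 0 < h) (hν : 0 < ν) {b : DiscGroup ι → ℕ → ℂ} {H : DiscGroup ι → ℍ → ℂ}
    (hH : ∀ u (τ : ℍ), HasSum (fun ℓ : ℕ => b u ℓ * ef ((ℓ : ℂ) / h * τ)) (H u τ))
    (hb : ∀ (t : invDiff ι) (ℓ : ℕ), b (QuotientAddGroup.mk t) ℓ ≠ 0 →
      ∃ n : ℕ, (n : ℝ) / ν = ℓ / h + Complex.normSq (t : ℂ)) :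
    ∃ c, HasFourierExpansion ι 1 ν c (fun τ z w => ∑ u, H u τ * theta ι u τ z w) ∧
      ∀ (n : ℕ) (t : invDiff ι) (ℓ : ℕ), (n : ℝ) / ν = ℓ / h + Complex.normSq (t : ℂ) →
        c n t = b (QuotientAddGroup.mk t) ℓ := by
  classical
  have hh' : (0 : ℝ) < h := by exact_mod_cast hh
  have hν' : (0 : ℝ) < ν := by exact_mod_cast hν
  -- Given `t`, the exponent `n/ν` determines `ℓ` through `n/ν = ℓ/h + |t|²`; the coefficient is `0`
  -- if no such `ℓ` exists.
  let c : ℕ → invDiff ι → ℂ := fun n t =>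
    if hex : ∃ ℓ : ℕ, (n : ℝ) / ν = ℓ / h + Complex.normSq (t : ℂ) then
      b (QuotientAddGroup.mk t) hex.choose else 0
  have hc : ∀ (n : ℕ) (t : invDiff ι) (ℓ : ℕ), (n : ℝ) / ν = ℓ / h + Complex.normSq (t : ℂ) →
      c n t = b (QuotientAddGroup.mk t) ℓ := by
    intro n t ℓ he
    have hex : ∃ ℓ : ℕ, (n : ℝ) / ν = ℓ / h + Complex.normSq (t : ℂ) := ⟨ℓ, he⟩
    have h1 := he.symm.trans hex.choose_spec
    rw [add_left_inj, div_left_inj' hh'.ne'] at h1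
    have h2 : ℓ = hex.choose := by exact_mod_cast h1
    simp only [c]
    rw [dif_pos hex, ← h2]
  choose! nn hnn using hb
  refine ⟨c, ⟨fun n t hlt => ?_, fun τ z w => ?_⟩, hc⟩
  · refine dif_neg ?_
    rintro ⟨ℓ, he⟩
    rw [Nat.cast_one, mul_one, ← div_lt_iff₀' hν', he] at hlt
    have : (0 : ℝ) ≤ ℓ / h := by positivity
    linarith
  · have hsum : HasSum (fun p : ℕ × invDiff ι => b (QuotientAddGroup.mk p.2) p.1 *
        ef ((p.1 : ℂ) / h * τ) * thTerm (p.2 : ℂ) τ z w) (∑ u, H u τ * theta ι u τ z w) := by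
      obtain ⟨g, hg⟩ : ∃ g : DiscGroup ι → invDiff ι → ℂ, ∀ u a, g u a =
          if (QuotientAddGroup.mk a : DiscGroup ι) = u then thTerm (a : ℂ) τ z w else 0 :=
        ⟨_, fun _ _ => rfl⟩
      have h2 : ∀ u, HasSum (g u) (theta ι u τ z w) := by
        intro u
        have := hK.hasSum_mul_theta (Pi.single u 1) τ z w
        simp only [Pi.single_apply, ite_mul, one_mul, zero_mul, Finset.sum_ite_eq',
          Finset.mem_univ, if_true] at this
        exact this.congr_fun fun a => hg u a
      have h1 : ∀ u : DiscGroup ι, HasSum (fun p : ℕ × invDiff ι =>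
          (b u p.1 * ef ((p.1 : ℂ) / h * τ)) * g u p.2) (H u τ * theta ι u τ z w) :=
        fun u => (hH u τ).mul_complex (h2 u)
      refine (hasSum_sum (s := Finset.univ) fun u _ => h1 u).congr_fun fun p => ?_
      simp [hg]
    -- On the nonzero terms, `(ℓ, t) ↦ (n, t)` is a bijection of index sets.
    refine (hasSum_iff_hasSum_of_ne_zero_bij
      (fun p => ((nn p.1.2 p.1.1, p.1.2) : ℕ × invDiff ι)) ?_ ?_ ?_).mpr hsum
    · rintro ⟨⟨ℓ, t⟩, hp⟩ ⟨⟨ℓ', t'⟩, hp'⟩ he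
      simp only [Prod.mk.injEq] at he
      obtain ⟨he, rfl⟩ := he
      have h1 := hnn t ℓ (fun h0 => hp (by simp [h0]))
      have h2 := hnn t ℓ' (fun h0 => hp' (by simp [h0]))
      rw [he, h2, add_left_inj, div_left_inj' hh'.ne'] at h1
      have h3 : ℓ' = ℓ := by exact_mod_cast h1
      subst h3
      rfl
    · rintro ⟨n, t⟩ hp
      have hcn : c n t ≠ 0 := fun h0 => hp (by simp [h0])
      have hex : ∃ ℓ : ℕ, (n : ℝ) / ν = ℓ / h + Complex.normSq (t : ℂ) := by
        by_contra hno
        exact hcn (dif_neg hno)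
      obtain ⟨ℓ, hℓ⟩ := hex
      rw [hc n t ℓ hℓ] at hcn
      refine ⟨⟨(ℓ, t), ?_⟩, ?_⟩
      · exact mul_ne_zero (mul_ne_zero hcn (ef_ne_zero _)) (ef_ne_zero _)
      · have h1 := hnn t ℓ hcn
        rw [← hℓ, div_left_inj' hν'.ne'] at h1
        exact Prod.ext (by exact_mod_cast h1) rfl
    · rintro ⟨⟨ℓ, t⟩, hp⟩
      have h1 := hnn t ℓ (fun h0 => hp (by simp [h0]))
      dsimp only
      rw [hc _ t ℓ h1, mul_assoc (b _ _), thTerm, ← ef_add]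
      congr 2
      have h2 : ((nn t ℓ : ℕ) : ℂ) / ν =
          ℓ / h + (Complex.normSq (t : ℂ) : ℂ) := by
        have := congrArg (fun x : ℝ => (x : ℂ)) h1
        push_cast at this
        exact this
      rw [h2]
      ring

/-- A theta expansion whose components share the coefficients `β` is special. -/
theorem exists_special_expansion [Fintype (DiscGroup ι)] (hK : IsImaginaryQuadratic ι) {β : ℕ → ℂ}
    {f : DiscGroup ι → ℍ → ℂ}
    (hf : ∀ u (τ : ℍ), HasSum (fun ℓ : ℕ => if (ℓ : ℤ) ≡ -normD ι u [ZMOD absDisc K] then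
      β ℓ * ef ((ℓ : ℂ) * τ / absDisc K) else 0) (f u τ)) :
    ∃ c, HasFourierExpansion ι 1 1 c (fun τ z w => ∑ u, f u τ * theta ι u τ z w) ∧
      ∀ (n : ℕ) (t : invDiff ι) (ℓ : ℕ),
        (ℓ : ℝ) = absDisc K * (n - Complex.normSq (t : ℂ)) → c n t = β ℓ := by
  have hD := hK.fund.pos
  have hD' : (0 : ℝ) < absDisc K := by exact_mod_cast hD
  obtain ⟨c, hc, hcb⟩ := hK.exists_hasFourierExpansion hD one_pos
    (b := fun u ℓ => if (ℓ : ℤ) ≡ -normD ι u [ZMOD absDisc K] then β ℓ else 0)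
    (fun u τ => (hf u τ).congr_fun fun ℓ => by
      split_ifs
      · congr 2; ring
      · rw [zero_mul]) (fun t ℓ hne => by
      have hmod : (ℓ : ℤ) ≡ -normD ι (QuotientAddGroup.mk t) [ZMOD absDisc K] := by
        by_contra hno
        exact hne (if_neg hno)
      obtain ⟨m, hm⟩ := hK.normD_mk t
      obtain ⟨r, hr⟩ := Int.modEq_iff_dvd.mp hmod
      have h1 : (ℓ : ℝ) / absDisc K + Complex.normSq (t : ℂ) = ((m - r : ℤ) : ℝ) := by
        have h2 : (-normD ι (QuotientAddGroup.mk t) - ℓ : ℝ) = absDisc K * r := by exact_mod_cast hr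
        push_cast
        field_simp
        rw [hm]; linarith
      have h3 : 0 ≤ m - r := by
        have : (0 : ℝ) ≤ ((m - r : ℤ) : ℝ) := by
          rw [← h1]
          have := Complex.normSq_nonneg (t : ℂ)
          positivity
        exact_mod_cast this
      refine ⟨(m - r).toNat, ?_⟩
      rw [h1, Nat.cast_one, div_one]
      exact_mod_cast congrArg (fun x : ℤ => (x : ℝ)) (Int.toNat_of_nonneg h3))
  refine ⟨c, hc, fun n t ℓ hℓ => ?_⟩
  rw [hcb n t ℓ (by rw [hℓ]; field_simp; ring), if_pos]
  obtain ⟨m, hm⟩ := hK.normD_mk t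
  have h1 : (ℓ : ℝ) = ((absDisc K * (n - m) - normD ι (QuotientAddGroup.mk t) : ℤ) : ℝ) := by
    push_cast
    rw [hℓ]; linarith
  have h2 : (ℓ : ℤ) = absDisc K * (n - m) - normD ι (QuotientAddGroup.mk t) := by exact_mod_cast h1
  rw [h2]
  exact Int.modEq_iff_dvd.mpr ⟨-(n - m), by ring⟩

theorem exists_normSq (hK : IsImaginaryQuadratic ι) (t : invDiff ι) (n : ℕ)
    (h : Complex.normSq (t : ℂ) ≤ n) :
    ∃ ℓ : ℕ, (ℓ : ℝ) = absDisc K * (n - Complex.normSq (t : ℂ)) := by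
  obtain ⟨m, hm⟩ := hK.normD_mk t
  have h1 : (absDisc K : ℝ) * (n - Complex.normSq (t : ℂ)) =
      ((absDisc K * (n - m) - normD ι (QuotientAddGroup.mk t) : ℤ) : ℝ) := by
    push_cast
    linarith
  have h2 : (0 : ℤ) ≤ absDisc K * (n - m) - normD ι (QuotientAddGroup.mk t) := by
    have : (0 : ℝ) ≤ ((absDisc K * (n - m) - normD ι (QuotientAddGroup.mk t) : ℤ) : ℝ) := by
      rw [← h1]
      exact mul_nonneg (Nat.cast_nonneg _) (sub_nonneg.mpr h)
    exact_mod_cast this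
  refine ⟨(absDisc K * (n - m) - normD ι (QuotientAddGroup.mk t) : ℤ).toNat, ?_⟩
  rw [h1]
  exact_mod_cast congrArg (fun x : ℤ => (x : ℝ)) (Int.toNat_of_nonneg h2)

theorem isSpecial_sum_theta [Fintype (DiscGroup ι)] (hK : IsImaginaryQuadratic ι) {β : ℕ → ℂ}
    {f : DiscGroup ι → ℍ → ℂ}
    (hf : ∀ u (τ : ℍ), HasSum (fun ℓ : ℕ => if (ℓ : ℤ) ≡ -normD ι u [ZMOD absDisc K] then
      β ℓ * ef ((ℓ : ℂ) * τ / absDisc K) else 0) (f u τ)) :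
    IsSpecial ι (fun τ z w => ∑ u, f u τ * theta ι u τ z w) := by
  obtain ⟨c, hc, hcb⟩ := hK.exists_special_expansion hf
  refine ⟨c, hc, fun n n' t t' he => ?_⟩
  by_cases h : Complex.normSq (t : ℂ) ≤ n
  · obtain ⟨ℓ, hℓ⟩ := hK.exists_normSq t n h
    rw [hcb n t ℓ hℓ, hcb n' t' ℓ (by rw [hℓ, he])]
  · push Not at h
    rw [hc.1 n t (by simpa using h), hc.1 n' t' (by simp; linarith)]

/-- The coefficients and components of a function given by a theta expansion. -/
theorem thetaComponent_sum_theta [Fintype (DiscGroup ι)] (hK : IsImaginaryQuadratic ι) {β : ℕ → ℂ}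
    {f : DiscGroup ι → ℍ → ℂ}
    (hf : ∀ u (τ : ℍ), HasSum (fun ℓ : ℕ => if (ℓ : ℤ) ≡ -normD ι u [ZMOD absDisc K] then
      β ℓ * ef ((ℓ : ℂ) * τ / absDisc K) else 0) (f u τ)) (u : DiscGroup ι) :
    thetaComponent ι (fun τ z w => ∑ u, f u τ * theta ι u τ z w) u = f u := by
  obtain ⟨c, hc, hcb⟩ := hK.exists_special_expansion hf
  set φ : ℍ → ℂ → ℂ → ℂ := fun τ z w => ∑ u, f u τ * theta ι u τ z w with hφ
  -- Uniqueness of the expansion makes the choices in `jacobiCoeff` and `alphaStar` immaterial.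
  have hcoef : jacobiCoeff ι φ = c := by
    have hex : ∃ c, HasFourierExpansion ι 1 1 c φ := ⟨c, hc⟩
    rw [jacobiCoeff, dif_pos hex]
    exact hK.expansion_unique one_pos hex.choose_spec hc
  funext τ
  rw [← (hf u τ).tsum_eq, thetaComponent]
  refine tsum_congr fun ℓ => ?_
  by_cases hmod : (ℓ : ℤ) ≡ -normD ι u [ZMOD (absDisc K : ℤ)]
  · rw [if_pos hmod, if_pos hmod]
    congr 1
    obtain ⟨t, rfl⟩ := QuotientAddGroup.mk_surjective u
    have hex : ∃ p : ℕ × invDiff ι,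
        (ℓ : ℝ) = absDisc K * (p.1 - Complex.normSq (p.2 : ℂ)) := by
      obtain ⟨m, hm⟩ := hK.normD_mk t
      obtain ⟨r, hr⟩ := Int.modEq_iff_dvd.mp hmod
      have hD' : (0 : ℝ) < absDisc K := by exact_mod_cast hK.fund.pos
      have h2 : (-normD ι (QuotientAddGroup.mk t) - ℓ : ℝ) = absDisc K * r := by exact_mod_cast hr
      have h1 : (absDisc K : ℝ) * ((m - r : ℤ) : ℝ) =
          ℓ + absDisc K * Complex.normSq (t : ℂ) := by
        push_cast
        rw [hm]; linarith
      have h3 : 0 ≤ m - r := by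
        have h4 : (0 : ℝ) ≤ absDisc K * ((m - r : ℤ) : ℝ) := by
          rw [h1]
          have := Complex.normSq_nonneg (t : ℂ)
          positivity
        exact_mod_cast nonneg_of_mul_nonneg_right h4 hD'
      refine ⟨((m - r).toNat, t), ?_⟩
      have h5 : (((m - r).toNat : ℕ) : ℝ) = ((m - r : ℤ) : ℝ) := by
        exact_mod_cast congrArg (fun x : ℤ => (x : ℝ)) (Int.toNat_of_nonneg h3)
      dsimp only
      rw [h5, mul_sub, h1]; ring
    rw [alphaStar, dif_pos hex, hcoef]
    exact hcb _ _ ℓ hex.choose_spec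
  · rw [if_neg hmod, if_neg hmod]

/-- A special function with a Fourier expansion has a theta decomposition. -/
theorem theta_decomposition [Fintype (DiscGroup ι)] (hK : IsImaginaryQuadratic ι)
    {φ : ℍ → ℂ → ℂ → ℂ} (hφ : IsSpecial ι φ) :
    (∀ u (τ : ℍ), HasSum (fun ℓ : ℕ => if (ℓ : ℤ) ≡ -normD ι u [ZMOD absDisc K] then
      alphaStar ι φ ℓ * ef ((ℓ : ℂ) * τ / absDisc K) else 0) (thetaComponent ι φ u τ)) ∧
    φ = fun τ z w => ∑ u, thetaComponent ι φ u τ * theta ι u τ z w := by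
  classical
  have hD := hK.fund.pos
  have hD' : (0 : ℝ) < absDisc K := by exact_mod_cast hD
  have hDc : (absDisc K : ℂ) ≠ 0 := by exact_mod_cast hD.ne'
  obtain ⟨c, hc, hs⟩ := hφ
  have hcoef : jacobiCoeff ι φ = c := by
    have hex : ∃ c, HasFourierExpansion ι 1 1 c φ := ⟨c, hc⟩
    rw [jacobiCoeff, dif_pos hex]
    exact hK.expansion_unique one_pos hex.choose_spec hc
  -- Speciality says that the pair `(n, t)` chosen to define `α*(ℓ)` does not matter.
  have halpha : ∀ (n : ℕ) (t : invDiff ι) (ℓ : ℕ),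
      (ℓ : ℝ) = absDisc K * (n - Complex.normSq (t : ℂ)) → alphaStar ι φ ℓ = c n t := by
    intro n t ℓ hℓ
    have hex : ∃ p : ℕ × invDiff ι,
        (ℓ : ℝ) = absDisc K * (p.1 - Complex.normSq (p.2 : ℂ)) := ⟨(n, t), hℓ⟩
    rw [alphaStar, dif_pos hex, hcoef]
    have h1 := hℓ.symm.trans hex.choose_spec
    rw [mul_right_inj' hD'.ne'] at h1
    exact (hs _ _ _ _ h1).symm
  -- The coefficient of `𝖾[t̄z + tw]` in `φ` is `𝖾[|t|²τ]` times the component of the class of `t`;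
  -- the two series match under `ℓ = D(n - |t|²)`.
  have hsum : ∀ (t : invDiff ι) (τ : ℍ), HasSum (fun ℓ : ℕ =>
      if (ℓ : ℤ) ≡ -normD ι (QuotientAddGroup.mk t) [ZMOD absDisc K] then
      alphaStar ι φ ℓ * ef ((ℓ : ℂ) * τ / absDisc K) else 0)
      (ef (-((Complex.normSq (t : ℂ) : ℂ) * τ)) *
        ∑' n : ℕ, c n t * ef ((n : ℂ) / (1 : ℕ) * τ)) := by
    intro t τ
    have h1 := ((hasSum_fiber hc τ).1 t).hasSum.mul_left
      (ef (-((Complex.normSq (t : ℂ) : ℂ) * τ)))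
    obtain ⟨m, hm⟩ := hK.normD_mk t
    have hℓ : ∀ n : ℕ, c n t ≠ 0 →
        ∃ ℓ : ℕ, (ℓ : ℝ) = absDisc K * (n - Complex.normSq (t : ℂ)) := by
      intro n hn
      refine hK.exists_normSq t n ?_
      by_contra hlt
      push Not at hlt
      exact hn (hc.1 n t (by simpa using hlt))
    choose! L hL using hℓ
    refine (hasSum_iff_hasSum_of_ne_zero_bij (fun p => L p.1) ?_ ?_ ?_).mpr h1
    · rintro ⟨n, hn⟩ ⟨n', hn'⟩ he
      have e1 := hL n (fun h0 => hn (by simp [h0]))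
      have e2 := hL n' (fun h0 => hn' (by simp [h0]))
      dsimp only at he
      rw [he, e2, mul_right_inj' hD'.ne', sub_left_inj] at e1
      have : n' = n := by exact_mod_cast e1
      exact Subtype.ext this.symm
    · intro ℓ hne
      have hmod : (ℓ : ℤ) ≡ -normD ι (QuotientAddGroup.mk t) [ZMOD absDisc K] := by
        by_contra hno
        exact hne (if_neg hno)
      rw [Function.mem_support, if_pos hmod] at hne
      obtain ⟨r, hr⟩ := Int.modEq_iff_dvd.mp hmod
      have h2 : (-normD ι (QuotientAddGroup.mk t) - ℓ : ℝ) = absDisc K * r := by exact_mod_cast hr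
      have h1 : (absDisc K : ℝ) * ((m - r : ℤ) : ℝ) =
          ℓ + absDisc K * Complex.normSq (t : ℂ) := by
        push_cast
        rw [hm]; linarith
      have h3 : 0 ≤ m - r := by
        have h4 : (0 : ℝ) ≤ absDisc K * ((m - r : ℤ) : ℝ) := by
          rw [h1]
          have := Complex.normSq_nonneg (t : ℂ)
          positivity
        exact_mod_cast nonneg_of_mul_nonneg_right h4 hD'
      have h5 : (((m - r).toNat : ℕ) : ℝ) = ((m - r : ℤ) : ℝ) := by
        exact_mod_cast congrArg (fun x : ℤ => (x : ℝ)) (Int.toNat_of_nonneg h3)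
      have h6 : (ℓ : ℝ) = absDisc K * ((m - r).toNat - Complex.normSq (t : ℂ)) := by
        rw [h5, mul_sub, h1]; ring
      rw [halpha _ t ℓ h6] at hne
      have hcn := left_ne_zero_of_mul hne
      refine ⟨⟨(m - r).toNat, mul_ne_zero (ef_ne_zero _) (mul_ne_zero hcn (ef_ne_zero _))⟩, ?_⟩
      have e1 := hL (m - r).toNat hcn
      rw [← h6] at e1
      exact_mod_cast e1
    · rintro ⟨n, hn⟩
      have e1 := hL n (fun h0 => hn (by simp [h0]))
      dsimp only
      generalize L n = ℓ at e1 ⊢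
      have h1 : (ℓ : ℝ) = ((absDisc K * (n - m) - normD ι (QuotientAddGroup.mk t) : ℤ) : ℝ) := by
        push_cast
        rw [e1]; linarith
      have h2 : (ℓ : ℤ) = absDisc K * (n - m) - normD ι (QuotientAddGroup.mk t) := by
        exact_mod_cast h1
      rw [if_pos (by rw [h2]; exact Int.modEq_iff_dvd.mpr ⟨-(n - m), by ring⟩), halpha n t ℓ e1,
        mul_left_comm, ← ef_add]
      congr 2
      have h3 : (ℓ : ℂ) = absDisc K * (n - (Complex.normSq (t : ℂ) : ℂ)) := by
        have := congrArg (fun x : ℝ => (x : ℂ)) e1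
        push_cast at this
        exact this
      rw [h3]
      field_simp
      push_cast
      ring
  have hcomp : ∀ (t : invDiff ι) (τ : ℍ), thetaComponent ι φ (QuotientAddGroup.mk t) τ =
      ef (-((Complex.normSq (t : ℂ) : ℂ) * τ)) *
        ∑' n : ℕ, c n t * ef ((n : ℂ) / (1 : ℕ) * τ) := by
    intro t τ
    rw [← (hsum t τ).tsum_eq, thetaComponent]
  refine ⟨fun u τ => ?_, ?_⟩
  · obtain ⟨t, rfl⟩ := QuotientAddGroup.mk_surjective u
    rw [hcomp]
    exact hsum t τ
  · funext τ z w
    refine ((hasSum_fiber hc τ).2 z w).unique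
      ((hK.hasSum_mul_theta (fun u => thetaComponent ι φ u τ) τ z w).congr_fun fun t => ?_)
    rw [hcomp, thTerm, mul_right_comm, ← ef_add, mul_comm]
    congr 2
    ring

end Expansion

end IsImaginaryQuadratic

end

/-! ### Invariance of theta expansions under lattice shifts, units and `SL₂(ℤ)` -/

section


variable {K : Type*} [Field K] [NumberField K] {ι : K →+* ℂ}

namespace IsImaginaryQuadratic

theorem slashH_sum_theta [Fintype (DiscGroup ι)] (hK : IsImaginaryQuadratic ι)
    (f : DiscGroup ι → ℍ → ℂ) {lam μ : ℂ} (hlam : lam ∈ intLattice ι) (hμ : μ ∈ intLattice ι) :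
    slashH 1 lam μ (fun τ z w => ∑ u, f u τ * theta ι u τ z w) =
      fun τ z w => ∑ u, f u τ * theta ι u τ z w := by
  funext τ z w
  let l : invDiff ι := ⟨lam, hK.intLattice_le hlam⟩
  have h1 := (hK.hasSum_mul_theta (fun u => f u τ) τ (z + lam * τ + μ)
    (w + (starRingEnd ℂ) lam * τ + (starRingEnd ℂ) μ)).mul_left
    (ef ((1 : ℕ) * ((Complex.normSq lam : ℂ) * τ + (starRingEnd ℂ) lam * z + lam * w)))
  -- Shifting the summation index by `lam ∈ 𝔬` preserves cosets and absorbs the automorphy factor;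
  -- `μ` contributes only integral traces.
  have h2 := (Equiv.addRight l).hasSum_iff.mpr (hK.hasSum_mul_theta (fun u => f u τ) τ z w)
  refine h1.unique (h2.congr_fun fun a => ?_)
  have hmk : (QuotientAddGroup.mk (a + l) : DiscGroup ι) = QuotientAddGroup.mk a := by
    rw [discGroup_mk_eq_iff]
    have : (a : ℂ) - ((a + l : invDiff ι) : ℂ) = -lam := by
      push_cast
      show (a : ℂ) - ((a : ℂ) + lam) = _
      ring
    rw [this]
    exact neg_mem hlam
  obtain ⟨n, hn⟩ := hK.trace_mem a.2 hμ
  have e1 : ((Equiv.addRight l a : invDiff ι) : ℂ) = lam + a := by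
    rw [add_comm]; rfl
  show _ * (f (QuotientAddGroup.mk a) τ * _) = f (QuotientAddGroup.mk (a + l)) τ * _
  rw [hmk, mul_left_comm, e1, thTerm_add]
  congr 1
  rw [thTerm, thTerm, thTerm, ← ef_add, ← ef_add]
  refine ef_congr ⟨n, ?_⟩
  rw [← hn]
  push_cast
  ring

/-- The action of a unit leaves a theta expansion invariant if its components depend only on
the norm of the class. -/
theorem sum_theta_unit [Fintype (DiscGroup ι)] (hK : IsImaginaryQuadratic ι)
    {f : DiscGroup ι → ℍ → ℂ}
    (hf : ∀ u v, normD ι u ≡ normD ι v [ZMOD absDisc K] → f u = f v)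
    (ε : (NumberField.RingOfIntegers K)ˣ) (τ : ℍ) (z w : ℂ) :
    ∑ u, f u τ * theta ι u τ (ι (ε : NumberField.RingOfIntegers K) * z)
      ((starRingEnd ℂ) (ι (ε : NumberField.RingOfIntegers K)) * w) =
      ∑ u, f u τ * theta ι u τ z w := by
  set e : ℂ := ι (ε : NumberField.RingOfIntegers K) with he
  set e' : ℂ := ι ((ε⁻¹ : (NumberField.RingOfIntegers K)ˣ) : NumberField.RingOfIntegers K) with he'
  have hee' : e * e' = 1 := by
    rw [he, he', ← map_mul, ← map_mul, Units.mul_inv, map_one, map_one]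
  have hmem : e ∈ intLattice ι := ⟨ε, rfl⟩
  have hmem' : e' ∈ intLattice ι := ⟨_, rfl⟩
  -- The norms of `ε` and `ε⁻¹` are nonnegative integers with product `1`, so multiplication by `ε`
  -- permutes `𝔡` preserving `|·|²`.
  have hnorm : Complex.normSq e = 1 := by
    obtain ⟨n, hn⟩ := hK.normSq_intLattice hmem
    obtain ⟨n', hn'⟩ := hK.normSq_intLattice hmem'
    have hn : Complex.normSq e = n := by exact_mod_cast hn
    have hn' : Complex.normSq e' = n' := by exact_mod_cast hn'
    have h1 : Complex.normSq e * Complex.normSq e' = 1 := by rw [← map_mul, hee', map_one]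
    have h2 : n * n' = 1 := by
      rw [hn, hn'] at h1
      exact_mod_cast h1
    have h3 : 0 ≤ n := by
      have := Complex.normSq_nonneg e
      rw [hn] at this
      exact_mod_cast this
    have h4 : n = 1 := by
      rcases Int.eq_one_or_neg_one_of_mul_eq_one h2 with h | h
      · exact h
      · omega
    rw [hn, h4, Int.cast_one]
  have hconj : (starRingEnd ℂ) e * e = 1 := by
    rw [mul_comm, Complex.mul_conj, hnorm, Complex.ofReal_one]
  have hstab : ∀ {x y : ℂ}, x ∈ intLattice ι → y ∈ invDiff ι → x * y ∈ invDiff ι := by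
    rintro _ _ ⟨x, rfl⟩ ⟨_, ⟨y, rfl⟩, rfl⟩
    refine ⟨_, ⟨x * y, rfl⟩, ?_⟩
    simp only [RingHom.coe_comp, Function.comp_apply, map_mul,
      AddMonoidHom.coe_mulLeft]
    ring
  let E : invDiff ι ≃ invDiff ι :=
    { toFun := fun a => ⟨e * a, hstab hmem a.2⟩
      invFun := fun a => ⟨e' * a, hstab hmem' a.2⟩
      left_inv := fun a => Subtype.ext (by
        show e' * (e * a) = a
        rw [← mul_assoc, mul_comm e', hee', one_mul])
      right_inv := fun a => Subtype.ext (by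
        show e * (e' * a) = a
        rw [← mul_assoc, hee', one_mul]) }
  refine HasSum.unique (E.hasSum_iff.mpr
    (hK.hasSum_mul_theta (fun u => f u τ) τ (e * z) ((starRingEnd ℂ) e * w)))
    ((hK.hasSum_mul_theta (fun u => f u τ) τ z w).congr_fun fun a => ?_)
  have e1 : ((E a : invDiff ι) : ℂ) = e * a := rfl
  have h5 : Complex.normSq ((E a : invDiff ι) : ℂ) = Complex.normSq (a : ℂ) := by
    rw [e1, map_mul, hnorm, one_mul]
  show f (QuotientAddGroup.mk (E a)) τ * _ = _
  rw [hf _ _ (hK.normD_mk_modEq_of_normSq_eq h5)]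
  congr 1
  rw [thTerm, thTerm, h5, e1, map_mul]
  congr 1
  linear_combination ((starRingEnd ℂ) (a : ℂ) * z + a * w) * hconj

end IsImaginaryQuadratic

theorem slashJ_unit (k : ℤ) (m : ℕ) (ε : ℂ) (A : SL(2, ℤ)) (φ : ℍ → ℂ → ℂ → ℂ) :
    slashJ k m ε A φ = slashJ k m 1 A (fun τ z w => φ τ (ε * z) ((starRingEnd ℂ) ε * w)) := by
  funext τ z w
  simp only [slashJ, one_mul, map_one, mul_div_assoc]

namespace IsImaginaryQuadratic

variable [Fintype (DiscGroup ι)] [DecidableEq (DiscGroup ι)]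

theorem slashJ_sum_theta (hK : IsImaginaryQuadratic ι) (k : ℤ) (A : SL(2, ℤ))
    (f : DiscGroup ι → ℍ → ℂ) :
    slashJ k 1 1 A (fun τ z w => ∑ u, f u τ * theta ι u τ z w) =
      fun τ z w => ∑ v, (∑ u, hK.weil A u v * (f u ∣[k - 1] A) τ) * theta ι v τ z w := by
  funext τ z w
  have h1 := slashJ_sum Finset.univ k 1 1 A (fun _ => (1 : ℂ))
    (fun u τ z w => f u τ * theta ι u τ z w) τ z w
  simp only [one_mul] at h1
  rw [h1]
  have h2 : ∀ u, slashJ k 1 1 A (fun τ z w => f u τ * theta ι u τ z w) τ z w =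
      ∑ v, hK.weil A u v * (f u ∣[k - 1] A) τ * theta ι v τ z w := by
    intro u
    rw [slashJ_mul_theta, hK.isWeil_weil A u τ z w, Finset.mul_sum]
    exact Finset.sum_congr rfl fun v _ => by ring
  simp only [h2, Finset.sum_mul]
  exact Finset.sum_comm

/-- A theta expansion is invariant under `A` if and only if its components transform under the
dual Weil representation. -/
theorem slashJ_sum_theta_eq_iff (hK : IsImaginaryQuadratic ι) (k : ℤ) (A : SL(2, ℤ))
    (f : DiscGroup ι → ℍ → ℂ) :
    slashJ k 1 1 A (fun τ z w => ∑ u, f u τ * theta ι u τ z w) =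
      (fun τ z w => ∑ u, f u τ * theta ι u τ z w) ↔
    ∀ v τ, (f v ∣[k - 1] A) τ = ∑ u, (starRingEnd ℂ) (hK.weil A v u) * f u τ := by
  rw [hK.slashJ_sum_theta]
  constructor
  · intro h v τ
    have h1 : ∀ v, ∑ u, hK.weil A u v * (f u ∣[k - 1] A) τ = f v τ := by
      intro v
      have := hK.theta_linearIndependent
        (c := fun v => ∑ u, hK.weil A u v * (f u ∣[k - 1] A) τ - f v τ) (τ := τ) (fun z w => by
          simp only [sub_mul, Finset.sum_sub_distrib]
          exact sub_eq_zero.mpr (congrFun (congrFun (congrFun h τ) z) w)) v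
      exact sub_eq_zero.mp this
    simp only [← h1, Finset.mul_sum]
    rw [Finset.sum_comm]
    -- Unitarity of `ρ(A)` inverts the relation between `f_u|A` and the components of the slashed
    -- expansion.
    have h2 : ∀ u, ∑ v', (starRingEnd ℂ) (hK.weil A v v') * (hK.weil A u v' * (f u ∣[k - 1] A) τ) =
        if u = v then (f u ∣[k - 1] A) τ else 0 := by
      intro u
      have h3 := congrFun (congrFun (hK.weil_mul_conjTranspose A) u) v
      rw [Matrix.mul_apply, Matrix.one_apply] at h3
      simp only [Matrix.conjTranspose_apply, ← starRingEnd_apply] at h3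
      rw [← one_mul ((f u ∣[k - 1] A) τ), ← zero_mul ((f u ∣[k - 1] A) τ), ← ite_mul, ← h3,
        Finset.sum_mul]
      exact Finset.sum_congr rfl fun v' _ => by ring
    simp only [h2, Finset.sum_ite_eq', Finset.mem_univ, if_true]
  · intro h
    funext τ z w
    refine Finset.sum_congr rfl fun v _ => ?_
    congr 1
    simp only [h, Finset.mul_sum]
    rw [Finset.sum_comm]
    have h2 : ∀ u, ∑ v', hK.weil A v' v * ((starRingEnd ℂ) (hK.weil A v' u) * f u τ) =
        if u = v then f u τ else 0 := by
      intro u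
      have h3 := congrFun (congrFun (hK.conjTranspose_mul_weil A) u) v
      rw [Matrix.mul_apply, Matrix.one_apply] at h3
      simp only [Matrix.conjTranspose_apply, ← starRingEnd_apply] at h3
      rw [← one_mul (f u τ), ← zero_mul (f u τ), ← ite_mul, ← h3, Finset.sum_mul]
      exact Finset.sum_congr rfl fun v' _ => by ring
    simp only [h2, Finset.sum_ite_eq', Finset.mem_univ, if_true]

end IsImaginaryQuadratic

end

/-! ### Behaviour at the cusps, and the lift as a special Jacobi form -/

section


variable {K : Type*} [Field K] [NumberField K] {ι : K →+* ℂ}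

theorem exists_hasSum_of_periodic {f : ℍ → ℂ} {h : ℕ} (hh : 0 < h)
    (hper : ∀ τ, f (ModularGroup.T ^ (h : ℤ) • τ) = f τ) (hhol : MDiff f)
    (hbdd : IsBoundedAtImInfty f) :
    ∃ b : ℕ → ℂ, ∀ τ : ℍ, HasSum (fun ℓ : ℕ => b ℓ * ef ((ℓ : ℂ) / h * τ)) (f τ) := by
  have hh' : (0 : ℝ) < h := by exact_mod_cast hh
  have hp : Function.Periodic (f ∘ ofComplex) (h : ℝ) := by
    intro w
    by_cases! hw : 0 < im w
    · have h1 : 0 < im (w + (h : ℝ)) := by simp [hw]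
      have h2 : (ofComplex (w + (h : ℝ)) : ℍ) = ModularGroup.T ^ (h : ℤ) • (ofComplex w : ℍ) := by
        ext1
        rw [coe_T_smul, coe_ofComplex h1, coe_ofComplex hw]
        push_cast
        rfl
      rw [Function.comp_apply, h2, hper, Function.comp_apply]
    · have : im (w + (h : ℝ)) ≤ 0 := by simpa using hw
      simp only [Function.comp_apply, ofComplex_apply_of_im_nonpos this,
        ofComplex_apply_of_im_nonpos hw]
  refine ⟨fun ℓ => (UpperHalfPlane.qExpansion h f).coeff ℓ, fun τ => ?_⟩
  refine (UpperHalfPlane.hasSum_qExpansion hh' hp hhol hbdd τ).congr_fun fun ℓ => ?_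
  rw [qParam_pow_eq, smul_eq_mul]

theorem mapGL_apply (B : SL(2, ℤ)) (i j : Fin 2) :
    (Matrix.SpecialLinearGroup.mapGL ℝ B) i j = (B i j : ℝ) := by
  simp [Matrix.SpecialLinearGroup.mapGL]

namespace IsImaginaryQuadratic

open ModularGroup

variable {N : ℕ} {κ : ℤ} {g : MFGamma1 (absDisc K * N) κ}

theorem mdifferentiable_rescaled (hK : IsImaginaryQuadratic ι) :
    MDiff (rescaled (absDisc K) g) := by
  rw [rescaled_eq_slash hK.fund.pos κ]
  exact (g.holo'.slash κ _).const_smul _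

/-- The matrix `(1 0; 0 D)B` maps `∞` to a rational cusp, where `g` is bounded. -/
theorem isBoundedAtImInfty_rescaled_slash (hK : IsImaginaryQuadratic ι) [NeZero (absDisc K * N)]
    (B : SL(2, ℤ)) : IsBoundedAtImInfty (rescaled (absDisc K) g ∣[κ] B) := by
  have hD := hK.fund.pos
  have hcusp : IsCusp ((lowerDiag hD * Matrix.SpecialLinearGroup.mapGL ℝ B) •
      (OnePoint.infty : OnePoint ℝ)) ((Gamma1 (absDisc K * N)).map
        (Matrix.SpecialLinearGroup.mapGL ℝ)) := by
    rw [Subgroup.IsArithmetic.isCusp_iff_isCusp_SL2Z]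
    refine isCusp_smul_infty _ (a := B 0 0) (c := absDisc K * B 1 0) ?_ ?_
    · rw [Units.val_mul, Matrix.mul_apply, Fin.sum_univ_two, mapGL_apply, mapGL_apply]
      simp [lowerDiag]
    · rw [Units.val_mul, Matrix.mul_apply, Fin.sum_univ_two, mapGL_apply, mapGL_apply]
      simp [lowerDiag]
  have h1 := g.bdd_at_cusps' hcusp _ rfl
  rw [SlashAction.slash_mul] at h1
  rw [rescaled_eq_slash hD κ, ModularForm.SL_smul_slash]
  exact h1.const_smul_left _

/-- `BT^{DN}B⁻¹` is congruent to the identity modulo `DN`, and `χ` is trivial there. -/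
theorem rescaled_slash_T (hK : IsImaginaryQuadratic ι) [NeZero (absDisc K * N)]
    (hg : g ∈ plusForms ι κ N) (B : SL(2, ℤ)) (τ : ℍ) :
    (rescaled (absDisc K) g ∣[κ] B) (T ^ ((absDisc K * N : ℕ) : ℤ) • τ) =
      (rescaled (absDisc K) g ∣[κ] B) τ := by
  obtain ⟨h, hh⟩ : ∃ h : ℤ, h = ((absDisc K * N : ℕ) : ℤ) := ⟨_, rfl⟩
  obtain ⟨δ, hδ⟩ : ∃ δ : SL(2, ℤ), δ = B * T ^ h * B⁻¹ := ⟨_, rfl⟩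
  have hBT : B * T ^ h = δ * B := by rw [hδ, inv_mul_cancel_right]
  have e : ∀ i j, ∃ x : ℤ, δ i j = (if i = j then 1 else 0) + absDisc K * N * x := by
    intro i j
    refine ⟨B i 0 * B⁻¹ 1 j, ?_⟩
    have h1 : (B * B⁻¹ : SL(2, ℤ)) i j = if i = j then 1 else 0 := by
      rw [mul_inv_cancel, Matrix.SpecialLinearGroup.coe_one, Matrix.one_apply]
    rw [SL_mul_apply] at h1
    rw [hδ, SL_mul_apply, SL_mul_apply, SL_mul_apply, T_zpow_00, T_zpow_01, T_zpow_10, T_zpow_11,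
      ← h1, hh]
    push_cast
    ring
  have h10 : (N : ℤ) ∣ δ 1 0 := by
    obtain ⟨x, hx⟩ := e 1 0
    exact ⟨absDisc K * x, by rw [hx, if_neg (by decide)]; ring⟩
  have h01 : (absDisc K : ℤ) ∣ δ 0 1 := by
    obtain ⟨x, hx⟩ := e 0 1
    exact ⟨N * x, by rw [hx, if_neg (by decide)]; ring⟩
  have h11 : δ 1 1 ≡ 1 [ZMOD absDisc K] := by
    obtain ⟨x, hx⟩ := e 1 1
    exact (Int.modEq_iff_dvd.mpr ⟨N * x, by rw [hx, if_pos rfl]; ring⟩).symm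
  have h2 := (hK.isPlusVector_rescaled hg).chi_eq δ h10 h01
  rw [hK.fund.chi_congr h11, chi_one, Int.cast_one, one_smul, slashAct_apply] at h2
  rw [← hh, ← slash_T κ h (rescaled (absDisc K) g ∣[κ] B), ← SlashAction.slash_mul, hBT,
    SlashAction.slash_mul, h2]

theorem exists_hasSum_rescaled_slash (hK : IsImaginaryQuadratic ι) [NeZero (absDisc K * N)]
    (hg : g ∈ plusForms ι κ N) (B : SL(2, ℤ)) :
    ∃ b : ℕ → ℂ, ∀ τ : ℍ, HasSum (fun ℓ : ℕ => b ℓ * ef ((ℓ : ℂ) / (absDisc K * N : ℕ) * τ))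
      ((rescaled (absDisc K) g ∣[κ] B) τ) :=
  exists_hasSum_of_periodic (Nat.pos_of_ne_zero (NeZero.ne _)) (hK.rescaled_slash_T hg B)
    (hK.mdifferentiable_rescaled.slash κ _) (hK.isBoundedAtImInfty_rescaled_slash B)

/-- The components of the lift are combinations of translates of `g(τ/D)`. -/
theorem exists_liftComponent_eq_sum (hK : IsImaginaryQuadratic ι) [NeZero (absDisc K * N)]
    (hg : g ∈ plusForms ι κ N) (v : DiscGroup ι) : ∃ c : ℕ → ℂ, liftComponent ι N g v =
      ∑ j ∈ Finset.range (absDisc K), c j • (rescaled (absDisc K) g ∣[κ] (T ^ (j : ℤ))) := by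
  classical
  have := hK.finite_discGroup
  have : Fintype (DiscGroup ι) := Fintype.ofFinite _
  have hne : (aD ι (-normD ι v) : ℂ) ≠ 0 := by exact_mod_cast aD_ne_zero v rfl
  refine ⟨fun j => (aD ι (-normD ι v) : ℂ)⁻¹ * (absDisc K : ℂ)⁻¹ *
    ef ((j : ℂ) * normD ι v / absDisc K) *
    ((chi (absDisc K) N : ℂ) * (-Complex.I * (Real.sqrt (absDisc K) : ℂ))), ?_⟩
  funext τ
  rw [Finset.sum_apply]
  have h1 : (aD ι (-normD ι v) : ℂ) * liftComponent ι N g v τ =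
      ∑ u, classIndicator v u * liftComponent ι N g u τ := by
    rw [← sum_classIndicator v rfl, Finset.sum_mul]
    refine Finset.sum_congr rfl fun u _ => ?_
    simp only [classIndicator]
    split_ifs with h
    · rw [liftComponent_congr h]
    · rw [zero_mul, zero_mul]
  have h2 : ∀ j : ℕ, (((aD ι (-normD ι v) : ℂ)⁻¹ * (absDisc K : ℂ)⁻¹ *
      ef ((j : ℂ) * normD ι v / absDisc K) *
      ((chi (absDisc K) N : ℂ) * (-Complex.I * (Real.sqrt (absDisc K) : ℂ)))) •
      (rescaled (absDisc K) g ∣[κ] (T ^ (j : ℤ)))) τ = (aD ι (-normD ι v) : ℂ)⁻¹ *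
      ∑ u, ((absDisc K : ℂ)⁻¹ * (ef ((j : ℂ) * normD ι v / absDisc K) *
        hK.weilAct (T ^ (j : ℤ)) 1 u)) * liftComponent ι N g u τ := by
    intro j
    have h3 := hK.sum_liftComponent hg j τ
    rw [Pi.smul_apply, smul_eq_mul, slash_T, mul_assoc _ _ (rescaled _ _ _), ← h3, Finset.mul_sum,
      Finset.mul_sum]
    refine Finset.sum_congr rfl fun u _ => ?_
    rw [hK.weilAct_T_one]
    ring
  simp only [h2]
  rw [← Finset.mul_sum, Finset.sum_comm, eq_inv_mul_iff_mul_eq₀ hne, h1]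
  refine Finset.sum_congr rfl fun u _ => ?_
  rw [hK.classIndicator_eq_sum, ← Finset.sum_mul, Pi.smul_apply, Finset.sum_apply, smul_eq_mul,
    Finset.mul_sum]
  rfl

theorem mdifferentiable_liftComponent (hK : IsImaginaryQuadratic ι) [NeZero (absDisc K * N)]
    (hg : g ∈ plusForms ι κ N) (v : DiscGroup ι) : MDiff (liftComponent ι N g v) := by
  obtain ⟨c, hc⟩ := hK.exists_liftComponent_eq_sum hg v
  rw [hc]
  exact MDifferentiable.sum fun j _ =>
    (hK.mdifferentiable_rescaled.slash κ _).const_smul _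

theorem exists_hasSum_liftComponent_slash (hK : IsImaginaryQuadratic ι) [NeZero (absDisc K * N)]
    (hg : g ∈ plusForms ι κ N) (A : SL(2, ℤ)) (v : DiscGroup ι) :
    ∃ b : ℕ → ℂ, ∀ τ : ℍ, HasSum (fun ℓ : ℕ => b ℓ * ef ((ℓ : ℂ) / (absDisc K * N : ℕ) * τ))
      ((liftComponent ι N g v ∣[κ] A) τ) := by
  obtain ⟨c, hc⟩ := hK.exists_liftComponent_eq_sum hg v
  choose b hb using fun j : ℕ => hK.exists_hasSum_rescaled_slash hg (T ^ (j : ℤ) * A)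
  refine ⟨fun ℓ => ∑ j ∈ Finset.range (absDisc K), c j * b j ℓ, fun τ => ?_⟩
  have h1 : (liftComponent ι N g v ∣[κ] A) τ = ∑ j ∈ Finset.range (absDisc K),
      c j * (rescaled (absDisc K) g ∣[κ] (T ^ (j : ℤ) * A)) τ := by
    rw [hc, slash_eq, Finset.sum_apply, Finset.mul_sum]
    refine Finset.sum_congr rfl fun j _ => ?_
    rw [SlashAction.slash_mul, slash_eq κ A, Pi.smul_apply, smul_eq_mul]
    ring
  rw [h1]
  refine (hasSum_sum fun j _ => (hb j τ).mul_left (c j)).congr_fun fun ℓ => ?_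
  rw [Finset.sum_mul]
  exact Finset.sum_congr rfl fun j _ => by ring

theorem exists_mul_normSq (hK : IsImaginaryQuadratic ι) (t : invDiff ι) :
    ∃ r : ℕ, (absDisc K : ℝ) * Complex.normSq (t : ℂ) = r := by
  obtain ⟨m, hm⟩ := hK.normD_mk t
  have h1 : (absDisc K : ℝ) * Complex.normSq (t : ℂ) =
      ((normD ι (QuotientAddGroup.mk t) + absDisc K * m : ℤ) : ℝ) := by
    rw [hm]; push_cast; rfl
  have h2 : 0 ≤ normD ι (QuotientAddGroup.mk t) + absDisc K * m := by
    have h3 : (0 : ℝ) ≤ (absDisc K : ℝ) * Complex.normSq (t : ℂ) :=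
      mul_nonneg (Nat.cast_nonneg _) (Complex.normSq_nonneg _)
    rw [h1] at h3
    exact_mod_cast h3
  refine ⟨(normD ι (QuotientAddGroup.mk t) + absDisc K * m).toNat, ?_⟩
  rw [h1]
  exact_mod_cast congrArg (fun x : ℤ => (x : ℝ)) (Int.toNat_of_nonneg h2).symm

theorem phiLift_eq [Fintype (DiscGroup ι)] : phiLift ι N g =
    fun τ z w => ∑ u, liftComponent ι N g u τ * theta ι u τ z w := by
  funext τ z w
  exact finsum_eq_sum_of_fintype _

theorem phiLift_mem {k : ℕ} {g : MFGamma1 (absDisc K * N) ((k : ℤ) - 1)}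
    (hK : IsImaginaryQuadratic ι) [NeZero (absDisc K * N)] (hN : Nat.Coprime (absDisc K) N)
    (hg : g ∈ plusForms ι ((k : ℤ) - 1) N) : phiLift ι N g ∈ specialJacobiForms ι k N := by
  classical
  have := hK.finite_discGroup
  have : Fintype (DiscGroup ι) := Fintype.ofFinite _
  have hD := hK.fund.pos
  have hDN : 0 < absDisc K * N := Nat.pos_of_ne_zero (NeZero.ne _)
  rw [phiLift_eq]
  have hspecial := hK.isSpecial_sum_theta (hK.hasSum_liftComponent (g := g))
  refine ⟨⟨?_, ?_, ?_, ?_⟩, hspecial⟩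
  · intro x hx
    refine DifferentiableAt.differentiableWithinAt ?_
    refine DifferentiableAt.fun_sum fun u _ => ?_
    refine DifferentiableAt.mul ?_ (hK.differentiableAt_theta u hx)
    have h1 := UpperHalfPlane.mdifferentiable_iff.mp (hK.mdifferentiable_liftComponent hg u)
    exact (h1.differentiableAt (isOpen_upperHalfPlaneSet.mem_nhds hx)).comp x differentiableAt_fst
  · intro ε A hA
    rw [slashJ_unit]
    have h1 : (fun (τ : ℍ) (z w : ℂ) => ∑ u, liftComponent ι N g u τ *
        theta ι u τ (ι (ε : NumberField.RingOfIntegers K) * z)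
          ((starRingEnd ℂ) (ι (ε : NumberField.RingOfIntegers K)) * w)) =
        fun τ z w => ∑ u, liftComponent ι N g u τ * theta ι u τ z w := by
      funext τ z w
      exact hK.sum_theta_unit (fun u v h => funext fun τ => liftComponent_congr h τ) ε τ z w
    rw [h1, hK.slashJ_sum_theta_eq_iff]
    intro v τ
    refine hK.liftComponent_slash hN hg ?_ v τ
    rwa [Gamma0_mem, ZMod.intCast_zmod_eq_zero_iff_dvd] at hA
  · intro lam hlam μ hμ
    exact hK.slashH_sum_theta _ hlam hμ
  · intro A
    -- The identity must have `ν = 1`, which is the special expansion. Every other matrix is treated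
    -- uniformly with `ν = DN`.
    by_cases hA : A = 1
    · obtain ⟨c, hc, -⟩ := hspecial
      refine ⟨1, one_pos, fun _ => rfl, c, ?_⟩
      rw [hA, slashJ_one]
      exact hc
    · refine ⟨absDisc K * N, hDN, fun h => absurd h hA, ?_⟩
      choose b hb using hK.exists_hasSum_liftComponent_slash hg A
      obtain ⟨c, hc, -⟩ := hK.exists_hasFourierExpansion hDN hDN
        (b := fun v ℓ => ∑ u, hK.weil A u v * b u ℓ)
        (H := fun v τ => ∑ u, hK.weil A u v * (liftComponent ι N g u ∣[(k : ℤ) - 1] A) τ)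
        (fun v τ => by
          refine (hasSum_sum fun u _ => (hb u τ).mul_left (hK.weil A u v)).congr_fun fun ℓ => ?_
          rw [Finset.sum_mul]
          exact Finset.sum_congr rfl fun j _ => by ring)
        -- With `r = D|t|²` the exponent is `ℓ/(DN) + |t|² = (ℓ + Nr)/(DN)`.
        (fun t ℓ _ => by
          obtain ⟨r, hr⟩ := hK.exists_mul_normSq t
          refine ⟨ℓ + N * r, ?_⟩
          have hD' : (absDisc K : ℝ) ≠ 0 := by exact_mod_cast hD.ne'
          have hN' : (N : ℝ) ≠ 0 := by exact_mod_cast (Nat.pos_of_mul_pos_left hDN).ne'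
          push_cast
          rw [← hr]
          field_simp)
      refine ⟨c, ?_⟩
      rw [hK.slashJ_sum_theta]
      exact hc

end IsImaginaryQuadratic

end

/-! ### Series with nonnegative exponents, and the image of a lift under `ι` -/

section


section Series

variable {α : Type*} {c : α → ℂ} {e : α → ℝ} {f : ℍ → ℂ}

theorem norm_mul_ef_le {c : ℂ} {e : ℝ} (he : c ≠ 0 → 0 ≤ e) {y : ℝ} {τ : ℂ} (hy : y ≤ τ.im) :
    ‖c * ef (e * τ)‖ ≤ ‖c * ef (e * (y * Complex.I))‖ := by
  by_cases hc : c = 0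
  · simp [hc]
  rw [norm_mul, norm_mul, norm_ef, norm_ef]
  refine mul_le_mul_of_nonneg_left (Real.exp_le_exp.mpr ?_) (norm_nonneg _)
  have h1 : ((e : ℂ) * τ).im = e * τ.im := by simp
  have h2 : ((e : ℂ) * (y * Complex.I)).im = e * y := by simp
  rw [h1, h2, neg_le_neg_iff]
  exact mul_le_mul_of_nonneg_left (mul_le_mul_of_nonneg_left hy (he hc)) (by positivity)

theorem summable_norm_of_hasSum (h : ∀ τ : ℍ, HasSum (fun i => c i * ef (e i * τ)) (f τ)) {y : ℝ}
    (hy : 0 < y) : Summable fun i => ‖c i * ef (e i * (y * Complex.I))‖ :=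
  (h ⟨y * Complex.I, by simpa using hy⟩).summable.norm

theorem isBoundedAtImInfty_of_hasSum (he : ∀ i, c i ≠ 0 → 0 ≤ e i)
    (h : ∀ τ : ℍ, HasSum (fun i => c i * ef (e i * τ)) (f τ)) : IsBoundedAtImInfty f := by
  refine isBoundedAtImInfty_iff.mpr
    ⟨∑' i, ‖c i * ef (e i * ((1 : ℝ) * Complex.I))‖, 1, fun τ hτ => ?_⟩
  rw [← (h τ).tsum_eq]
  exact tsum_of_norm_bounded (summable_norm_of_hasSum h one_pos).hasSum
    fun i => norm_mul_ef_le (he i) hτ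

/-- With nonnegative exponents, the terms on `Im w > y` are dominated by those at `iy`; taking `y`
to be half the imaginary part gives local uniform convergence. -/
theorem mdifferentiable_of_hasSum (he : ∀ i, c i ≠ 0 → 0 ≤ e i)
    (h : ∀ τ : ℍ, HasSum (fun i => c i * ef (e i * τ)) (f τ)) : MDiff f := by
  rw [UpperHalfPlane.mdifferentiable_iff]
  intro x hx
  refine DifferentiableAt.differentiableWithinAt ?_
  have hx : 0 < x.im := hx
  have hopen : IsOpen {w : ℂ | x.im / 2 < w.im} := isOpen_lt continuous_const Complex.continuous_im
  have hmem : x ∈ {w : ℂ | x.im / 2 < w.im} := half_lt_self hx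
  have h1 : DifferentiableOn ℂ (fun w => ∑' i, c i * ef (e i * w)) {w : ℂ | x.im / 2 < w.im} := by
    refine differentiableOn_tsum_of_summable_norm
      (summable_norm_of_hasSum h (half_pos hx)) (fun i => ?_) hopen
      fun i w hw => norm_mul_ef_le (he i) (le_of_lt hw)
    unfold ef
    fun_prop
  refine (h1.differentiableAt (hopen.mem_nhds hmem)).congr_of_eventuallyEq ?_
  filter_upwards [hopen.mem_nhds hmem] with w hw
  have hw : 0 < w.im := (half_pos hx).trans hw
  rw [Function.comp_apply, ← (h _).tsum_eq, coe_ofComplex hw]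

end Series

variable {K : Type*} [Field K] [NumberField K] {ι : K →+* ℂ}

/-- `W_D` factors as `(1 0; N 1)T^y` times `(D 0; 0 1)`, with the first factor in `SL₂(ℤ)`. -/
theorem toElliptic_eq_slash {k N : ℕ} {y : ℤ} (hD : 0 < absDisc K) (φ : ℍ → ℂ → ℂ → ℂ) (τ : ℍ) :
    toElliptic ι k N y φ τ = (thetaComponent ι φ 0 ∣[(k : ℤ) - 1]
      (lowerT N * ModularGroup.T ^ y)) (ofComplex ((absDisc K : ℂ) * τ)) := by
  rw [slash_eq, toElliptic, slashW]
  have e00 : (!![1, 0; (N : ℤ), 1] * !![(absDisc K : ℤ), y; 0, 1]) 0 0 = (absDisc K : ℤ) := by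
    simp [Matrix.mul_apply, Fin.sum_univ_two]
  have e01 : (!![1, 0; (N : ℤ), 1] * !![(absDisc K : ℤ), y; 0, 1]) 0 1 = y := by
    simp [Matrix.mul_apply, Fin.sum_univ_two]
  have e10 : (!![1, 0; (N : ℤ), 1] * !![(absDisc K : ℤ), y; 0, 1]) 1 0 = N * (absDisc K : ℤ) := by
    simp [Matrix.mul_apply, Fin.sum_univ_two]
  have e11 : (!![1, 0; (N : ℤ), 1] * !![(absDisc K : ℤ), y; 0, 1]) 1 1 = N * y + 1 := by
    simp [Matrix.mul_apply, Fin.sum_univ_two]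
  obtain ⟨γ, hγ⟩ : ∃ γ : SL(2, ℤ), γ = lowerT N * ModularGroup.T ^ y := ⟨_, rfl⟩
  have g00 : γ 0 0 = 1 := by rw [hγ, SL_mul_apply]; simp
  have g01 : γ 0 1 = y := by rw [hγ, SL_mul_apply]; simp
  have g10 : γ 1 0 = N := by rw [hγ, SL_mul_apply]; simp
  have g11 : γ 1 1 = N * y + 1 := by rw [hγ, SL_mul_apply]; simp
  rw [← hγ, e00, e01, e10, e11]
  have him := im_mul_pos hD τ
  have h1 : ofComplex ((((absDisc K : ℤ) : ℂ) * τ + (y : ℤ)) /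
      (((N * (absDisc K : ℤ) : ℤ) : ℂ) * τ + ((N * y + 1 : ℤ) : ℂ))) =
      γ • (ofComplex ((absDisc K : ℂ) * τ) : ℍ) := by
    rw [← ofComplex_apply (γ • (ofComplex ((absDisc K : ℂ) * τ) : ℍ))]
    congr 1
    rw [coe_SL_smul, coe_ofComplex him, g00, g01, g10, g11]
    push_cast
    ring
  rw [h1, g10, g11, coe_ofComplex him]
  congr 2
  push_cast
  ring

namespace IsImaginaryQuadratic

theorem chi_natCast_mul_self (hK : IsImaginaryQuadratic ι) {N : ℕ} (hN : Nat.Coprime (absDisc K) N) :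
    (chi (absDisc K) N : ℂ) * chi (absDisc K) N = 1 := by
  have := hK.fund.chi_mul_self (a := N) (Nat.isCoprime_iff_coprime.mpr hN.symm)
  exact_mod_cast this

/-- As row zero of `ρ((1 0; N 1)T^y)` is constant, the slashed component `g_0` is a multiple of `∑
g_u`, that is, of `g(τ/D)`. Evaluated at `Dτ` it gives `g`, and `χ(N)² = 1` together with
`(i/√D)(-i√D) = 1` makes the constant equal to `1`. -/
theorem toElliptic_phiLift {k N : ℕ} [NeZero (absDisc K * N)]
    {g : MFGamma1 (absDisc K * N) ((k : ℤ) - 1)} (hK : IsImaginaryQuadratic ι)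
    (hN : Nat.Coprime (absDisc K) N) {y : ℤ} (hy : (N : ℤ) * y ≡ -1 [ZMOD absDisc K])
    (hg : g ∈ plusForms ι ((k : ℤ) - 1) N) : toElliptic ι k N y (phiLift ι N g) = ⇑g := by
  classical
  have := hK.finite_discGroup
  have : Fintype (DiscGroup ι) := Fintype.ofFinite _
  have hD := hK.fund.pos
  funext τ
  rw [toElliptic_eq_slash hD, phiLift_eq,
    hK.thetaComponent_sum_theta (hK.hasSum_liftComponent (g := g)),
    hK.liftComponent_slash hN hg (by rw [SL_mul_apply]; simp)]
  simp only [hK.weil_lowerT_mul_T hy]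
  rw [← Finset.mul_sum]
  have h1 := hK.sum_liftComponent hg 0 (ofComplex ((absDisc K : ℂ) * τ))
  simp only [Int.cast_zero, zero_mul, neg_zero, zero_div, ef_zero, one_mul, zpow_zero,
    one_smul] at h1
  have hDc : (absDisc K : ℂ) ≠ 0 := by exact_mod_cast hD.ne'
  have h2 : rescaled (absDisc K) g (ofComplex ((absDisc K : ℂ) * τ)) = g τ := by
    rw [rescaled, coe_ofComplex (im_mul_pos hD τ), mul_div_cancel_left₀ _ hDc, ofComplex_apply]
  rw [h1, h2]
  have hs := sqrt_ne_zero hD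
  have hc := hK.chi_natCast_mul_self hN
  simp only [map_mul, map_div₀, map_neg, Complex.conj_I, Complex.conj_ofReal, map_intCast]
  field_simp
  linear_combination (-(g τ) * (chi (absDisc K) N : ℂ) ^ 2) * Complex.I_sq + g τ * hc

end IsImaginaryQuadratic

end

/-! ### From special Jacobi forms back to plus forms -/

section


variable {K : Type*} [Field K] [NumberField K] {ι : K →+* ℂ}

namespace IsImaginaryQuadratic

section Components

variable [Fintype (DiscGroup ι)]

/-- The components of a theta expansion are bounded at infinity if the expansion has a Fourier
expansion. -/
theorem isBoundedAtImInfty_component (hK : IsImaginaryQuadratic ι) {ν : ℕ} (hν : 0 < ν)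
    {c : ℕ → invDiff ι → ℂ} {H : DiscGroup ι → ℍ → ℂ}
    (h : HasFourierExpansion ι 1 ν c (fun τ z w => ∑ u, H u τ * theta ι u τ z w))
    (u : DiscGroup ι) : IsBoundedAtImInfty (H u) := by
  obtain ⟨t, rfl⟩ := QuotientAddGroup.mk_surjective u
  have hν' : (0 : ℝ) < ν := by exact_mod_cast hν
  -- The support condition `ν|t|² ≤ n` is what makes the exponents `n/ν - |t|²` of the component
  -- nonnegative.
  refine isBoundedAtImInfty_of_hasSum (c := fun n => c n t)
    (e := fun n : ℕ => (n : ℝ) / ν - Complex.normSq (t : ℂ)) (fun n hn => ?_) fun τ => ?_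
  · rw [sub_nonneg, le_div_iff₀' hν']
    by_contra hlt
    push Not at hlt
    exact hn (h.1 n t (by simpa using hlt))
  · obtain ⟨h1, h2⟩ := hasSum_fiber h τ
    have h3 := hK.fourier_unique_invDiff (c := fun t : invDiff ι =>
      (∑' ℓ : ℕ, c ℓ t * ef ((ℓ : ℂ) / ν * τ)) -
        H (QuotientAddGroup.mk t) τ * ef (Complex.normSq (t : ℂ) * τ)) (fun z w => by
      have h4 := (h2 z w).sub (hK.hasSum_mul_theta (fun u => H u τ) τ z w)
      rw [sub_self] at h4
      refine h4.congr_fun fun t => ?_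
      rw [thTerm, add_assoc, ef_add ((Complex.normSq (t : ℂ) : ℂ) * τ), sub_mul, mul_assoc]) t
    have h5 := (h1 t).hasSum.mul_left (ef (-(Complex.normSq (t : ℂ) * τ)))
    rw [sub_eq_zero.mp h3, mul_left_comm, ← ef_add, neg_add_cancel, ef_zero, mul_one] at h5
    refine h5.congr_fun fun n => ?_
    rw [mul_left_comm, ← ef_add]
    congr 2
    push_cast
    ring

variable [DecidableEq (DiscGroup ι)]

/-- By unitarity each `f_u|A` is a combination of the components of the slashed form, and those are
bounded. -/
theorem isBoundedAtImInfty_component_slash (hK : IsImaginaryQuadratic ι) {k : ℤ} (A : SL(2, ℤ))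
    {f : DiscGroup ι → ℍ → ℂ} {ν : ℕ} (hν : 0 < ν) {c : ℕ → invDiff ι → ℂ}
    (h : HasFourierExpansion ι 1 ν c
      (slashJ k 1 1 A (fun τ z w => ∑ u, f u τ * theta ι u τ z w))) (u : DiscGroup ι) :
    IsBoundedAtImInfty (f u ∣[k - 1] A) := by
  rw [hK.slashJ_sum_theta] at h
  have h1 : f u ∣[k - 1] A = ∑ v, (starRingEnd ℂ) (hK.weil A u v) •
      fun τ => ∑ u, hK.weil A u v * (f u ∣[k - 1] A) τ := by
    funext τ
    rw [Finset.sum_apply]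
    simp only [Pi.smul_apply, smul_eq_mul, Finset.mul_sum]
    rw [Finset.sum_comm]
    have h2 : ∀ u', ∑ v, (starRingEnd ℂ) (hK.weil A u v) * (hK.weil A u' v * (f u' ∣[k - 1] A) τ) =
        if u' = u then (f u' ∣[k - 1] A) τ else 0 := by
      intro u'
      have h3 := congrFun (congrFun (hK.weil_mul_conjTranspose A) u') u
      rw [Matrix.mul_apply, Matrix.one_apply] at h3
      simp only [Matrix.conjTranspose_apply, ← starRingEnd_apply] at h3
      rw [← one_mul ((f u' ∣[k - 1] A) τ), ← zero_mul ((f u' ∣[k - 1] A) τ), ← ite_mul, ← h3,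
        Finset.sum_mul]
      exact Finset.sum_congr rfl fun v' _ => by ring
    simp only [h2, Finset.sum_ite_eq', Finset.mem_univ, if_true]
  rw [h1]
  refine Finset.sum_induction _ IsBoundedAtImInfty (fun a b ha hb => ha.add hb)
    (Filter.const_boundedAtFilter _ (0 : ℂ)) fun v _ => ?_
  exact (hK.isBoundedAtImInfty_component hν h v).const_smul_left _

/-- Summing the transformation law over all classes leaves the column sums of `ρ(A)`, which are `χ`.
-/
theorem sum_slash_Gamma0 (hK : IsImaginaryQuadratic ι) {k : ℤ} {A : SL(2, ℤ)}
    (hA : (absDisc K : ℤ) ∣ A 0 1) {f : DiscGroup ι → ℍ → ℂ}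
    (h : ∀ v τ, (f v ∣[k] A) τ = ∑ u, (starRingEnd ℂ) (hK.weil A v u) * f u τ) :
    (fun τ => ∑ u, f u τ) ∣[k] A = (chi (absDisc K) (A 1 1) : ℂ) • fun τ => ∑ u, f u τ := by
  funext τ
  rw [slash_eq, Finset.mul_sum]
  simp only [← slash_eq, h]
  rw [Finset.sum_comm, Pi.smul_apply, smul_eq_mul, Finset.mul_sum]
  refine Finset.sum_congr rfl fun u _ => ?_
  rw [← Finset.sum_mul, ← map_sum, hK.sum_weil_col hA, map_intCast]

end Components

/-- `(D 0; 0 1)γ` sends `∞` to a rational cusp, where boundedness of `F` is already known. -/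
theorem isBoundedAt_rescaled {D : ℕ} (hD : 0 < D) {k : ℤ} {F : ℍ → ℂ}
    (hF : ∀ A : SL(2, ℤ), IsBoundedAtImInfty (F ∣[k] A)) {c : OnePoint ℝ} (hc : IsCusp c 𝒮ℒ) :
    c.IsBoundedAt (F ∣[k] upperDiag hD) k := by
  rw [OnePoint.isBoundedAt_iff_forall_SL2Z hc]
  intro γ _
  have hcusp : IsCusp ((upperDiag hD * Matrix.SpecialLinearGroup.mapGL ℝ γ) •
      (OnePoint.infty : OnePoint ℝ)) 𝒮ℒ := by
    refine isCusp_smul_infty _ (a := D * γ 0 0) (c := γ 1 0) ?_ ?_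
    · rw [Units.val_mul, Matrix.mul_apply, Fin.sum_univ_two, mapGL_apply, mapGL_apply]
      simp [upperDiag]
    · rw [Units.val_mul, Matrix.mul_apply, Fin.sum_univ_two, mapGL_apply, mapGL_apply]
      simp [upperDiag]
  have h1 := (OnePoint.isBoundedAt_iff_forall_SL2Z (f := F) (k := k) hcusp).mpr
    (fun A _ => hF A) _ rfl
  rw [SlashAction.slash_mul] at h1
  exact h1

/-- Every special Jacobi form is a lift. -/
theorem exists_phiLift_eq (hK : IsImaginaryQuadratic ι) {k N : ℕ} [NeZero (absDisc K * N)]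
    (hN : Nat.Coprime (absDisc K) N) {φ : ℍ → ℂ → ℂ → ℂ} (hφ : φ ∈ specialJacobiForms ι k N) :
    ∃ g ∈ plusForms ι ((k : ℤ) - 1) N, phiLift ι N g = φ := by
  classical
  have := hK.finite_discGroup
  have : Fintype (DiscGroup ι) := Fintype.ofFinite _
  have hD := hK.fund.pos
  have hDc : (absDisc K : ℂ) ≠ 0 := by exact_mod_cast hD.ne'
  obtain ⟨hJ, hsp⟩ := hφ
  have hJ : IsJacobiForm ι k 1 N φ := hJ
  obtain ⟨hsum, hdec⟩ := hK.theta_decomposition hsp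
  obtain ⟨f, hf⟩ : ∃ f, f = thetaComponent ι φ := ⟨_, rfl⟩
  rw [← hf] at hsum hdec
  set F : ℍ → ℂ := fun τ => ∑ u, f u τ with hF
  -- The exponent `ℓ` appears in `a_D(ℓ)` of the components, so the plus condition will hold
  -- automatically.
  have hFsum : ∀ τ : ℍ, HasSum (fun ℓ : ℕ => (aD ι ℓ : ℂ) * alphaStar ι φ ℓ *
      ef ((ℓ : ℂ) * τ / absDisc K)) (F τ) := by
    intro τ
    refine (hasSum_sum (s := Finset.univ) fun u _ => hsum u τ).congr_fun fun ℓ => ?_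
    have h1 : ∀ u : DiscGroup ι, (ℓ : ℤ) ≡ -normD ι u [ZMOD absDisc K] ↔
        normD ι u ≡ -ℓ [ZMOD absDisc K] := fun u =>
      ⟨fun h => by simpa using h.neg.symm, fun h => by simpa using h.neg.symm⟩
    simp only [h1]
    rw [← Finset.sum_filter, Finset.sum_const, nsmul_eq_mul, aD, Nat.card_eq_fintype_card,
      Fintype.card_subtype]
    ring
  have hweil : ∀ A : SL(2, ℤ), (N : ℤ) ∣ A 1 0 → ∀ v τ,
      (f v ∣[(k : ℤ) - 1] A) τ = ∑ u, (starRingEnd ℂ) (hK.weil A v u) * f u τ := by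
    intro A hA
    rw [← hK.slashJ_sum_theta_eq_iff, ← hdec]
    have := hJ.modular 1 A (by rwa [Gamma0_mem, ZMod.intCast_zmod_eq_zero_iff_dvd])
    simpa using this
  have hFbdd : ∀ A : SL(2, ℤ), IsBoundedAtImInfty (F ∣[(k : ℤ) - 1] A) := by
    intro A
    obtain ⟨ν, hν, -, c, hc⟩ := hJ.fourier A
    rw [hdec] at hc
    have h1 : F ∣[(k : ℤ) - 1] A = ∑ u, (f u ∣[(k : ℤ) - 1] A) := by
      funext τ
      rw [slash_eq, hF, Finset.mul_sum, Finset.sum_apply]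
      exact Finset.sum_congr rfl fun u _ => (slash_eq _ _ _ _).symm
    rw [h1]
    exact Finset.sum_induction _ IsBoundedAtImInfty (fun a b ha hb => ha.add hb)
      (Filter.const_boundedAtFilter _ (0 : ℂ)) fun u _ =>
        hK.isBoundedAtImInfty_component_slash A hν hc u
  -- The inverse of the constant `χ(N)(-i√D)` in the lift, because `χ(N)² = 1`.
  set C : ℂ := (chi (absDisc K) N : ℂ) * (Complex.I / (Real.sqrt (absDisc K) : ℂ)) with hC
  set E : ℍ → ℂ := fun τ => C * F (ofComplex ((absDisc K : ℂ) * τ)) with hE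
  have hEsum : ∀ τ : ℍ, HasSum (fun ℓ : ℕ => (C * ((aD ι ℓ : ℂ) * alphaStar ι φ ℓ)) *
      ef (((ℓ : ℝ) : ℂ) * τ)) (E τ) := by
    intro τ
    refine ((hFsum (ofComplex ((absDisc K : ℂ) * τ))).mul_left C).congr_fun fun ℓ => ?_
    rw [coe_ofComplex (im_mul_pos hD τ), mul_assoc C]
    congr 3
    push_cast
    field_simp
  have hEslash : E = (C * ((absDisc K : ℂ) ^ ((k : ℤ) - 1 - 1))⁻¹) •
      (F ∣[(k : ℤ) - 1] upperDiag hD) := by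
    funext τ
    rw [Pi.smul_apply, slash_upperDiag, smul_eq_mul, mul_assoc,
      inv_mul_cancel_left₀ (zpow_ne_zero _ hDc)]
  have hEmod : ∀ γ ∈ Gamma0 (absDisc K * N),
      E ∣[(k : ℤ) - 1] γ = (chi (absDisc K) (γ 1 1) : ℂ) • E := by
    intro γ hγ
    rw [Gamma0_mem, ZMod.intCast_zmod_eq_zero_iff_dvd] at hγ
    obtain ⟨c, hc⟩ := hγ
    have hdet := SL_det γ
    -- The conjugate of `γ` by `(D 0; 0 1)`; it lies in `Γ₀(N) ∩ Γ⁰(D)`.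
    obtain ⟨δ, d00, d01, d10, d11⟩ : ∃ δ : SL(2, ℤ), δ 0 0 = γ 0 0 ∧ δ 0 1 = absDisc K * γ 0 1 ∧
        δ 1 0 = N * c ∧ δ 1 1 = γ 1 1 :=
      ⟨⟨!![γ 0 0, absDisc K * γ 0 1; N * c, γ 1 1], by
        rw [Matrix.det_fin_two_of]
        rw [hc] at hdet
        push_cast at hdet
        linarith⟩, rfl, rfl, rfl, rfl⟩
    have h1 := hK.sum_slash_Gamma0 (A := δ) ⟨_, d01⟩ (hweil δ ⟨c, d10⟩)
    funext τ
    have h2 := congrFun h1 (ofComplex ((absDisc K : ℂ) * τ))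
    have hj := SL_denom_ne_zero γ τ
    have h3 : δ • (ofComplex ((absDisc K : ℂ) * τ) : ℍ) =
        ofComplex ((absDisc K : ℂ) * ((γ • τ : ℍ) : ℂ)) := by
      ext1
      rw [coe_ofComplex (im_mul_pos hD _), coe_SL_smul, coe_SL_smul,
        coe_ofComplex (im_mul_pos hD _), d00, d01, d10, d11]
      have e4 : ((N * c : ℤ) : ℂ) * (absDisc K * τ) = γ 1 0 * τ := by
        rw [hc]; push_cast; ring
      rw [e4]
      push_cast
      field_simp
    rw [slash_eq, h3, d10, d11, coe_ofComplex (im_mul_pos hD _)] at h2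
    have e4 : ((N * c : ℤ) : ℂ) * (absDisc K * τ) = γ 1 0 * τ := by
      rw [hc]; push_cast; ring
    rw [e4, Pi.smul_apply, smul_eq_mul] at h2
    rw [slash_eq, Pi.smul_apply, smul_eq_mul]
    simp only [hE, hF]
    linear_combination C * h2
  let g : MFGamma1 (absDisc K * N) ((k : ℤ) - 1) :=
    { toFun := E
      slash_action_eq' := by
        rintro _ ⟨γ, hγ, rfl⟩
        have hγ' := hγ
        rw [SetLike.mem_coe, Gamma1_mem] at hγ'
        have h1 := hEmod γ (Gamma1_in_Gamma0 _ hγ)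
        have h11 : γ 1 1 ≡ 1 [ZMOD absDisc K] := by
          have h2 := (ZMod.intCast_eq_intCast_iff (γ 1 1) 1 (absDisc K * N)).mp
            (by rw [hγ'.2.1, Int.cast_one])
          exact h2.of_dvd (by push_cast; exact dvd_mul_right _ _)
        rw [hK.fund.chi_congr h11, chi_one, Int.cast_one, one_smul] at h1
        exact h1
      holo' := mdifferentiable_of_hasSum (fun ℓ _ => Nat.cast_nonneg _) hEsum
      bdd_at_cusps' := by
        intro c hc
        rw [Subgroup.IsArithmetic.isCusp_iff_isCusp_SL2Z] at hc
        show c.IsBoundedAt E _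
        rw [OnePoint.isBoundedAt_iff_forall_SL2Z hc]
        intro γ hγ
        have h1 := (OnePoint.isBoundedAt_iff_forall_SL2Z hc).mp
          (isBoundedAt_rescaled hD hFbdd hc) γ hγ
        rw [hEslash, ModularForm.SL_smul_slash]
        exact h1.const_smul_left _ }
  have hgE : ⇑g = E := rfl
  have hcoeff : ∀ ℓ : ℕ, coeff g ℓ = C * ((aD ι ℓ : ℂ) * alphaStar ι φ ℓ) := by
    intro ℓ
    refine (ModularFormClass.qExpansion_coeff_unique (f := g) one_pos
      (one_mem_strictPeriods _) (c := fun ℓ => C * ((aD ι ℓ : ℂ) * alphaStar ι φ ℓ))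
      (fun τ => (hEsum τ).congr_fun fun m => ?_) ℓ).symm
    have h1 := qParam_pow_eq 1 τ m
    rw [Nat.cast_one] at h1
    rw [h1, smul_eq_mul]
    push_cast
    rw [div_one]
  refine ⟨g, ⟨hEmod, fun ℓ h0 => ?_⟩, ?_⟩
  · rw [hcoeff, h0, Nat.cast_zero, zero_mul, mul_zero]
  · rw [phiLift_eq, hdec]
    funext τ z w
    refine Finset.sum_congr rfl fun u _ => ?_
    congr 1
    -- Dividing by `a_D(ℓ)` is legitimate here, since `ℓ ≡ -D|u|²` makes `u` itself one of the
    -- classes counted.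
    refine (hK.hasSum_liftComponent (g := g) u τ).unique ((hsum u τ).congr_fun fun ℓ => ?_)
    split_ifs with h
    · have hne : (aD ι ℓ : ℂ) ≠ 0 := by exact_mod_cast aD_ne_zero u h
      have hs := sqrt_ne_zero hD
      have hc := hK.chi_natCast_mul_self hN
      congr 1
      rw [hcoeff, hC]
      field_simp
      linear_combination (-alphaStar ι φ ℓ * (chi (absDisc K) N : ℂ) ^ 2) * Complex.I_sq +
        alphaStar ι φ ℓ * hc
    · rfl

end IsImaginaryQuadratic

end

/-! ### The linear isomorphism -/

section


variable {K : Type*} [Field K] [NumberField K] {ι : K →+* ℂ}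

namespace IsImaginaryQuadratic

variable {N : ℕ} [NeZero (absDisc K * N)] {κ : ℤ}

theorem liftComponent_add (hK : IsImaginaryQuadratic ι) (g h : MFGamma1 (absDisc K * N) κ)
    (u : DiscGroup ι) (τ : ℍ) :
    liftComponent ι N (g + h) u τ = liftComponent ι N g u τ + liftComponent ι N h u τ := by
  refine (hK.hasSum_liftComponent (g := g + h) u τ).unique
    (((hK.hasSum_liftComponent (g := g) u τ).add
      (hK.hasSum_liftComponent (g := h) u τ)).congr_fun fun ℓ => ?_)
  split_ifs
  · rw [coeff_add]; ring
  · rw [add_zero]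

theorem liftComponent_smul (hK : IsImaginaryQuadratic ι) (c : ℂ) (g : MFGamma1 (absDisc K * N) κ)
    (u : DiscGroup ι) (τ : ℍ) : liftComponent ι N (c • g) u τ = c * liftComponent ι N g u τ := by
  refine (hK.hasSum_liftComponent (g := c • g) u τ).unique
    (((hK.hasSum_liftComponent (g := g) u τ).mul_left c).congr_fun fun ℓ => ?_)
  split_ifs
  · rw [coeff_smul]; ring
  · rw [mul_zero]

/-- The lift `g ↦ φ_g` as a linear map. -/
def phiLiftHom (hK : IsImaginaryQuadratic ι) (hN : Nat.Coprime (absDisc K) N) (k : ℕ) :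
    plusForms ι ((k : ℤ) - 1) N →ₗ[ℂ] specialJacobiForms ι k N where
  toFun g := ⟨phiLift ι N g.1, hK.phiLift_mem hN g.2⟩
  map_add' g h := by
    have := hK.finite_discGroup
    have : Fintype (DiscGroup ι) := Fintype.ofFinite _
    refine Subtype.ext ?_
    show phiLift ι N (g.1 + h.1) = phiLift ι N g.1 + phiLift ι N h.1
    simp only [phiLift_eq]
    funext τ z w
    simp only [hK.liftComponent_add, add_mul, Finset.sum_add_distrib, Pi.add_apply]
  map_smul' c g := by
    have := hK.finite_discGroup
    have : Fintype (DiscGroup ι) := Fintype.ofFinite _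
    refine Subtype.ext ?_
    show phiLift ι N (c • g.1) = c • phiLift ι N g.1
    simp only [phiLift_eq]
    funext τ z w
    simp only [hK.liftComponent_smul, mul_assoc, Finset.mul_sum, Pi.smul_apply, smul_eq_mul]

/-- Injectivity holds because `ι` recovers `g` from its lift; surjectivity is `exists_phiLift_eq`.
-/
theorem phiLiftHom_bijective (hK : IsImaginaryQuadratic ι) (hN : Nat.Coprime (absDisc K) N) (k : ℕ)
    {y : ℤ} (hy : (N : ℤ) * y ≡ -1 [ZMOD absDisc K]) :
    Function.Bijective (hK.phiLiftHom hN k) := by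
  constructor
  · intro g h hgh
    have h1 : phiLift ι N g.1 = phiLift ι N h.1 := congrArg Subtype.val hgh
    refine Subtype.ext (DFunLike.coe_injective ?_)
    rw [← hK.toElliptic_phiLift hN hy g.2, ← hK.toElliptic_phiLift hN hy h.2, h1]
  · rintro ⟨φ, hφ⟩
    obtain ⟨g, hg, rfl⟩ := hK.exists_phiLift_eq hN hφ
    exact ⟨⟨g, hg⟩, rfl⟩

end IsImaginaryQuadratic

end

end HermitianMaass

end

theorem theorem5p1 {K : Type*} [Field K] [NumberField K] (ι : K →+* ℂ)
    (hdeg : Module.finrank ℚ K = 2) (hdisc : NumberField.discr K < 0)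
    (k : ℕ) (hk : Nat.card (NumberField.RingOfIntegers K)ˣ ∣ k)
    (N : ℕ) (hN : Nat.Coprime (absDisc K) N)
    (y : ℤ) (hy : (N : ℤ) * y ≡ -1 [ZMOD (absDisc K : ℤ)]) :
    (∀ g ∈ plusForms ι ((k : ℤ) - 1) N,
      phiLift ι N g ∈ specialJacobiForms ι k N ∧
      toElliptic ι k N y (phiLift ι N g) = ⇑g) ∧
    ∃ Φ : specialJacobiForms ι k N ≃ₗ[ℂ] plusForms ι ((k : ℤ) - 1) N,
      (∀ φ : specialJacobiForms ι k N,
        toElliptic ι k N y (φ : ℍ → ℂ → ℂ → ℂ) = ⇑(Φ φ).1) ∧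
      ∀ g : plusForms ι ((k : ℤ) - 1) N,
        ((Φ.symm g : specialJacobiForms ι k N) : ℍ → ℂ → ℂ → ℂ) =
          phiLift ι N g.1 := by
  have hK : IsImaginaryQuadratic ι :=
    ⟨isFundamental_absDisc hdeg hdisc, mem_intLattice ι hdeg hdisc⟩
  -- For `N = 0` coprimality would force `D = 1`, whereas `D > 2`.
  have hN0 : N ≠ 0 := by
    rintro rfl
    have h1 := hK.fund.two_lt
    rw [Nat.coprime_zero_right] at hN
    omega
  have : NeZero (absDisc K * N) := ⟨Nat.mul_ne_zero hK.fund.pos.ne' hN0⟩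
  -- `Φ` is the inverse of the lift, so the formula for `Φ.symm` is definitional, and the formula
  -- for `Φ` follows by writing `φ` as a lift.
  refine ⟨fun g hg => ⟨hK.phiLift_mem hN hg, hK.toElliptic_phiLift hN hy hg⟩,
    (LinearEquiv.ofBijective _ (hK.phiLiftHom_bijective hN k hy)).symm, fun φ => ?_, fun g => rfl⟩
  obtain ⟨g, rfl⟩ := (LinearEquiv.ofBijective _ (hK.phiLiftHom_bijective hN k hy)).surjective φ
  rw [LinearEquiv.symm_apply_apply]
  exact hK.toElliptic_phiLift hN hy g.2
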